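/- Let $p\ge 5$ be a prime, let $\mathcal O$ be the ring of integers of a finite extension of $\mathbb Q_p$, and let $$S=\mathcal O[\![a_0,a_1,b_0c,b_1c]\!][b_0,b_1,c]/(pb_0+a_1b_0+a_0b_1)$$ (that is, $\mathcal O[\![a_0,a_1,Y_0,Y_1]\!][b_0,b_1,c]$ modulo $Y_0=b_0c$, $Y_1=b_1c$ and $pb_0+a_1b_0+a_0b_1=0$), $\mathbb Z$-graded with $b_0,b_1$ in degree $2$, $c$ in degree $-2$ and $\mathcal O[\![a_0,a_1,b_0c,b_1c]\!]$ in degree $0$. Put $R=S_0$ and $a_1'=a_1+p$. Let $\mathfrak X=[\operatorname{Spec}S/\mathbb G_m]$, so that $\operatorname{Coh}(\mathfrak X)$ is the category of finitely generated $\mathbb Z$-graded $S$-modules with degree-preserving maps. Let $L_n=S(n)$, i.e. $(L_n)_k=S_{n+k}$, and $$Q=\operatorname{coker}\Big(M=\begin{pmatrix} b_0&b_1\\-a_0&a_1'\end{pmatrix}:L_{-1}\oplus L_{-1}\to L_1\oplus L_{-1}\Big),\qquad X=L_{-1}\oplus L_1\oplus Q$$ (elements of direct sums are column vectors, matrices act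 from the left). Consider the morphisms, for $i=0,1$: * $\varphi_{12}=c:L_1\to L_{-1}$, and $\varphi_{21}^i=b_i:L_{-1}\to L_1$; * $\varphi_{13}^0=(a_0c,b_0c)$, $\varphi_{13}^1=(-a_1'c,b_1c):Q\to L_{-1}$, and $\varphi_{23}^0=(a_0,b_0)$, $\varphi_{23}^1=(-a_1',b_1):Q\to L_1$ (induced by row vectors on $L_1\oplus L_{-1}$); * $\varphi_{31}=\binom01:L_{-1}\to Q$, and $\varphi_{32}=\binom0c$, $\beta=\binom10:L_1\to Q$. Then: (a) $\operatorname{Ext}^i_S(Q,S)=0$ for all $i\ge1$ (ungraded modules); $Q$ is a maximal Cohen–Macaulay $S$-module, and it is not locally free (not projective over $S$). (b) For all $i\ge1$: $\operatorname{Ext}^i_{\mathfrak X}(Q,L_n)=0$ for all $n\in\mathbb Z$, $\operatorname{Ext}^i_{\mathfrak X}(Q,Q)=0$, and $\operatorname{Ext}^i_{\mathfrak X}(X,X)=0$. (c) As $R$-modules: $\operatorname{End}(L_{-1})$, $\operatorname{End}(L_1)$, $\operatorname{End}(Q)$ are free of rank $1$ on the identities; $\operatorname{Hom}(L_1,L_{-1})$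 and $\operatorname{Hom}(L_{-1},Q)$ are free of rank $1$ on $\varphi_{12}$ and $\varphi_{31}$; $\operatorname{Hom}(Q,L_{-1})\cong b_0cR+b_1cR$ with $\varphi_{13}^i\leftrightarrow b_ic$; $\operatorname{Hom}(L_{-1},L_1)\cong b_0R+b_1R\subset S$ with $\varphi_{21}^i\leftrightarrow b_i$; $\operatorname{Hom}(Q,L_1)\cong b_0R+b_1R$ with $\varphi_{23}^i\leftrightarrow b_i$; $\operatorname{Hom}(L_1,Q)$ is generated by $\beta,\varphi_{32}$, its module of relations is generated by $b_0c\,\beta=a_0\varphi_{32}$ and $b_1c\,\beta=-a_1'\varphi_{32}$, and $\operatorname{Hom}(L_1,Q)\cong(a_0,b_0c)\subset R$ with $\beta\leftrightarrow a_0$, $\varphi_{32}\leftrightarrow b_0c$. (d) For $i,j\in\{0,1\}$ (a scalar in $R$ stands for that multiple of the identity): 1. $\varphi_{12}\circ\varphi_{21}^i=b_ic$; 2. $\varphi_{12}\circ\varphi_{23}^i=\varphi_{13}^i$; 3. $\varphi_{13}^i\circ\varphi_{31}=b_ic$; 4. $\varphi_{21}^i\circ\varphi_{12}=b_ic$; 5.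 $\varphi_{21}^i\circ\varphi_{13}^j=b_ic\,\varphi_{23}^j$; 6. $\varphi_{23}^i\circ\varphi_{31}=\varphi_{21}^i$; 7. $\varphi_{31}\circ\varphi_{12}=\varphi_{32}$; 8. $\varphi_{31}\circ\varphi_{13}^i=b_ic$; 9. $\varphi_{13}^i\circ\varphi_{32}=b_ic\,\varphi_{12}$, $\varphi_{13}^0\circ\beta=a_0\varphi_{12}$, $\varphi_{13}^1\circ\beta=-a_1'\varphi_{12}$; 10. $\varphi_{23}^i\circ\varphi_{32}=b_ic$, $\varphi_{23}^0\circ\beta=a_0$, $\varphi_{23}^1\circ\beta=-a_1'$; 11. $\varphi_{32}\circ\varphi_{21}^i=b_ic\,\varphi_{31}$, $\beta\circ\varphi_{21}^0=a_0\varphi_{31}$, $\beta\circ\varphi_{21}^1=-a_1'\varphi_{31}$; 12. $\varphi_{32}\circ\varphi_{23}^i=b_ic$, $\beta\circ\varphi_{23}^0=a_0$, $\beta\circ\varphi_{23}^1=-a_1'$. (e) These relations determine the $R$-algebra $\widetilde E=\operatorname{End}_{\mathfrak X}(X)$: it is the $3\times3$ generalized matrix $R$-algebra generated by the orthogonal idempotents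 $e_1,e_2,e_3$ with $e_1+e_2+e_3=1$ (the projections of $X$ onto $L_{-1},L_1,Q$) and by the ten morphisms above, each in its own matrix entry, subject to the twelve relations (1)–(12). -/

import Mathlib

open CategoryTheory CategoryTheory.Limits
universe u

namespace Grading

variable {M N : Type*} [AddCommGroup M] [AddCommGroup N]

theorem isInternal_of_proj (d : ℤ → AddSubgroup M) (p : ℤ → M →+ M)
    (h1 : ∀ i, ∀ x ∈ d i, p i x = x) (h2 : ∀ i j, i ≠ j → ∀ x ∈ d j, p i x = 0)
    (h3 : ∀ x, x ∈ ⨆ i, d i) : DirectSum.IsInternal d := by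
  classical
  have key : ∀ (v : DirectSum ℤ fun i => d i) (i : ℤ),
      p i (DirectSum.coeAddMonoidHom d v) = v i := by
    intro v i
    induction v using DirectSum.induction_on with
    | zero => simp
    | of j x =>
      rw [DirectSum.coeAddMonoidHom_of, DirectSum.coe_of_apply]
      split_ifs with h
      · subst h; exact h1 _ _ x.2
      · exact h2 _ _ (Ne.symm h) _ x.2
    | add x y hx hy => simp [map_add, hx, hy]
  constructor
  · intro v w h
    ext i
    have := congrArg (p i) h
    rwa [key, key] at this
  · intro x
    have : (⨆ i, d i) ≤ (DirectSum.coeAddMonoidHom d).range :=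
      iSup_le fun i x hx => ⟨DirectSum.of _ i ⟨x, hx⟩, by simp⟩
    exact this (h3 x)

/-- The projection onto the degree `i` part. -/
noncomputable def proj {d : ℤ → AddSubgroup M} (h : DirectSum.IsInternal d) (i : ℤ) : M →+ M :=
  letI := h.chooseDecomposition
  (d i).subtype.comp
    ((DFinsupp.evalAddMonoidHom i).comp (DirectSum.decomposeAddEquiv d).toAddMonoidHom)

variable {d : ℤ → AddSubgroup M} (h : DirectSum.IsInternal d)

theorem proj_mem (i : ℤ) (x : M) : proj h i x ∈ d i := by
  let _ := h.chooseDecomposition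
  exact (DirectSum.decompose d x i).2

theorem proj_of_mem (i : ℤ) (x : M) (hx : x ∈ d i) : proj h i x = x := by
  let _ := h.chooseDecomposition
  exact DirectSum.decompose_of_mem_same d hx

theorem proj_of_ne (i j : ℤ) (hij : i ≠ j) (x : M) (hx : x ∈ d j) : proj h i x = 0 := by
  let _ := h.chooseDecomposition
  exact DirectSum.decompose_of_mem_ne d hx hij.symm

theorem mem_iSup (h : DirectSum.IsInternal d) (x : M) : x ∈ ⨆ i, d i := by
  let _ := h.chooseDecomposition
  classical
  rw [← DirectSum.sum_support_decompose d x]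
  exact AddSubgroup.sum_mem _ fun i _ => le_iSup d i (DirectSum.decompose d x i).2

theorem mem_of_proj_mem (x : M) (P : AddSubgroup M) (hP : ∀ i, proj h i x ∈ P) : x ∈ P := by
  let _ := h.chooseDecomposition
  classical
  rw [← DirectSum.sum_support_decompose d x]
  exact AddSubgroup.sum_mem _ fun i _ => hP i

theorem map_proj {e : ℤ → AddSubgroup N} (h' : DirectSum.IsInternal e) (f : M →+ N)
    (hf : ∀ i, ∀ x ∈ d i, f x ∈ e i) (i : ℤ) (x : M) : f (proj h i x) = proj h' i (f x) := by
  induction mem_iSup h x using AddSubgroup.iSup_induction' with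
  | hp j x hx =>
    by_cases hij : i = j
    · subst hij; rw [proj_of_mem h _ _ hx, proj_of_mem h' _ _ (hf _ _ hx)]
    · rw [proj_of_ne h _ _ hij _ hx, proj_of_ne h' _ _ hij _ (hf _ _ hx), map_zero]
  | h1 => simp
  | hadd x y _ _ hx hy => simp [map_add, hx, hy]

theorem isInternal_comap (f : N →+ M) (hf : Function.Injective f)
    (hr : ∀ i, ∀ x ∈ f.range, proj h i x ∈ f.range) :
    DirectSum.IsInternal fun i => (d i).comap f := by
  have ex : ∀ i y, ∃ z, f z = proj h i (f y) := fun i y => hr i _ ⟨y, rfl⟩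
  choose g hg using ex
  let p : ℤ → N →+ N := fun i =>
    { toFun := g i
      map_zero' := hf (by simp [hg])
      map_add' := fun a b => hf (by simp [hg]) }
  have hp : ∀ i y, f (p i y) = proj h i (f y) := hg
  refine isInternal_of_proj _ p ?_ ?_ ?_
  · intro i x hx; exact hf (by rw [hp, proj_of_mem h _ _ hx])
  · intro i j hij x hx; exact hf (by rw [hp, proj_of_ne h _ _ hij _ hx, map_zero])
  · intro x
    have : f x ∈ (⨆ i, (d i).comap f).map f := by
      refine mem_of_proj_mem h _ _ fun i => ?_
      rw [← hp]
      refine ⟨p i x, le_iSup (fun i => (d i).comap f) i ?_, rfl⟩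
      change f (p i x) ∈ d i
      rw [hp]; exact proj_mem h _ _
    obtain ⟨y, hy, hyx⟩ := this
    rwa [← hf hyx]

theorem isInternal_map (f : M →+ N) (hf : Function.Surjective f)
    (hk : ∀ i, ∀ x ∈ f.ker, proj h i x ∈ f.ker) :
    DirectSum.IsInternal fun i => (d i).map f := by
  choose g hg using hf
  have key : ∀ i a b, f a = f b → f (proj h i a) = f (proj h i b) := by
    intro i a b hab
    have : a - b ∈ f.ker := by simp [AddMonoidHom.mem_ker, hab]
    have := hk i _ this
    rwa [AddMonoidHom.mem_ker, map_sub, map_sub, sub_eq_zero] at this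
  let p : ℤ → N →+ N := fun i =>
    { toFun := fun y => f (proj h i (g y))
      map_zero' := by rw [key i (g 0) 0 (by simp [hg])]; simp
      map_add' := fun a b => by rw [key i (g (a + b)) (g a + g b) (by simp [hg])]; simp }
  have hp : ∀ i x, p i (f x) = f (proj h i x) := fun i x => key i _ _ (hg _)
  refine isInternal_of_proj _ p ?_ ?_ ?_
  · rintro i _ ⟨x, hx, rfl⟩; rw [hp, proj_of_mem h _ _ hx]
  · rintro i j hij _ ⟨x, hx, rfl⟩; rw [hp, proj_of_ne h _ _ hij _ hx, map_zero]
  · intro y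
    rw [← hg y]
    have hle : (⨆ i, d i) ≤ (⨆ i, (d i).map f).comap f :=
      iSup_le fun i x hx => le_iSup (fun i => (d i).map f) i ⟨x, hx, rfl⟩
    exact hle (mem_iSup h (g y))

theorem isInternal_prod (h : DirectSum.IsInternal d) {e : ℤ → AddSubgroup N} (h' : DirectSum.IsInternal e) :
    DirectSum.IsInternal fun i => (d i).prod (e i) := by
  refine isInternal_of_proj _ (fun i => (proj h i).prodMap (proj h' i)) ?_ ?_ ?_
  · rintro i ⟨x, y⟩ ⟨hx, hy⟩
    exact Prod.ext (proj_of_mem h _ _ hx) (proj_of_mem h' _ _ hy)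
  · rintro i j hij ⟨x, y⟩ ⟨hx, hy⟩
    exact Prod.ext (proj_of_ne h _ _ hij _ hx) (proj_of_ne h' _ _ hij _ hy)
  · rintro ⟨x, y⟩
    have h1 : (⨆ i, d i) ≤ (⨆ i, (d i).prod (e i)).comap (AddMonoidHom.inl M N) :=
      iSup_le fun i x hx => le_iSup (fun i => (d i).prod (e i)) i ⟨hx, (e i).zero_mem⟩
    have h2 : (⨆ i, e i) ≤ (⨆ i, (d i).prod (e i)).comap (AddMonoidHom.inr M N) :=
      iSup_le fun i x hx => le_iSup (fun i => (d i).prod (e i)) i ⟨(d i).zero_mem, hx⟩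
    have := add_mem (AddSubgroup.mem_comap.1 (h1 (mem_iSup h x)))
      (AddSubgroup.mem_comap.1 (h2 (mem_iSup h' y)))
    simpa using this

theorem isInternal_shift (n : ℤ) (h : DirectSum.IsInternal d) :
    DirectSum.IsInternal fun i => d (n + i) := by
  refine isInternal_of_proj _ (fun i => proj h (n + i)) ?_ ?_ ?_
  · intro i x hx; exact proj_of_mem h _ _ hx
  · intro i j hij x hx; exact proj_of_ne h _ _ (by simpa using hij) _ hx
  · intro x
    have hle : (⨆ i, d i) ≤ ⨆ i, d (n + i) := iSup_le fun i => by
      have := le_iSup (fun i => d (n + i)) (i - n)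
      simpa using this
    exact hle (mem_iSup h x)

theorem eq_proj (p : M →+ M) (i : ℤ) (h1 : ∀ x ∈ d i, p x = x)
    (h2 : ∀ j, i ≠ j → ∀ x ∈ d j, p x = 0) (x : M) : p x = proj h i x := by
  induction mem_iSup h x using AddSubgroup.iSup_induction' with
  | hp j x hx =>
    by_cases hij : i = j
    · subst hij; rw [proj_of_mem h _ _ hx, h1 _ hx]
    · rw [proj_of_ne h _ _ hij _ hx, h2 _ hij _ hx]
  | h1 => simp
  | hadd x y _ _ hx hy => simp [map_add, hx, hy]

end Grading

/-- A `ℤ`-graded module over a commutative ring `A` with grading `𝒜`: an `A`-module `M` with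
subgroups `M_j` such that `M = ⨁ M_j` and `A_i M_j ⊆ M_{i+j}`. -/
structure GrMod {A : Type u} [CommRing A] (𝒜 : ℤ → AddSubgroup A) where
  carrier : Type u
  [addCommGroup : AddCommGroup carrier]
  [module : Module A carrier]
  deg : ℤ → AddSubgroup carrier
  isInternal : DirectSum.IsInternal deg
  smul_mem : ∀ {i j : ℤ} {a : A} {x : carrier}, a ∈ 𝒜 i → x ∈ deg j → a • x ∈ deg (i + j)

namespace GrMod

attribute [instance] GrMod.addCommGroup GrMod.module

variable {A : Type u} [CommRing A] {𝒜 : ℤ → AddSubgroup A}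

/-- Morphisms of graded modules: `A`-linear maps preserving degrees. -/
@[ext]
structure Hom (M N : GrMod 𝒜) where
  lin : M.carrier →ₗ[A] N.carrier
  map_mem : ∀ (i : ℤ) (x : M.carrier), x ∈ M.deg i → lin x ∈ N.deg i

instance : Category (GrMod 𝒜) where
  Hom := Hom
  id M := ⟨LinearMap.id, fun _ _ h => h⟩
  comp f g := ⟨g.lin ∘ₗ f.lin, fun i x h => g.map_mem i _ (f.map_mem i x h)⟩

variable {M N K : GrMod 𝒜}

@[ext]
theorem hom_ext {f g : M ⟶ N} (h : f.lin = g.lin) : f = g := Hom.ext h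

@[simp] theorem id_lin : Hom.lin (𝟙 M) = LinearMap.id := rfl
@[simp] theorem comp_lin (f : M ⟶ N) (g : N ⟶ K) : (f ≫ g).lin = g.lin ∘ₗ f.lin := rfl

/-- Degree-preserving linear maps as a subgroup of all linear maps. -/
def homSubgroup (M N : GrMod 𝒜) : AddSubgroup (M.carrier →ₗ[A] N.carrier) where
  carrier := {f | ∀ (i : ℤ) (x : M.carrier), x ∈ M.deg i → f x ∈ N.deg i}
  zero_mem' i _ _ := (N.deg i).zero_mem
  add_mem' hf hg i x hx := (N.deg i).add_mem (hf i x hx) (hg i x hx)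
  neg_mem' hf i x hx := (N.deg i).neg_mem (hf i x hx)

/-- Morphisms are the degree-preserving linear maps. -/
def homEquiv (M N : GrMod 𝒜) : (M ⟶ N) ≃ homSubgroup M N where
  toFun f := ⟨f.lin, f.map_mem⟩
  invFun f := ⟨f.1, f.2⟩

instance : AddCommGroup (M ⟶ N) := (homEquiv M N).addCommGroup

@[simp] theorem add_lin (f g : M ⟶ N) : (f + g).lin = f.lin + g.lin := rfl
@[simp] theorem zero_lin : (0 : M ⟶ N).lin = 0 := rfl

instance : Preadditive (GrMod 𝒜) where
  add_comp _ _ _ f f' g := by ext x; simp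
  comp_add _ _ _ f g g' := by ext x; simp

section Linear

variable [GradedRing 𝒜]

instance : SMul (SetLike.GradeZero.subring 𝒜) (M ⟶ N) where
  smul r f := ⟨(r : A) • f.lin, fun i x hx => by
    simpa using N.smul_mem r.2 (f.map_mem i x hx)⟩

@[simp] theorem smul_lin (r : SetLike.GradeZero.subring 𝒜) (f : M ⟶ N) :
    (r • f).lin = (r : A) • f.lin := rfl

instance : Module (SetLike.GradeZero.subring 𝒜) (M ⟶ N) where
  one_smul f := by ext x; simp
  mul_smul r s f := by ext x; simp [mul_smul]
  smul_zero r := by ext x; simp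
  smul_add r f g := by ext x; simp
  add_smul r s f := by ext x; simp [add_smul]
  zero_smul f := by ext x; simp

instance : Linear (SetLike.GradeZero.subring 𝒜) (GrMod 𝒜) where
  smul_comp _ _ _ r f g := by ext x; simp
  comp_smul _ _ _ f r g := by ext x; simp

end Linear

/-- The graded submodule on a homogeneous submodule. -/
def sub (M : GrMod 𝒜) (P : Submodule A M.carrier)
    (hP : ∀ i, ∀ x ∈ P, Grading.proj M.isInternal i x ∈ P) : GrMod 𝒜 where
  carrier := P
  deg i := (M.deg i).comap P.subtype.toAddMonoidHom
  isInternal := Grading.isInternal_comap M.isInternal _ P.injective_subtype (by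
    rintro i _ ⟨x, rfl⟩
    exact ⟨⟨_, hP i x x.2⟩, rfl⟩)
  smul_mem ha hx := M.smul_mem ha hx

/-- The graded quotient by a homogeneous submodule. -/
def quot (M : GrMod 𝒜) (P : Submodule A M.carrier)
    (hP : ∀ i, ∀ x ∈ P, Grading.proj M.isInternal i x ∈ P) : GrMod 𝒜 where
  carrier := M.carrier ⧸ P
  deg i := (M.deg i).map P.mkQ.toAddMonoidHom
  isInternal := Grading.isInternal_map M.isInternal _ P.mkQ_surjective (by
    intro i x hx
    have hx' : P.mkQ x = 0 := hx
    change P.mkQ _ = 0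
    rw [Submodule.mkQ_apply, Submodule.Quotient.mk_eq_zero] at hx' ⊢
    exact hP i x hx')
  smul_mem := by
    rintro i j a _ ha ⟨x, hx, rfl⟩
    exact ⟨a • x, M.smul_mem ha hx, P.mkQ.map_smul a x⟩

theorem ker_homogeneous (f : M ⟶ N) (i : ℤ) (x : M.carrier) (hx : x ∈ LinearMap.ker f.lin) :
    Grading.proj M.isInternal i x ∈ LinearMap.ker f.lin := by
  have := Grading.map_proj M.isInternal N.isInternal f.lin.toAddMonoidHom f.map_mem i x
  rw [LinearMap.mem_ker] at hx ⊢
  simpa [hx] using this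

theorem range_homogeneous (f : M ⟶ N) (i : ℤ) (y : N.carrier) (hy : y ∈ LinearMap.range f.lin) :
    Grading.proj N.isInternal i y ∈ LinearMap.range f.lin := by
  obtain ⟨x, rfl⟩ := hy
  exact ⟨_, Grading.map_proj M.isInternal N.isInternal f.lin.toAddMonoidHom f.map_mem i x⟩

/-- The kernel of a morphism. -/
def ker (f : M ⟶ N) : GrMod 𝒜 := M.sub (LinearMap.ker f.lin) (ker_homogeneous f)

/-- The inclusion of the kernel. -/
def kerι (f : M ⟶ N) : ker f ⟶ M := ⟨(LinearMap.ker f.lin).subtype, fun _ _ h => h⟩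

/-- The cokernel of a morphism. -/
def coker (f : M ⟶ N) : GrMod 𝒜 := N.quot (LinearMap.range f.lin) (range_homogeneous f)

/-- The projection onto the cokernel. -/
def cokerπ (f : M ⟶ N) : N ⟶ coker f :=
  ⟨(LinearMap.range f.lin).mkQ, fun _ x h => ⟨x, h, rfl⟩⟩

theorem kerι_comp (f : M ⟶ N) : kerι f ≫ f = 0 := by
  ext x; exact x.2

theorem comp_cokerπ (f : M ⟶ N) : f ≫ cokerπ f = 0 := by
  ext x
  exact (Submodule.Quotient.mk_eq_zero _).2 ⟨x, rfl⟩

/-- The universal property of the kernel. -/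
def kerLift (f : M ⟶ N) (g : K ⟶ M) (h : g ≫ f = 0) : K ⟶ ker f :=
  ⟨g.lin.codRestrict _ fun x => LinearMap.congr_fun (congrArg Hom.lin h) x,
    fun i x hx => g.map_mem i x hx⟩

/-- The universal property of the cokernel. -/
def cokerDesc (f : M ⟶ N) (g : N ⟶ K) (h : f ≫ g = 0) : coker f ⟶ K :=
  ⟨(LinearMap.range f.lin).liftQ g.lin (by
      rintro _ ⟨x, rfl⟩; exact LinearMap.congr_fun (congrArg Hom.lin h) x), by
    rintro i _ ⟨x, hx, rfl⟩; exact g.map_mem i x hx⟩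

theorem injective_of_mono (f : M ⟶ N) [Mono f] : Function.Injective f.lin := by
  rw [← LinearMap.ker_eq_bot, LinearMap.ker_eq_bot']
  intro x hx
  have : kerι f = 0 := by rw [← cancel_mono f, kerι_comp, zero_comp]
  exact LinearMap.congr_fun (congrArg Hom.lin this) ⟨x, hx⟩

theorem surjective_of_epi (f : M ⟶ N) [Epi f] : Function.Surjective f.lin := by
  intro x
  have : cokerπ f = 0 := by rw [← cancel_epi f, comp_cokerπ, comp_zero]
  exact (Submodule.Quotient.mk_eq_zero _).1 (LinearMap.congr_fun (congrArg Hom.lin this) x)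

/-- An injective morphism reflects degrees. -/
theorem mem_deg_of_injective (f : M ⟶ N) (hf : Function.Injective f.lin) (i : ℤ) (x : M.carrier)
    (hx : f.lin x ∈ N.deg i) : x ∈ M.deg i := by
  have := Grading.map_proj M.isInternal N.isInternal f.lin.toAddMonoidHom f.map_mem i x
  have := hf (this.trans (Grading.proj_of_mem N.isInternal i _ hx))
  rw [← this]
  exact Grading.proj_mem _ _ _

theorem isIso_of_bijective (f : M ⟶ N) (hf : Function.Bijective f.lin) : IsIso f := by
  let e := LinearEquiv.ofBijective f.lin hf
  refine ⟨⟨⟨e.symm.toLinearMap, fun i y hy => ?_⟩, ?_, ?_⟩⟩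
  · apply mem_deg_of_injective f hf.1
    have : f.lin (e.symm y) = y := e.apply_symm_apply y
    simpa [this] using hy
  · ext x; exact e.symm_apply_apply x
  · ext x; exact e.apply_symm_apply x

def kerIsLimit (f : M ⟶ N) : IsLimit (KernelFork.ofι (kerι f) (kerι_comp f)) :=
  KernelFork.IsLimit.ofι _ _ (fun g h => kerLift f g h) (fun _ _ => rfl) (fun g h m hm => by
    subst hm; rfl)

def cokerIsColimit (f : M ⟶ N) : IsColimit (CokernelCofork.ofπ (cokerπ f) (comp_cokerπ f)) :=
  CokernelCofork.IsColimit.ofπ _ _ (fun g h => cokerDesc f g h) (fun _ _ => rfl)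
    (fun g h m hm => by
      subst hm
      ext x
      obtain ⟨x, rfl⟩ := Submodule.mkQ_surjective _ x
      rfl)

instance : HasKernels (GrMod 𝒜) where
  has_limit f := ⟨⟨_, kerIsLimit f⟩⟩

instance : HasCokernels (GrMod 𝒜) where
  has_colimit f := ⟨⟨_, cokerIsColimit f⟩⟩

/-- The direct sum of two graded modules. -/
def dsum (M N : GrMod 𝒜) : GrMod 𝒜 where
  carrier := M.carrier × N.carrier
  deg i := (M.deg i).prod (N.deg i)
  isInternal := Grading.isInternal_prod M.isInternal N.isInternal
  smul_mem ha hx := ⟨M.smul_mem ha hx.1, N.smul_mem ha hx.2⟩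

/-- The first projection. -/
def fst (M N : GrMod 𝒜) : M.dsum N ⟶ M := ⟨LinearMap.fst A _ _, fun _ _ h => h.1⟩
/-- The second projection. -/
def snd (M N : GrMod 𝒜) : M.dsum N ⟶ N := ⟨LinearMap.snd A _ _, fun _ _ h => h.2⟩
/-- The first inclusion. -/
def inl (M N : GrMod 𝒜) : M ⟶ M.dsum N :=
  ⟨LinearMap.inl A _ _, fun i _ h => ⟨h, (N.deg i).zero_mem⟩⟩
/-- The second inclusion. -/
def inr (M N : GrMod 𝒜) : N ⟶ M.dsum N :=
  ⟨LinearMap.inr A _ _, fun i _ h => ⟨(M.deg i).zero_mem, h⟩⟩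

/-- The morphism with column vector `(f, g)`. -/
def lift (f : K ⟶ M) (g : K ⟶ N) : K ⟶ M.dsum N :=
  ⟨f.lin.prod g.lin, fun i x hx => ⟨f.map_mem i x hx, g.map_mem i x hx⟩⟩

/-- The morphism with row vector `(f, g)`. -/
def desc (f : M ⟶ K) (g : N ⟶ K) : M.dsum N ⟶ K :=
  ⟨f.lin.coprod g.lin, fun i _ hx =>
    (K.deg i).add_mem (f.map_mem i _ hx.1) (g.map_mem i _ hx.2)⟩

instance : HasBinaryProducts (GrMod 𝒜) :=
  @hasBinaryProducts_of_hasLimit_pair _ _ fun {M N} =>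
    ⟨⟨BinaryFan.mk (fst M N) (snd M N), BinaryFan.isLimitMk
      (fun s => lift s.fst s.snd)
      (fun _ => rfl) (fun _ => rfl) (fun s m h1 h2 => by
        refine hom_ext (LinearMap.ext fun x => ?_)
        exact Prod.ext (LinearMap.congr_fun (congrArg Hom.lin h1) x)
          (LinearMap.congr_fun (congrArg Hom.lin h2) x))⟩⟩

/-- The zero module. -/
def zeroModule (𝒜 : ℤ → AddSubgroup A) : GrMod 𝒜 where
  carrier := PUnit
  deg _ := ⊤
  isInternal := Grading.isInternal_of_proj _ (fun _ => 0) (fun _ _ _ => rfl) (fun _ _ _ _ _ => rfl)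
    fun _ => (⨆ _ : ℤ, (⊤ : AddSubgroup PUnit)).zero_mem
  smul_mem _ _ := AddSubgroup.mem_top _

theorem isZero_zeroModule : IsZero (zeroModule 𝒜) where
  unique_to N := ⟨⟨⟨0⟩, fun f => by
    ext
    exact f.lin.map_zero⟩⟩
  unique_from N := ⟨⟨⟨0⟩, fun f => by ext; exact Subsingleton.elim (α := PUnit) _ _⟩⟩

instance : HasZeroObject (GrMod 𝒜) := ⟨⟨_, isZero_zeroModule⟩⟩

instance : HasFiniteProducts (GrMod 𝒜) :=
  have : HasTerminal (GrMod 𝒜) := HasZeroObject.hasTerminal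
  hasFiniteProducts_of_has_binary_and_terminal

noncomputable instance : Abelian (GrMod 𝒜) where
  normalMonoOfMono {M N} f _ :=
    have hw : f ≫ cokerπ f = 0 := comp_cokerπ f
    have : IsIso (kerLift (cokerπ f) f hw) := isIso_of_bijective _ (by
      constructor
      · intro x y hxy
        exact injective_of_mono f (congrArg Subtype.val hxy)
      · rintro ⟨y, hy⟩
        obtain ⟨x, hx⟩ := (Submodule.Quotient.mk_eq_zero _).1 hy
        exact ⟨x, Subtype.ext hx⟩)
    ⟨{  Z := coker f
        g := cokerπ f
        w := hw
        isLimit := IsLimit.ofIsoLimit (kerIsLimit (cokerπ f))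
          (Fork.ext (asIso (kerLift (cokerπ f) f hw)) rfl).symm }⟩
  normalEpiOfEpi {M N} f _ :=
    have hw : kerι f ≫ f = 0 := kerι_comp f
    have : IsIso (cokerDesc (kerι f) f hw) := isIso_of_bijective _ (by
      constructor
      · rw [← LinearMap.ker_eq_bot, LinearMap.ker_eq_bot']
        intro x hx
        obtain ⟨x, rfl⟩ := Submodule.mkQ_surjective _ x
        exact (Submodule.Quotient.mk_eq_zero _).2 ⟨⟨x, hx⟩, rfl⟩
      · intro y
        obtain ⟨x, rfl⟩ := surjective_of_epi f y
        exact ⟨Submodule.Quotient.mk x, rfl⟩)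
    ⟨{  W := ker f
        g := kerι f
        w := hw
        isColimit := IsColimit.ofIsoColimit (cokerIsColimit (kerι f))
          (Cofork.ext (asIso (cokerDesc (kerι f) f hw)) rfl) }⟩

/-- Finitely generated graded modules. -/
def isFG (𝒜 : ℤ → AddSubgroup A) : ObjectProperty (GrMod 𝒜) := fun M => Module.Finite A M.carrier

theorem isFG_dsum {M N : GrMod 𝒜} (h1 : isFG 𝒜 M) (h2 : isFG 𝒜 N) : isFG 𝒜 (M.dsum N) :=
  have : Module.Finite A M.carrier := h1
  have : Module.Finite A N.carrier := h2
  (inferInstance : Module.Finite A (M.carrier × N.carrier))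

theorem isFG_coker (f : M ⟶ N) (h : isFG 𝒜 N) : isFG 𝒜 (coker f) :=
  have : Module.Finite A N.carrier := h
  Module.Finite.quotient A (LinearMap.range f.lin)

instance : (isFG 𝒜).ContainsZero :=
  ⟨⟨_, isZero_zeroModule, (inferInstance : Module.Finite A PUnit.{u + 1})⟩⟩

instance : (isFG 𝒜).IsClosedUnderQuotients where
  prop_of_epi f _ hX :=
    have : Module.Finite A _ := hX
    Module.Finite.of_surjective f.lin (surjective_of_epi f)

instance [IsNoetherianRing A] : (isFG 𝒜).IsClosedUnderSubobjects where
  prop_of_mono f _ hY :=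
    have : Module.Finite A _ := hY
    Module.Finite.of_injective f.lin (injective_of_mono f)

instance [IsNoetherianRing A] : (isFG 𝒜).IsClosedUnderBinaryProducts where
  limitsOfShape_le := by
    rintro X ⟨p⟩
    have h3 := isFG_dsum (p.prop_diag_obj ⟨WalkingPair.left⟩) (p.prop_diag_obj ⟨WalkingPair.right⟩)
    let q1 : X ⟶ p.diag.obj ⟨WalkingPair.left⟩ := p.π.app ⟨WalkingPair.left⟩
    let q2 : X ⟶ p.diag.obj ⟨WalkingPair.right⟩ := p.π.app ⟨WalkingPair.right⟩
    let f := q1 ≫ inl _ (p.diag.obj ⟨WalkingPair.right⟩) +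
      q2 ≫ inr (p.diag.obj ⟨WalkingPair.left⟩) _
    have hf1 : f ≫ fst _ _ = q1 := by
      ext x
      change (q1.lin x, (0 : (p.diag.obj ⟨WalkingPair.right⟩).carrier)).1 + 0 = _
      simp
    have hf2 : f ≫ snd _ _ = q2 := by
      ext x
      change 0 + q2.lin x = _
      simp
    have : Mono f := ⟨fun g h e => p.isLimit.hom_ext (by
      rintro ⟨_ | _⟩
      · change g ≫ q1 = h ≫ q1
        rw [← hf1, reassoc_of% e]
      · change g ≫ q2 = h ≫ q2
        rw [← hf2, reassoc_of% e])⟩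
    exact (isFG 𝒜).prop_of_mono f h3

instance [IsNoetherianRing A] : (isFG 𝒜).IsClosedUnderFiniteProducts := .mk'

/-- The graded module `A(n)`, with `A(n)_k = A_{n+k}`. -/
def line (𝒜 : ℤ → AddSubgroup A) [GradedRing 𝒜] (n : ℤ) : GrMod 𝒜 where
  carrier := A
  deg i := 𝒜 (n + i)
  isInternal := Grading.isInternal_shift n (DirectSum.Decomposition.isInternal 𝒜)
  smul_mem {i j a x} ha hx := by
    have := SetLike.GradedMul.mul_mem ha hx
    rwa [add_left_comm] at this

variable [GradedRing 𝒜]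

/-- Multiplication by an element of degree `k`, as a morphism `A(m) ⟶ A(n)` where `n = m + k`. -/
def mulHom (m n : ℤ) {k : ℤ} {s : A} (hs : s ∈ 𝒜 k) (h : m + k = n := by norm_num) :
    line 𝒜 m ⟶ line 𝒜 n where
  lin := LinearMap.mulLeft A s
  map_mem i x hx := by
    have := SetLike.GradedMul.mul_mem hs hx
    rwa [show k + (m + i) = n + i by rw [← h]; ring] at this

end GrMod

/-- The category of finitely generated graded modules over a graded ring `A`, i.e. of coherent
sheaves on the quotient stack `[Spec A / 𝔾ₘ]` when `A` is Noetherian. -/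
abbrev GrCoh {A : Type u} [CommRing A] (𝒜 : ℤ → AddSubgroup A) := (GrMod.isFG 𝒜).FullSubcategory

instance {A : Type u} [CommRing A] [IsNoetherianRing A] (𝒜 : ℤ → AddSubgroup A) :
    HasExt.{u + 1} (GrCoh 𝒜) := HasExt.standard _

/-! ### The graded ring `S` -/

noncomputable section

namespace NonGenericII

variable (O : Type u) [CommRing O] (p : ℕ)

/-- The power series ring `O⟦a₀, a₁, Y₀, Y₁⟧`, with variables numbered `0, 1, 2, 3`. -/
abbrev Coeff : Type u := MvPowerSeries (Fin 4) O

/-- The polynomial ring `O⟦a₀, a₁, Y₀, Y₁⟧[b₀, b₁, c]`, with variables numbered `0, 1, 2`. -/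
abbrev Poly : Type u := MvPolynomial (Fin 3) (Coeff O)

/-- The degrees of `b₀`, `b₁` and `c`. -/
def weight : Fin 3 → ℤ := ![2, 2, -2]

open MvPolynomial in
/-- The generators of the ideal of relations: `Yᵢ = bᵢ c` for `i = 0, 1`, and
`p b₀ + a₁ b₀ + a₀ b₁ = 0`. -/
def relators : Fin 3 → Poly O :=
  ![C (MvPowerSeries.X 2) - X 0 * X 2,
    C (MvPowerSeries.X 3) - X 1 * X 2,
    C (p : Coeff O) * X 0 + C (MvPowerSeries.X 1) * X 0 + C (MvPowerSeries.X 0) * X 1]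

/-- The ideal of relations. -/
def relIdeal : Ideal (Poly O) := Ideal.span (Set.range (relators O p))

/-- The ring `S = O⟦a₀, a₁, b₀c, b₁c⟧[b₀, b₁, c] / (p b₀ + a₁ b₀ + a₀ b₁)`. -/
def S : Type u := Poly O ⧸ relIdeal O p

instance : CommRing (S O p) := inferInstanceAs (CommRing (Poly O ⧸ relIdeal O p))

instance [IsNoetherianRing O] : IsNoetherianRing (S O p) :=
  inferInstanceAs (IsNoetherianRing (Poly O ⧸ relIdeal O p))

/-- The quotient map `O⟦a₀, a₁, Y₀, Y₁⟧[b₀, b₁, c] → S`. -/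
def mk : Poly O →+* S O p := Ideal.Quotient.mk (relIdeal O p)

theorem mk_surjective : Function.Surjective (mk O p) := Ideal.Quotient.mk_surjective

theorem mk_eq_zero (x : Poly O) : mk O p x = 0 ↔ x ∈ relIdeal O p :=
  Ideal.Quotient.eq_zero_iff_mem

/-- The grading on `O⟦a₀, a₁, Y₀, Y₁⟧[b₀, b₁, c]` with coefficients in degree `0`. -/
def polyDeg (n : ℤ) : AddSubgroup (Poly O) :=
  (MvPolynomial.weightedHomogeneousSubmodule (Coeff O) weight n).toAddSubgroup

/-- The grading on `S` with `b₀, b₁` in degree `2`, `c` in degree `-2`, and `O⟦a₀, a₁, b₀c, b₁c⟧`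
in degree `0`. -/
def deg (n : ℤ) : AddSubgroup (S O p) :=
  (polyDeg O n).map (mk O p).toAddMonoidHom

theorem isInternal_polyDeg : DirectSum.IsInternal (polyDeg O) := by
  let _ := MvPolynomial.weightedGradedAlgebra (Coeff O) weight
  exact DirectSum.Decomposition.isInternal
    (MvPolynomial.weightedHomogeneousSubmodule (Coeff O) weight)

theorem relators_mem : ∀ i, ∃ n, relators O p i ∈ polyDeg O n := by
  have hX := fun i => MvPolynomial.isWeightedHomogeneous_X (Coeff O) weight i
  have hC := fun r : Coeff O => MvPolynomial.isWeightedHomogeneous_C (σ := Fin 3) weight r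
  intro i
  fin_cases i
  · exact ⟨0, MvPolynomial.IsWeightedHomogeneous.sub (hC _) ((hX 0).mul (hX 2))⟩
  · exact ⟨0, MvPolynomial.IsWeightedHomogeneous.sub (hC _) ((hX 1).mul (hX 2))⟩
  · refine ⟨2, MvPolynomial.IsWeightedHomogeneous.add (.add ?_ ?_) ?_⟩
    · simpa [weight] using (hC (p : Coeff O)).mul (hX 0)
    · simpa [weight] using (hC (MvPowerSeries.X 1)).mul (hX 0)
    · simpa [weight] using (hC (MvPowerSeries.X 0)).mul (hX 1)

theorem relIdeal_homogeneous (i : ℤ) (x : Poly O) (hx : x ∈ relIdeal O p) :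
    Grading.proj (isInternal_polyDeg O) i x ∈ relIdeal O p := by
  let _ := MvPolynomial.weightedGradedAlgebra (Coeff O) weight
  have h := Ideal.homogeneous_span
    (MvPolynomial.weightedHomogeneousSubmodule (Coeff O) weight) (Set.range (relators O p)) (by
      rintro _ ⟨i, rfl⟩
      exact relators_mem O p i) i hx
  rw [← Grading.eq_proj (isInternal_polyDeg O)
    (GradedRing.proj (MvPolynomial.weightedHomogeneousSubmodule (Coeff O) weight) i) i]
  · exact h
  · intro y hy
    exact DirectSum.decompose_of_mem_same
      (MvPolynomial.weightedHomogeneousSubmodule (Coeff O) weight) hy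
  · intro j hij y hy
    exact DirectSum.decompose_of_mem_ne
      (MvPolynomial.weightedHomogeneousSubmodule (Coeff O) weight) hy hij.symm

theorem isInternal_deg : DirectSum.IsInternal (deg O p) :=
  Grading.isInternal_map (isInternal_polyDeg O) _ (mk_surjective O p) (by
    intro i x hx
    have hx' : mk O p x = 0 := hx
    change mk O p _ = 0
    rw [mk_eq_zero] at hx' ⊢
    exact relIdeal_homogeneous O p i x hx')

noncomputable instance : GradedRing (deg O p) where
  one_mem := ⟨1, MvPolynomial.isWeightedHomogeneous_one _ _,
    map_one (mk O p)⟩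
  mul_mem := by
    rintro i j _ _ ⟨x, hx, rfl⟩ ⟨y, hy, rfl⟩
    exact ⟨x * y, MvPolynomial.IsWeightedHomogeneous.mul hx hy,
      map_mul (mk O p) x y⟩
  toDecomposition := (isInternal_deg O p).chooseDecomposition

/-- The degree `0` part `R` of `S`. -/
abbrev R : Type u := SetLike.GradeZero.subring (deg O p)

/-- The elements `b₀, b₁` of `S`. -/
def b (i : Fin 2) : S O p := mk O p (MvPolynomial.X (Fin.castSucc i))

/-- The element `c` of `S`. -/
def c : S O p := mk O p (MvPolynomial.X 2)

/-- The map `O⟦a₀, a₁, Y₀, Y₁⟧ → S`. -/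
def ofCoeff : Coeff O →+* S O p := (mk O p).comp MvPolynomial.C

/-- The element `a₀` of `S`. -/
def a₀ : S O p := ofCoeff O p (MvPowerSeries.X 0)

/-- The element `a₁' = a₁ + p` of `S`. -/
def a₁' : S O p := ofCoeff O p (MvPowerSeries.X 1 + (p : Coeff O))

theorem b_mem (i : Fin 2) : b O p i ∈ deg O p 2 := by
  have h := MvPolynomial.isWeightedHomogeneous_X (Coeff O) weight (Fin.castSucc i)
  have hw : weight (Fin.castSucc i) = 2 := by fin_cases i <;> rfl
  rw [hw] at h
  exact ⟨_, h, rfl⟩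

theorem c_mem : c O p ∈ deg O p (-2) :=
  ⟨_, MvPolynomial.isWeightedHomogeneous_X (Coeff O) weight 2, rfl⟩

theorem ofCoeff_mem (x : Coeff O) : ofCoeff O p x ∈ deg O p 0 :=
  ⟨_, MvPolynomial.isWeightedHomogeneous_C weight x, rfl⟩

theorem bc_mem (i : Fin 2) : b O p i * c O p ∈ deg O p 0 :=
  SetLike.GradedMul.mul_mem (b_mem O p i) (c_mem O p)

theorem relation : a₁' O p * b O p 0 + a₀ O p * b O p 1 = 0 := by
  have h : relators O p 2 ∈ relIdeal O p := Ideal.subset_span ⟨2, rfl⟩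
  have := (mk_eq_zero O p _).2 h
  rw [← this]
  simp [a₁', a₀, b, ofCoeff, relators]
  ring

theorem a₀_mem : a₀ O p ∈ deg O p 0 := ofCoeff_mem O p _

theorem a₁'_mem : a₁' O p ∈ deg O p 0 := ofCoeff_mem O p _

/-- The element `a₀` of `R`. -/
def ra₀ : R O p := ⟨a₀ O p, a₀_mem O p⟩
/-- The element `a₁'` of `R`. -/
def ra₁' : R O p := ⟨a₁' O p, a₁'_mem O p⟩
/-- The elements `b₀ c, b₁ c` of `R`. -/
def rbc (i : Fin 2) : R O p := ⟨b O p i * c O p, bc_mem O p i⟩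

open GrMod

/-- The matrix `M = (b₀, b₁; -a₀, a₁')` as a morphism `L₋₁ ⊕ L₋₁ ⟶ L₁ ⊕ L₋₁`. -/
def matM : (line (deg O p) (-1)).dsum (line (deg O p) (-1)) ⟶
    (line (deg O p) 1).dsum (line (deg O p) (-1)) :=
  lift
    (desc (mulHom (-1) 1 (b_mem O p 0)) (mulHom (-1) 1 (b_mem O p 1)))
    (desc (-mulHom (-1) (-1) (a₀_mem O p)) (mulHom (-1) (-1) (a₁'_mem O p)))

/-- The category `Coh(𝔛)`. -/
abbrev Coh : Type (u + 1) := GrCoh (deg O p)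

/-- The line bundle `Lₙ = S(n)`. -/
def L (n : ℤ) : Coh O p := ⟨line (deg O p) n, Module.Finite.self (S O p)⟩

/-- The coherent sheaf `Q = coker (M : L₋₁ ⊕ L₋₁ ⟶ L₁ ⊕ L₋₁)`. -/
def Q : Coh O p :=
  ⟨coker (matM O p), isFG_coker _ (isFG_dsum (L O p 1).property (L O p (-1)).property)⟩

/-- The morphism `Q ⟶ Lₙ` induced by a row vector `(x, y) : L₁ ⊕ L₋₁ ⟶ Lₙ` with
`(x, y) M = 0`. -/
def rowHom (n : ℤ) {k l : ℤ} {x y : S O p} (hx : x ∈ deg O p k) (hy : y ∈ deg O p l)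
    (hk : 1 + k = n) (hl : -1 + l = n)
    (h0 : x * b O p 0 = y * a₀ O p) (h1 : x * b O p 1 + y * a₁' O p = 0) :
    Q O p ⟶ L O p n :=
  (isFG (deg O p)).homMk (cokerDesc (matM O p) (desc (mulHom 1 n hx hk) (mulHom (-1) n hy hl)) (by
    refine hom_ext (LinearMap.ext ?_)
    rintro ⟨(u : S O p), (v : S O p)⟩
    change x * (b O p 0 * u + b O p 1 * v) + y * (-(a₀ O p * u) + a₁' O p * v) = 0
    linear_combination u * h0 + v * h1))

/-- The morphism `φ₁₂ = c : L₁ ⟶ L₋₁`. -/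
def φ₁₂ : L O p 1 ⟶ L O p (-1) := (isFG (deg O p)).homMk (mulHom 1 (-1) (c_mem O p))

/-- The morphisms `φ₂₁ⁱ = bᵢ : L₋₁ ⟶ L₁`. -/
def φ₂₁ (i : Fin 2) : L O p (-1) ⟶ L O p 1 :=
  (isFG (deg O p)).homMk (mulHom (-1) 1 (b_mem O p i))

/-- The elements `a₀` and `-a₁'`. -/
def α : Fin 2 → S O p := ![a₀ O p, -a₁' O p]

theorem α_mem : ∀ i, α O p i ∈ deg O p 0 := by
  intro i
  fin_cases i
  · exact a₀_mem O p
  · exact neg_mem (a₁'_mem O p)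

theorem α_b₀ (i : Fin 2) : α O p i * b O p 0 = b O p i * a₀ O p := by
  have := relation O p
  fin_cases i
  · exact mul_comm _ _
  · change -a₁' O p * b O p 0 = b O p 1 * a₀ O p
    linear_combination -this

theorem α_b₁ (i : Fin 2) : α O p i * b O p 1 + b O p i * a₁' O p = 0 := by
  have := relation O p
  fin_cases i
  · change a₀ O p * b O p 1 + b O p 0 * a₁' O p = 0
    linear_combination this
  · change -a₁' O p * b O p 1 + b O p 1 * a₁' O p = 0
    ring

/-- The morphisms `φ₂₃⁰ = (a₀, b₀)` and `φ₂₃¹ = (-a₁', b₁)` from `Q` to `L₁`. -/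
def φ₂₃ (i : Fin 2) : Q O p ⟶ L O p 1 :=
  rowHom O p 1 (α_mem O p i) (b_mem O p i) (by norm_num) (by norm_num) (α_b₀ O p i) (α_b₁ O p i)

/-- The morphisms `φ₁₃⁰ = (a₀ c, b₀ c)` and `φ₁₃¹ = (-a₁' c, b₁ c)` from `Q` to `L₋₁`. -/
def φ₁₃ (i : Fin 2) : Q O p ⟶ L O p (-1) :=
  rowHom O p (-1) (x := α O p i * c O p) (SetLike.GradedMul.mul_mem (α_mem O p i) (c_mem O p))
    (bc_mem O p i) (by norm_num) (by norm_num)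
    (by linear_combination c O p * α_b₀ O p i) (by linear_combination c O p * α_b₁ O p i)

/-- The inclusion `φ₃₁ = ι : L₋₁ ⟶ Q`, the class of the column vector `(0, 1)`. -/
def φ₃₁ : L O p (-1) ⟶ Q O p := (isFG (deg O p)).homMk (inr _ _ ≫ cokerπ (matM O p))

/-- The morphism `φ₃₂ : L₁ ⟶ Q`, the class of the column vector `(0, c)`. -/
def φ₃₂ : L O p 1 ⟶ Q O p :=
  (isFG (deg O p)).homMk (mulHom 1 (-1) (c_mem O p) ≫ inr _ _ ≫ cokerπ (matM O p))

/-- The morphism `β : L₁ ⟶ Q`, the class of the column vector `(1, 0)`. -/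
def β : L O p 1 ⟶ Q O p := (isFG (deg O p)).homMk (inl _ _ ≫ cokerπ (matM O p))

/-- The three summands `L₋₁`, `L₁`, `Q`, in this order. -/
abbrev summand : Fin 3 → Coh O p
  | 0 => L O p (-1)
  | 1 => L O p 1
  | 2 => Q O p

attribute [local instance] Abelian.hasFiniteBiproducts

/-- The coherent sheaf `X = L₋₁ ⊕ L₁ ⊕ Q`. -/
abbrev X [IsNoetherianRing O] : Coh O p := ⨁ summand O p

/-- Names for the generators of the generalized matrix algebra. -/
inductive Gen
  | e (i : Fin 3)
  | φ₁₂
  | φ₁₃ (i : Fin 2)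
  | φ₂₁ (i : Fin 2)
  | φ₂₃ (i : Fin 2)
  | φ₃₁
  | φ₃₂
  | β

/-- The row in which a generator is placed; a generator in row `i` and column `j` is a morphism
from the `j`-th to the `i`-th summand. -/
def Gen.row : Gen → Fin 3
  | e i => i
  | φ₁₂ | φ₁₃ _ => 0
  | φ₂₁ _ | φ₂₃ _ => 1
  | φ₃₁ | φ₃₂ | β => 2

/-- The column in which a generator is placed. -/
def Gen.col : Gen → Fin 3
  | e i => i
  | φ₂₁ _ | φ₃₁ => 0
  | φ₁₂ | φ₃₂ | β => 1
  | φ₁₃ _ | φ₂₃ _ => 2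

/-- The morphism named by a generator; the `eᵢ` name the identities. -/
def Gen.hom : (g : Gen) → (summand O p g.col ⟶ summand O p g.row)
  | e i => 𝟙 (summand O p i)
  | φ₁₂ => NonGenericII.φ₁₂ O p
  | φ₁₃ i => NonGenericII.φ₁₃ O p i
  | φ₂₁ i => NonGenericII.φ₂₁ O p i
  | φ₂₃ i => NonGenericII.φ₂₃ O p i
  | φ₃₁ => NonGenericII.φ₃₁ O p
  | φ₃₂ => NonGenericII.φ₃₂ O p
  | β => NonGenericII.β O p

/-- The endomorphism of `X` given by a generator in its matrix entry, and zero in all others. -/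
def Gen.toEnd [IsNoetherianRing O] (g : Gen) : End (X O p) :=
  biproduct.π (summand O p) g.col ≫ g.hom O p ≫ biproduct.ι (summand O p) g.row

open FreeAlgebra in
/-- The defining relations of the `3 × 3` generalized matrix `R`-algebra `Ẽ`: the `eᵢ` are a
complete system of orthogonal idempotents, each generator lies in its own matrix entry, and the
twelve families of relations for products hold. -/
inductive Rel : FreeAlgebra (R O p) Gen → FreeAlgebra (R O p) Gen → Prop
  | sum_e : Rel (ι _ (.e 0) + ι _ (.e 1) + ι _ (.e 2)) 1
  | e_mul_e {i j : Fin 3} (h : i ≠ j) : Rel (ι _ (.e i) * ι _ (.e j)) 0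
  | e_mul (g : Gen) : Rel (ι _ (.e g.row) * ι _ g) (ι _ g)
  | mul_e (g : Gen) : Rel (ι _ g * ι _ (.e g.col)) (ι _ g)
  | r1 (i : Fin 2) : Rel (ι _ .φ₁₂ * ι _ (.φ₂₁ i)) (rbc O p i • ι _ (.e 0))
  | r2 (i : Fin 2) : Rel (ι _ .φ₁₂ * ι _ (.φ₂₃ i)) (ι _ (.φ₁₃ i))
  | r3 (i : Fin 2) : Rel (ι _ (.φ₁₃ i) * ι _ .φ₃₁) (rbc O p i • ι _ (.e 0))
  | r4 (i : Fin 2) : Rel (ι _ (.φ₂₁ i) * ι _ .φ₁₂) (rbc O p i • ι _ (.e 1))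
  | r5 (i j : Fin 2) : Rel (ι _ (.φ₂₁ i) * ι _ (.φ₁₃ j)) (rbc O p i • ι _ (.φ₂₃ j))
  | r6 (i : Fin 2) : Rel (ι _ (.φ₂₃ i) * ι _ .φ₃₁) (ι _ (.φ₂₁ i))
  | r7 : Rel (ι _ .φ₃₁ * ι _ .φ₁₂) (ι _ .φ₃₂)
  | r8 (i : Fin 2) : Rel (ι _ .φ₃₁ * ι _ (.φ₁₃ i)) (rbc O p i • ι _ (.e 2))
  | r9 (i : Fin 2) : Rel (ι _ (.φ₁₃ i) * ι _ .φ₃₂) (rbc O p i • ι _ .φ₁₂)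
  | r9₀ : Rel (ι _ (.φ₁₃ 0) * ι _ .β) (ra₀ O p • ι _ .φ₁₂)
  | r9₁ : Rel (ι _ (.φ₁₃ 1) * ι _ .β) (-ra₁' O p • ι _ .φ₁₂)
  | r10 (i : Fin 2) : Rel (ι _ (.φ₂₃ i) * ι _ .φ₃₂) (rbc O p i • ι _ (.e 1))
  | r10₀ : Rel (ι _ (.φ₂₃ 0) * ι _ .β) (ra₀ O p • ι _ (.e 1))
  | r10₁ : Rel (ι _ (.φ₂₃ 1) * ι _ .β) (-ra₁' O p • ι _ (.e 1))
  | r11 (i : Fin 2) : Rel (ι _ .φ₃₂ * ι _ (.φ₂₁ i)) (rbc O p i • ι _ .φ₃₁)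
  | r11₀ : Rel (ι _ .β * ι _ (.φ₂₁ 0)) (ra₀ O p • ι _ .φ₃₁)
  | r11₁ : Rel (ι _ .β * ι _ (.φ₂₁ 1)) (-ra₁' O p • ι _ .φ₃₁)
  | r12 (i : Fin 2) : Rel (ι _ .φ₃₂ * ι _ (.φ₂₃ i)) (rbc O p i • ι _ (.e 2))
  | r12₀ : Rel (ι _ .β * ι _ (.φ₂₃ 0)) (ra₀ O p • ι _ (.e 2))
  | r12₁ : Rel (ι _ .β * ι _ (.φ₂₃ 1)) (-ra₁' O p • ι _ (.e 2))

/-- The `R`-algebra given by the generators and relations. -/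
abbrev GMA : Type u := RingQuot (Rel O p)

/-- The class of a generator. -/
def GMA.gen (g : Gen) : GMA O p := RingQuot.mkAlgHom (R O p) (Rel O p) (FreeAlgebra.ι _ g)

/-- `Q` as an `S`-module, without its grading. -/
abbrev Qmod : Type u := (Q O p).obj.carrier

end NonGenericII

end

/-- A finitely generated module `M` over a Noetherian ring `A` is maximal Cohen-Macaulay if for
every maximal ideal `𝔪` of `A` the depth of `M_𝔪` equals the dimension of `A_𝔪`: there is an
`M_𝔪`-regular sequence of length `dim A_𝔪` in the maximal ideal of `A_𝔪`. -/
def IsMaximalCohenMacaulay (A M : Type*) [CommRing A] [AddCommGroup M] [Module A M] : Prop :=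
  Module.Finite A M ∧ ∀ (𝔪 : Ideal A) [𝔪.IsMaximal],
    ∃ rs : List (Localization.AtPrime 𝔪),
      (∀ r ∈ rs, r ∈ IsLocalRing.maximalIdeal (Localization.AtPrime 𝔪)) ∧
      RingTheory.Sequence.IsRegular (LocalizedModule.AtPrime 𝔪 M) rs ∧
      (rs.length : WithBot ℕ∞) = ringKrullDim (Localization.AtPrime 𝔪)

/-- The ring of integers of a finite extension `K` of `ℚ_p`. -/
abbrev 𝒪 (p : ℕ) [Fact p.Prime] (K : Type u) [Field K] [Algebra ℤ_[p] K] : Type u :=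
  integralClosure ℤ_[p] K

/-- The ring of integers of a finite extension of `ℚ_p` is Noetherian. -/
instance isNoetherianRing_integers (p : ℕ) [Fact p.Prime] (K : Type u) [Field K] [Algebra ℚ_[p] K]
    [Algebra ℤ_[p] K] [IsScalarTower ℤ_[p] ℚ_[p] K] [FiniteDimensional ℚ_[p] K] :
    IsNoetherianRing (𝒪 p K) :=
  IsIntegralClosure.isNoetherianRing ℤ_[p] ℚ_[p] K _

open NonGenericII

set_option linter.unusedSectionVars false

/-! ### Depth over Noetherian local rings -/

namespace LocalDepth

open IsLocalRing RingTheory.Sequence Abelian Pointwise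

/-! Write `d = a₁' b₀ + a₀ b₁ = det M`, let `N` be the adjugate of `M`, and let `PreS` be the
polynomial ring modulo the two relations `Yᵢ = bᵢ c`. Sending `c` to `T` and `bᵢ` to `Yᵢ T⁻¹` embeds
`PreS` in the Laurent polynomials over the coefficient ring, so `PreS` is a domain of extended Rees
type, and `S = PreS / d`. Since `M N = N M = d`, the pair `(M, N)` is a matrix factorization of `d`,
and `Q` is its cokernel. The same embedding, taken modulo ideals generated by variables, decides
which elements are regular in quotients of `PreS`. This yields the syzygies of `(b₀, b₁)` and of
`(a₀, b₀)` over `S` (`exists_of_b_mul`, `exists_of_a₀_b₀_mul`), on which all later computations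
rest.

Ext. By these syzygies `Q` has the 2-periodic resolution by `M, N, M, ...`, and the transposed
complex is exact as well, so `Ext` into `S` and all `Lₙ` vanishes. For `Ext(Q, Q)`, the row `(a₀,
b₀)` embeds `Q` as the ideal `(a₀, b₀)`, and one must move a solution in `S` into that ideal. At one
parity this works because `a₁', b₁` is a regular sequence modulo `(a₀, b₀)`
(`exists_of_mem_idealAB`); at the other parity the grading is used: the relevant entry has positive
degree and hence lies in `(b₀, b₁)`. The `Lₙ` are projective, so the vanishing for `X` follows.

Depth. Over `PreS` the module `Q` has the resolution of length one given by `M`. The ring of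
integers is a local ring of dimension at most one with nonzero element `p` in its maximal ideal, so
its power series ring is Cohen-Macaulay; this property passes to localizations and polynomial rings.
Three relators form a weakly regular sequence, so the dimension drops by at least three from the
polynomial ring to `S`, while the depth of `Q` is at most three below that of the polynomial ring.
Projectivity of `Q` fails after specializing to `k[b₀]`, where `M` becomes `diag(b₀, 0)`.

Homomorphisms. A map out of `Lₙ` is its value at `1`; a map from `Q` to a module on which `b₀` is
regular is determined by its value at the class of `(0, 1)`. Monomials of positive degree contain
some `bᵢ` and those of negative degree contain `c`, which identifies the graded pieces that occur
with explicit `R`-modules.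

Presentation. The relations rewrite each product of two composable generators as a multiple of a
generator, so the presented algebra is spanned over `R` by the generators (`mem_span_gen`). It maps
onto `End(X)` by the computation of the Hom modules. In entries with one generator that generator
maps to a basis; in entries with two, every relation among the morphisms comes from the syzygies
above, and those already follow from associativity in the presented algebra. -/

theorem height_add_coheight_le {B : Type*} [CommRing B] (q : PrimeSpectrum B) :
    ((Order.height q + Order.coheight q : ℕ∞) : WithBot ℕ∞) ≤ ringKrullDim B := by
  have : Nonempty (PrimeSpectrum B) := ⟨q⟩
  rw [ringKrullDim, Order.krullDim_eq_iSup_height_add_coheight_of_nonempty, WithBot.coe_le_coe]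
  exact le_iSup (fun a : PrimeSpectrum B => Order.height a + Order.coheight a) q

/-- There is a weakly regular sequence of length `n` on `N` in the maximal ideal. -/
def HasDepth (B : Type*) [CommRing B] [IsLocalRing B] (N : Type*) [AddCommGroup N] [Module B N]
    (n : ℕ) : Prop :=
  ∃ rs : List B, rs.length = n ∧ (∀ r ∈ rs, r ∈ maximalIdeal B) ∧ IsWeaklyRegular N rs

section

variable {B : Type u} [CommRing B] [IsLocalRing B] [IsNoetherianRing B]
variable {N : Type u} [AddCommGroup N] [Module B N] [Module.Finite B N]

theorem hasDepth_of_subsingleton [Subsingleton N] (n : ℕ) : HasDepth B N n := by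
  refine ⟨List.replicate n 0, by simp, fun r hr => ?_, ⟨fun i hi => ?_⟩⟩
  · rw [List.eq_of_mem_replicate hr]; exact zero_mem _
  · intro x y _; exact Subsingleton.elim _ _

theorem maximalIdeal_smul_lt [Nontrivial N] :
    maximalIdeal B • (⊤ : Submodule B N) < ⊤ := by
  refine lt_top_iff_ne_top.2 fun h => ?_
  have := Submodule.eq_bot_of_le_smul_of_le_jacobson_bot (maximalIdeal B) (⊤ : Submodule B N)
    Module.Finite.fg_top h.ge (IsLocalRing.maximalIdeal_le_jacobson _)
  exact top_ne_bot this

/-- Rees' characterization of depth by vanishing of `Ext` from the residue field. It turns the depth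
lemma for short exact sequences into the long exact sequence. Weak regularity lets the zero module
have every depth, so that case is treated separately. -/
theorem hasDepth_iff_ext (n : ℕ) : HasDepth B N n ↔ ∀ i < n,
    Subsingleton (Ext.{u} (ModuleCat.of B (B ⧸ maximalIdeal B)) (ModuleCat.of B N) i) := by
  rcases subsingleton_or_nontrivial N with hN | hN
  · refine ⟨fun _ i _ => ?_, fun _ => hasDepth_of_subsingleton n⟩
    have hz : IsZero (ModuleCat.of B N) := ModuleCat.isZero_of_subsingleton _
    refine ⟨fun a b => ?_⟩
    have h : ∀ c : Ext.{u} (ModuleCat.of B (B ⧸ maximalIdeal B)) (ModuleCat.of B N) i, c = 0 := by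
      intro c
      have := Ext.comp_mk₀_id c
      rw [hz.eq_of_src (𝟙 (ModuleCat.of B N)) 0, Ext.mk₀_zero, Ext.comp_zero] at this
      exact this.symm
    rw [h a, h b]
  · have hs : Module.support B (B ⧸ maximalIdeal B) =
        PrimeSpectrum.zeroLocus (maximalIdeal B : Set B) := by
      rw [Module.support_eq_zeroLocus, Ideal.annihilator_quotient]
    constructor
    · rintro ⟨rs, rfl, hm, hr⟩
      exact ModuleCat.subsingleton_ext_of_exists_isRegular (maximalIdeal B)
        (ModuleCat.of B (B ⧸ maximalIdeal B)) hs.subset (ModuleCat.of B N)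
        maximalIdeal_smul_lt rs hm
        ((isRegular_iff_isWeaklyRegular_of_subset_maximalIdeal (M := N) hm).2 hr)
    · intro h
      obtain ⟨rs, hl, hm, hr⟩ := ModuleCat.exists_isRegular_of_exists_subsingleton_ext
        (maximalIdeal B) n (ModuleCat.of B N) maximalIdeal_smul_lt
        (ModuleCat.of B (B ⧸ maximalIdeal B)) hs h
      exact ⟨rs, hl, hm, hr.toIsWeaklyRegular⟩

variable {N₁ N₃ : Type u} [AddCommGroup N₁] [Module B N₁] [Module.Finite B N₁]
  [AddCommGroup N₃] [Module B N₃] [Module.Finite B N₃]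

theorem shortExact_of_linear {A : Type u} [CommRing A] {N₁ N N₃ : Type u} [AddCommGroup N₁]
    [Module A N₁] [AddCommGroup N] [Module A N] [AddCommGroup N₃] [Module A N₃]
    (f : N₁ →ₗ[A] N) (g : N →ₗ[A] N₃) (hf : Function.Injective f)
    (hg : Function.Surjective g) (hfg : Function.Exact f g) :
    (ShortComplex.mk (ModuleCat.ofHom f) (ModuleCat.ofHom g) (by
      ext x; exact hfg.apply_apply_eq_zero x)).ShortExact where
  exact := (ShortComplex.ShortExact.moduleCat_exact_iff_function_exact _).2 hfg
  mono_f := (ModuleCat.mono_iff_injective _).2 hf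
  epi_g := (ModuleCat.epi_iff_surjective _).2 hg

/-- In the long exact sequence, `Ext^i` into `N₃` sits between `Ext^i` into `N` and `Ext^(i+1)` into
`N₁`; hence the one extra unit of depth required of `N₁`. -/
theorem HasDepth.of_exact₃ {n : ℕ} (f : N₁ →ₗ[B] N) (g : N →ₗ[B] N₃)
    (hf : Function.Injective f) (hg : Function.Surjective g) (hfg : Function.Exact f g)
    (h₁ : HasDepth B N₁ (n + 1)) (h : HasDepth B N n) : HasDepth B N₃ n := by
  rw [hasDepth_iff_ext] at h₁ h ⊢
  intro i hi
  have hS := shortExact_of_linear f g hf hg hfg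
  have := h₁ (i + 1) (by omega)
  have := h i hi
  refine ⟨fun a b => ?_⟩
  have key : ∀ c : Ext.{u} (ModuleCat.of B (B ⧸ maximalIdeal B)) (ModuleCat.of B N₃) i, c = 0 := by
    intro c
    obtain ⟨x, hx⟩ := Ext.covariant_sequence_exact₃ _ hS c rfl (Subsingleton.elim _ _)
    rw [← hx, Subsingleton.elim x 0, Ext.zero_comp]
  rw [key a, key b]

theorem HasDepth.of_exact₂ {n : ℕ} (f : N₁ →ₗ[B] N) (g : N →ₗ[B] N₃)
    (hf : Function.Injective f) (hg : Function.Surjective g) (hfg : Function.Exact f g)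
    (h₁ : HasDepth B N₁ n) (h₃ : HasDepth B N₃ n) : HasDepth B N n := by
  rw [hasDepth_iff_ext] at h₁ h₃ ⊢
  intro i hi
  have hS := shortExact_of_linear f g hf hg hfg
  have := h₁ i hi
  have := h₃ i hi
  refine ⟨fun a b => ?_⟩
  have key : ∀ c : Ext.{u} (ModuleCat.of B (B ⧸ maximalIdeal B)) (ModuleCat.of B N) i, c = 0 := by
    intro c
    obtain ⟨x, hx⟩ := Ext.covariant_sequence_exact₂ _ hS c (Subsingleton.elim _ _)
    rw [← hx, Subsingleton.elim x 0, Ext.zero_comp]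
  rw [key a, key b]

theorem HasDepth.of_le {m n : ℕ} (h : HasDepth B N n) (hm : m ≤ n) : HasDepth B N m := by
  rw [hasDepth_iff_ext] at h ⊢
  exact fun i hi => h i (hi.trans_le hm)

theorem HasDepth.quotSMulTop {n : ℕ} (h : HasDepth B N (n + 1)) {x : B}
    (hx : IsSMulRegular N x) : HasDepth B (QuotSMulTop x N) n :=
  HasDepth.of_exact₃ (LinearMap.lsmul B N x) (Submodule.mkQ _) hx (Submodule.mkQ_surjective _)
    (LinearMap.exact_lsmul_mkQ_smul_top N x) h (h.of_le n.le_succ)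

/-- Over a regular element, an associated prime extends to a strictly larger one of the quotient. -/
theorem exists_lt_associatedPrimes {x : B} (hx : x ∈ maximalIdeal B) (hreg : IsSMulRegular N x)
    {q : Ideal B} (hq : q ∈ associatedPrimes B N) :
    ∃ q' ∈ associatedPrimes B (QuotSMulTop x N), q < q' := by
  obtain ⟨hqp, y, hy⟩ := isAssociatedPrime_iff.1 hq
  have hqy : ∀ r, r ∈ q ↔ r • y = 0 := fun r => by rw [hy, Submodule.mem_colon_singleton]; simp
  have hxq : x ∉ q := fun h => by
    have hy0 : y = 0 := hreg (by simpa using (hqy x).1 h)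
    exact hqp.ne_top ((Ideal.eq_top_iff_one _).2 ((hqy 1).2 (by simp [hy0])))
  let T : Submodule B N :=
    { carrier := {n | ∀ r ∈ q, r • n = 0}
      zero_mem' := by simp
      add_mem' := fun ha hb r hr => by rw [smul_add, ha r hr, hb r hr, add_zero]
      smul_mem' := fun c n hn r hr => by rw [smul_comm, hn r hr, smul_zero] }
  have hyT : y ∈ T := fun r hr => (hqy r).1 hr
  -- `T` consists of the elements killed by `q`. If it lay in `x N`, regularity of `x` would give `T
  -- = x T`, so `T = 0` by Nakayama, against `y ∈ T`.
  obtain ⟨n, hnT, hn⟩ : ∃ n ∈ T, n ∉ x • (⊤ : Submodule B N) := by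
    by_contra! hcon
    have hle : T ≤ maximalIdeal B • T := by
      intro n hn
      obtain ⟨m, -, rfl⟩ := Submodule.mem_smul_pointwise_iff_exists _ _ _ |>.1 (hcon n hn)
      refine Submodule.smul_mem_smul hx fun r hr => hreg ?_
      simpa [smul_comm x r m] using hn r hr
    have := Submodule.eq_bot_of_le_smul_of_le_jacobson_bot (maximalIdeal B) T
      (IsNoetherian.noetherian T) hle (IsLocalRing.maximalIdeal_le_jacobson _)
    rw [this, Submodule.mem_bot] at hyT
    exact hqp.ne_top ((Ideal.eq_top_iff_one _).2 ((hqy 1).2 (by simp [hyT])))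
  have hn0 : (Submodule.mkQ (x • (⊤ : Submodule B N)) n) ≠ 0 := by
    rwa [Ne, Submodule.mkQ_apply, Submodule.Quotient.mk_eq_zero]
  -- The annihilator of the class of `n` contains both `q` and `x`, and `x ∉ q`, so any associated
  -- prime above it is strictly larger than `q`.
  obtain ⟨q', hq', hle⟩ := exists_le_isAssociatedPrime_of_isNoetherianRing B
    (Submodule.mkQ (x • (⊤ : Submodule B N)) n) hn0
  refine ⟨q', hq', lt_of_le_of_ne (fun r hr => hle ?_) ?_⟩
  · rw [Submodule.mem_colon_singleton, ← map_smul, hnT r hr]; simp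
  · rintro rfl
    refine hxq (hle ?_)
    rw [Submodule.mem_colon_singleton, ← map_smul, Submodule.mem_bot, Submodule.mkQ_apply,
      Submodule.Quotient.mk_eq_zero]
    exact Submodule.smul_mem_pointwise_smul _ _ _ trivial

/-- Each element of the sequence lets an associated prime grow strictly, so the whole sequence
produces a chain of primes above `q`. This bounds the depth of `N` by the dimension of `B / q`. -/
theorem length_le_coheight (rs : List B) (hm : ∀ r ∈ rs, r ∈ maximalIdeal B) :
    ∀ (N : Type u) [AddCommGroup N] [Module B N] [Module.Finite B N], IsWeaklyRegular N rs →
    ∀ q : PrimeSpectrum B, q.asIdeal ∈ associatedPrimes B N →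
      (rs.length : ℕ∞) ≤ Order.coheight q := by
  induction rs with
  | nil => simp
  | cons x rs ih =>
    intro N _ _ _ hr q hq
    rw [isWeaklyRegular_cons_iff] at hr
    obtain ⟨q', hq', hlt⟩ := exists_lt_associatedPrimes (hm x (by simp)) hr.1 hq
    have h1 := ih (fun r hr => hm r (by simp [hr])) (QuotSMulTop x N) hr.2
      ⟨q', (isAssociatedPrime_iff.1 hq').1⟩ hq'
    have h2 : Order.coheight (⟨q', (isAssociatedPrime_iff.1 hq').1⟩ : PrimeSpectrum B) + 1 ≤
      Order.coheight q := Order.coheight_add_one_le hlt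
    rw [List.length_cons, Nat.cast_add]
    exact (add_le_add_left h1 _).trans h2

/-- If `p` consisted of zero divisors on `N`, prime avoidance would put it inside an associated
prime `q`, and `length_le_coheight` would bound the depth by the coheight of `q`, hence of `p`. So
`p` contains a regular element as long as the depth exceeds its coheight; then one divides by it and
repeats. -/
theorem exists_isWeaklyRegular_of_le (p : PrimeSpectrum B) (k : ℕ) :
    ∀ (N : Type u) [AddCommGroup N] [Module B N] [Module.Finite B N] (d : ℕ), HasDepth B N d →
    k + Order.coheight p ≤ d →
    ∃ rs : List B, rs.length = k ∧ (∀ r ∈ rs, r ∈ p.asIdeal) ∧ IsWeaklyRegular N rs := by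
  induction k with
  | zero => intro N _ _ _ d _ _; exact ⟨[], rfl, by simp, IsWeaklyRegular.nil _ _⟩
  | succ k ih =>
    intro N _ _ _ d hd hk
    obtain ⟨x, hx, hreg⟩ : ∃ x ∈ p.asIdeal, IsSMulRegular N x := by
      by_contra! hcon
      have hsub : (p.asIdeal : Set B) ⊆ ⋃ q ∈ associatedPrimes B N, (q : Set B) := by
        rw [biUnion_associatedPrimes_eq_compl_regular B N]
        exact fun r hr => hcon r hr
      obtain ⟨q, hq, hle⟩ := (Ideal.subset_union_prime_finite (associatedPrimes.finite B N) ⊤ ⊤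
        (fun q hq _ _ => IsAssociatedPrime.isPrime hq)).1 hsub
      obtain ⟨rs, rfl, hm, hr⟩ := hd
      have h1 := length_le_coheight rs hm N hr ⟨q, IsAssociatedPrime.isPrime hq⟩ hq
      have h2 : Order.coheight (⟨q, IsAssociatedPrime.isPrime hq⟩ : PrimeSpectrum B) ≤
        Order.coheight p := Order.coheight_anti hle
      have h3 := hk.trans (h1.trans h2)
      have hfin : Order.coheight p ≠ ⊤ := fun h => by
        rw [h] at hk; simp at hk
      lift Order.coheight p to ℕ using hfin with c
      norm_cast at h3
      omega
    have hdpos : d ≠ 0 := by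
      rintro rfl
      have := le_of_add_le_left hk
      norm_cast at this
    obtain ⟨e, rfl⟩ := Nat.exists_eq_succ_of_ne_zero hdpos
    obtain ⟨rs, hl, hm, hr⟩ := ih (QuotSMulTop x N) e (hd.quotSMulTop hreg) (by
      have hfin : Order.coheight p ≠ ⊤ := fun h => by
        rw [h] at hk; simp at hk
      lift Order.coheight p to ℕ using hfin with c
      norm_cast at hk ⊢
      omega)
    exact ⟨x :: rs, by simp [hl], by simpa [hx] using hm, (isWeaklyRegular_cons_iff _ _ _).2 ⟨hreg, hr⟩⟩

end

/-- A local ring is Cohen-Macaulay if a weakly regular sequence in its maximal ideal is as long as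
the dimension. -/
def IsCM (B : Type*) [CommRing B] [IsLocalRing B] : Prop :=
  ∃ rs : List B, (∀ r ∈ rs, r ∈ maximalIdeal B) ∧ IsWeaklyRegular B rs ∧
    ringKrullDim B ≤ rs.length

theorem IsCM.of_ringEquiv {B B' : Type*} [CommRing B] [IsLocalRing B] [CommRing B']
    [IsLocalRing B'] (e : B ≃+* B') (h : IsCM B) : IsCM B' := by
  obtain ⟨rs, hm, hr, hd⟩ := h
  refine ⟨rs.map e, fun r hr => ?_, ?_, ?_⟩
  · obtain ⟨s, hs, rfl⟩ := List.mem_map.1 hr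
    have := hm s hs
    rw [mem_maximalIdeal, mem_nonunits_iff] at this ⊢
    simpa using this
  · refine (AddEquiv.isWeaklyRegular_congr (e := e.toAddEquiv) (as := rs) ?_).1 hr
    rw [List.forall₂_map_right_iff]
    exact List.forall₂_same.2 fun r _ x => map_mul e r x
  · rw [← ringKrullDim_eq_of_ringEquiv e]; simpa using hd

/-- Localizations of Cohen-Macaulay local rings are Cohen-Macaulay. -/
theorem IsCM.localization {B : Type u} [CommRing B] [IsLocalRing B] [IsNoetherianRing B]
    (h : IsCM B) (p : Ideal B) [hp : p.IsPrime] : IsCM (Localization.AtPrime p) := by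
  obtain ⟨rs, hm, hr, hd⟩ := h
  have h1 := (height_add_coheight_le (⟨p, hp⟩ : PrimeSpectrum B)).trans hd
  have hfin : Order.height (⟨p, hp⟩ : PrimeSpectrum B) ≠ ⊤ := fun h => by
    rw [h, top_add] at h1
    exact absurd h1 (by rw [not_le]; exact WithBot.coe_lt_coe.2 (ENat.natCast_lt_top _))
  obtain ⟨k, hk⟩ := ENat.ne_top_iff_exists.1 hfin
  -- Height plus coheight is at most the length of `rs`, so `p` itself contains a weakly regular
  -- sequence as long as its height, and localization preserves it.
  obtain ⟨rs', hl, hm', hr'⟩ := exists_isWeaklyRegular_of_le ⟨p, hp⟩ k B rs.length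
    ⟨rs, rfl, hm, hr⟩ (by rw [hk]; exact WithBot.coe_le_coe.1 h1)
  refine ⟨rs'.map (algebraMap B _), ?_, ?_, ?_⟩
  · intro r hr
    obtain ⟨s, hs, rfl⟩ := List.mem_map.1 hr
    exact (IsLocalization.AtPrime.to_map_mem_maximal_iff _ p s).2 (hm' s hs)
  · exact hr'.of_isLocalization _ p.primeCompl
  · rw [IsLocalization.AtPrime.ringKrullDim_eq_height p, List.length_map, hl]
    have h2 := PrimeSpectrum.height_eq_orderHeight (⟨p, hp⟩ : PrimeSpectrum B)
    rw [← hk] at h2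
    rw [show p.height = k from h2]; rfl

end LocalDepth

/-! ### Polynomial rings over Cohen-Macaulay rings -/

namespace LocalDepth

open IsLocalRing RingTheory.Sequence Polynomial

theorem isWeaklyRegular_append_singleton {A : Type*} [CommRing A] (rs : List A) (f : A)
    (h : IsWeaklyRegular A rs) (hf : ∀ g, f * g ∈ Ideal.ofList rs → g ∈ Ideal.ofList rs) :
    IsWeaklyRegular A (rs ++ [f]) := by
  rw [isWeaklyRegular_append_iff, isWeaklyRegular_singleton_iff]
  refine ⟨h, (isSMulRegular_quotient_iff_mem_of_smul_mem _ _).2 fun g hg => ?_⟩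
  simpa using hf g (by simpa using hg)

/-- The fibre over the residue field is a principal ideal domain, so `P` is either the extension of
the maximal ideal, of the same height, or is generated by it and one monic `f`, and then its height
is at most one larger. Monicity makes `f` regular modulo any ideal extended from `A`, so it prolongs
the sequence of `A`. -/
theorem isCM_polynomial_of_comap_eq {A : Type u} [CommRing A] [IsLocalRing A] [IsNoetherianRing A]
    (h : IsCM A) (P : Ideal A[X]) [hP : P.IsPrime] (hc : P.comap C = maximalIdeal A) :
    IsCM (Localization.AtPrime P) := by
  obtain ⟨rs, hm, hr, hd⟩ := h
  have hm' : ∀ r ∈ rs.map C, r ∈ P := by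
    intro r hr
    obtain ⟨s, hs, rfl⟩ := List.mem_map.1 hr
    have := hm s hs
    rwa [← hc] at this
  have hr' : IsWeaklyRegular A[X] (rs.map C) := hr.of_flat (S := A[X])
  have key : ∀ l : List A[X], (∀ r ∈ l, r ∈ P) → IsWeaklyRegular A[X] l →
      P.height ≤ (l.length : ℕ∞) → IsCM (Localization.AtPrime P) := by
    intro l hl hlr hh
    refine ⟨l.map (algebraMap A[X] _), ?_, hlr.of_isLocalization _ P.primeCompl, ?_⟩
    · intro r hr
      obtain ⟨s, hs, rfl⟩ := List.mem_map.1 hr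
      exact (IsLocalization.AtPrime.to_map_mem_maximal_iff _ P s).2 (hl s hs)
    · rw [IsLocalization.AtPrime.ringKrullDim_eq_height P, List.length_map]
      exact WithBot.coe_le_coe.2 hh
  have hdm : (maximalIdeal A).height ≤ (rs.length : ℕ∞) := by
    rw [← maximalIdeal_height_eq_ringKrullDim] at hd
    exact WithBot.coe_le_coe.1 hd
  by_cases hPe : P = (maximalIdeal A).map C
  · refine key _ hm' hr' ?_
    rw [hPe, Polynomial.height_map_C, List.length_map]
    exact hdm
  · obtain ⟨f, hf, hPf⟩ := exists_monic_span_sup_map_eq A P (by rw [hc]; infer_instance)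
      (by rwa [hc])
    refine key (rs.map C ++ [f]) ?_ (isWeaklyRegular_append_singleton _ _ hr' ?_) ?_
    · intro r hr
      rcases List.mem_append.1 hr with hr | hr
      · exact hm' r hr
      · rw [List.mem_singleton.1 hr, hPf]
        exact Ideal.mem_sup_right (Ideal.mem_span_singleton_self f)
    · intro g hg
      rw [← Ideal.map_ofList, ← Ideal.mk_ker (I := Ideal.ofList rs), ← Polynomial.ker_mapRingHom,
        RingHom.mem_ker] at hg ⊢
      rw [map_mul] at hg
      have hfm : (mapRingHom (Ideal.Quotient.mk (Ideal.ofList rs)) f).Monic := hf.map _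
      exact (hfm.mul_right_eq_zero_iff).1 hg
    · obtain ⟨M, hM, hPM⟩ := P.exists_le_maximal hP.ne_top
      have hMc : M.comap C = maximalIdeal A := by
        have hle : maximalIdeal A ≤ M.comap C := hc ▸ Ideal.comap_mono hPM
        exact ((maximalIdeal.isMaximal A).eq_of_le (Ideal.comap_ne_top _ hM.ne_top) hle).symm
      have : M.LiesOver (maximalIdeal A) := ⟨hMc.symm⟩
      have h1 := Polynomial.height_eq_height_add_one (maximalIdeal A) M
      calc P.height ≤ M.height := Ideal.height_mono hPM
        _ = (maximalIdeal A).height + 1 := h1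
        _ ≤ _ := by
          simp only [List.length_append, List.length_map, List.length_singleton, Nat.cast_add,
            Nat.cast_one]
          gcongr

/-- All localizations of `A` at primes are Cohen-Macaulay. -/
def IsCMRing (A : Type*) [CommRing A] : Prop :=
  ∀ (p : Ideal A) [p.IsPrime], IsCM (Localization.AtPrime p)

theorem IsCMRing.of_ringEquiv {A A' : Type*} [CommRing A] [CommRing A'] (e : A ≃+* A')
    (h : IsCMRing A) : IsCMRing A' := by
  intro p hp
  exact (h (p.comap e)).of_ringEquiv <| IsLocalization.ringEquivOfRingEquiv
    (Localization.AtPrime (p.comap e)) (Localization.AtPrime p) e (e.map_primeCompl_comap_eq p)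

attribute [local instance] Polynomial.algebra Polynomial.isLocalization in
theorem IsCMRing.polynomial {A : Type u} [CommRing A] [IsNoetherianRing A] (h : IsCMRing A) :
    IsCMRing A[X] := by
  intro p hp
  -- Localizing `A` at `q` first reduces to a prime of `A_q[X]` lying over the maximal ideal;
  -- localizing `A_q[X]` there recovers the localization of `A[X]` at `p`.
  let q := p.comap C
  let S := (Localization.AtPrime q)[X]
  let pc := Submonoid.map Polynomial.C.toMonoidHom q.primeCompl
  let : Algebra A[X] S := algebra A (Localization.AtPrime q)
  have : IsLocalization pc S := Polynomial.isLocalization _ _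
  let pS := p.map (algebraMap A[X] S)
  have disj : Disjoint (pc : Set A[X]) (p : Set A[X]) := by
    simpa [pc, q] using! Set.disjoint_image_left.mpr
      (Set.disjoint_compl_left_iff_subset.mpr (fun _ a ↦ a))
  have : pS.IsPrime := IsLocalization.isPrime_of_isPrime_disjoint pc _ _ ‹_› disj
  have : IsLocalization.AtPrime (Localization.AtPrime pS) p := by
    convert IsLocalization.isLocalization_isLocalization_atPrime_isLocalization pc
      (Localization.AtPrime pS) pS
    exact (IsLocalization.under_map_of_isPrime_disjoint pc _ ‹_› disj).symm
  have eq : Ideal.comap C pS = maximalIdeal (Localization.AtPrime q) := by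
    rw [← IsLocalization.map_under q.primeCompl _ (Ideal.comap C pS),
      ← IsLocalization.map_under q.primeCompl _ (maximalIdeal (Localization.AtPrime q))]
    simp only [Ideal.comap_comap, S, pS, Ideal.under_def]
    rw [← Polynomial.algebraMap_eq (R := Localization.AtPrime q),
      ← IsScalarTower.algebraMap_eq A (Localization.AtPrime q) (Localization.AtPrime q)[X],
      IsScalarTower.algebraMap_eq A A[X] (Localization.AtPrime q)[X], ← Ideal.comap_comap,
      ← Ideal.under_def A[X], IsLocalization.under_map_of_isPrime_disjoint pc _ ‹_› disj]
    have := IsLocalization.AtPrime.under_maximalIdeal (Localization.AtPrime q) q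
    rw [Ideal.under_def] at this
    rw [this]
    rfl
  exact (isCM_polynomial_of_comap_eq (h q) pS eq).of_ringEquiv
    (IsLocalization.algEquiv p.primeCompl
      (Localization.AtPrime pS) (Localization.AtPrime p)).toRingEquiv

theorem IsCMRing.mvPolynomial_fin {A : Type u} [CommRing A] [IsNoetherianRing A]
    (h : IsCMRing A) (n : ℕ) : IsCMRing (MvPolynomial (Fin n) A) := by
  induction n with
  | zero => exact h.of_ringEquiv (MvPolynomial.isEmptyRingEquiv A (Fin 0)).symm
  | succ n ih => exact ih.polynomial.of_ringEquiv (MvPolynomial.finSuccEquiv A n).symm.toRingEquiv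

end LocalDepth

/-! ### The coefficient rings -/

namespace PadicIntegers

variable (p : ℕ) [Fact p.Prime] (K : Type u) [Field K]
    [Algebra ℚ_[p] K] [Algebra ℤ_[p] K] [IsScalarTower ℤ_[p] ℚ_[p] K] [FiniteDimensional ℚ_[p] K]

/-- The spectral norm is at most one exactly when all coefficients of the minimal polynomial over
`ℚ_[p]` are `p`-adic integers. Multiplicativity and the ultrametric inequality then make the
elements of norm less than one the unique maximal ideal. -/
theorem isIntegral_iff_spectralNorm_le_one (x : K) :
    IsIntegral ℤ_[p] x ↔ spectralNorm ℚ_[p] K x ≤ 1 := by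
  have hx : IsIntegral ℚ_[p] x := Algebra.IsIntegral.isIntegral x
  rw [spectralNorm, spectralValue_le_one_iff (minpoly.monic hx)]
  constructor
  · intro h n
    rw [minpoly.isIntegrallyClosed_eq_field_fractions' ℚ_[p] h, Polynomial.coeff_map]
    exact PadicInt.norm_le_one _
  · intro h
    have hl : minpoly ℚ_[p] x ∈ Polynomial.lifts (algebraMap ℤ_[p] ℚ_[p]) := by
      rw [Polynomial.lifts_iff_coeff_lifts]
      exact fun n => ⟨⟨_, h n⟩, rfl⟩
    obtain ⟨q, hq, -, hqm⟩ := Polynomial.lifts_and_natDegree_eq_and_monic hl (minpoly.monic hx)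
    refine ⟨q, hqm, ?_⟩
    have := minpoly.aeval ℚ_[p] x
    rw [← hq] at this
    rwa [← Polynomial.aeval_def, ← Polynomial.aeval_map_algebraMap ℚ_[p]]

theorem spectralNorm_mul' (x y : K) : spectralNorm ℚ_[p] K (x * y) =
    spectralNorm ℚ_[p] K x * spectralNorm ℚ_[p] K y :=
  spectralAlgNorm_mul x y

theorem isUnit_iff (x : 𝒪 p K) : IsUnit x ↔ spectralNorm ℚ_[p] K (x : K) = 1 := by
  have hle : ∀ y : 𝒪 p K, spectralNorm ℚ_[p] K (y : K) ≤ 1 := fun y =>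
    (isIntegral_iff_spectralNorm_le_one p K y).1 y.2
  constructor
  · rintro ⟨v, rfl⟩
    have h1 : spectralNorm ℚ_[p] K ((v : 𝒪 p K) : K) *
        spectralNorm ℚ_[p] K (((v⁻¹ : (𝒪 p K)ˣ) : 𝒪 p K) : K) = 1 := by
      rw [← spectralNorm_mul', ← MulMemClass.coe_mul, Units.mul_inv, OneMemClass.coe_one,
        spectralNorm_one]
    have h2 := hle ((v⁻¹ : (𝒪 p K)ˣ) : 𝒪 p K)
    have h3 := hle v
    have h4 : 0 ≤ spectralNorm ℚ_[p] K ((v : 𝒪 p K) : K) := spectralNorm_nonneg _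
    nlinarith
  · intro h
    have hx0 : (x : K) ≠ 0 := fun h0 => by rw [h0, spectralNorm_zero] at h; norm_num at h
    have hinv : spectralNorm ℚ_[p] K (x : K)⁻¹ = 1 := by
      have := spectralNorm_mul' p K (x : K) (x : K)⁻¹
      rwa [mul_inv_cancel₀ hx0, spectralNorm_one, h, one_mul, eq_comm] at this
    exact IsUnit.of_mul_eq_one ⟨(x : K)⁻¹, (isIntegral_iff_spectralNorm_le_one p K _).2 hinv.le⟩
      (Subtype.ext (mul_inv_cancel₀ hx0))

instance : IsLocalRing (𝒪 p K) := by
  refine IsLocalRing.of_nonunits_add fun x y hx hy => ?_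
  have hlt : ∀ z : 𝒪 p K, z ∈ nonunits (𝒪 p K) ↔ spectralNorm ℚ_[p] K (z : K) < 1 := fun z => by
    rw [mem_nonunits_iff, isUnit_iff]
    exact (lt_iff_le_and_ne.trans
      (and_iff_right ((isIntegral_iff_spectralNorm_le_one p K _).1 z.2))).symm
  rw [hlt] at hx hy ⊢
  exact (isNonarchimedean_spectralNorm (x : K) (y : K)).trans_lt (max_lt hx hy)

theorem natCast_mem_maximalIdeal : (p : 𝒪 p K) ∈ IsLocalRing.maximalIdeal (𝒪 p K) := by
  rw [IsLocalRing.mem_maximalIdeal, mem_nonunits_iff, isUnit_iff]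
  have : (((p : 𝒪 p K)) : K) = algebraMap ℚ_[p] K p := by simp
  rw [this, spectralNorm_extends, Padic.norm_p]
  have := (Fact.out : p.Prime).one_lt
  exact (inv_lt_one_of_one_lt₀ (by exact_mod_cast this)).ne

theorem natCast_ne_zero : (p : 𝒪 p K) ≠ 0 := by
  intro h
  have : ((p : 𝒪 p K) : K) = 0 := by rw [h]; rfl
  have h2 : algebraMap ℚ_[p] K p = 0 := by simpa using this
  rw [map_eq_zero] at h2
  exact (Fact.out : p.Prime).ne_zero (by exact_mod_cast h2)

theorem ringKrullDim_le_one : ringKrullDim (𝒪 p K) ≤ 1 := by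
  have : IsDedekindDomain (𝒪 p K) := integralClosure.isDedekindDomain ℤ_[p] ℚ_[p] K
  exact Order.krullDimLE_iff 1 _ |>.1 inferInstance

end PadicIntegers

/-! ### Ideals of power series rings generated by variables -/

namespace MvPowerSeries

variable {σ R : Type*} [CommRing R]

theorem mem_span_X_image_iff (s : Finset σ) (f : MvPowerSeries σ R) :
    f ∈ Ideal.span (X '' (s : Set σ)) ↔
      ∀ m : σ →₀ ℕ, (∀ i ∈ s, m i = 0) → coeff m f = 0 := by
  classical
  constructor
  · intro h
    induction h using Submodule.span_induction with
    | mem x hx =>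
      obtain ⟨i, hi, rfl⟩ := hx
      exact fun m hm => X_dvd_iff.1 dvd_rfl m (hm i hi)
    | zero => simp
    | add x y _ _ hx hy => exact fun m hm => by rw [map_add, hx m hm, hy m hm, add_zero]
    | smul a x _ hx =>
      intro m hm
      rw [smul_eq_mul, coeff_mul]
      refine Finset.sum_eq_zero fun z hz => ?_
      rw [hx z.2 fun i hi => ?_, mul_zero]
      have h1 := DFunLike.congr_fun (Finset.HasAntidiagonal.mem_antidiagonal.1 hz) i
      have h2 := hm i hi
      simp only [Finsupp.coe_add, Pi.add_apply] at h1
      omega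
  · induction s using Finset.induction_on generalizing f with
    | empty =>
      intro h
      have : f = 0 := MvPowerSeries.ext fun m => h m (by simp)
      simp [this]
    | insert i s his ih =>
      intro h
      -- `g` is the part of `f` free of the variable `X i`: the difference is divisible by `X i`,
      -- and `g` satisfies the criterion for the smaller set `s`.
      let g : MvPowerSeries σ R := fun m => if m i = 0 then coeff m f else 0
      have hg : ∀ m, coeff m g = if m i = 0 then coeff m f else 0 := fun m => rfl
      have h1 : f - g ∈ Ideal.span (X '' ((insert i s : Finset σ) : Set σ)) := by
        obtain ⟨q, hq⟩ : X i ∣ f - g := X_dvd_iff.2 fun m hm => by simp [hg, hm]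
        rw [hq]
        exact Ideal.mul_mem_right _ _ (Ideal.subset_span ⟨i, by simp, rfl⟩)
      have h2 : g ∈ Ideal.span (X '' ((insert i s : Finset σ) : Set σ)) := by
        refine Ideal.span_mono (Set.image_mono (by simp)) (ih g fun m hm => ?_)
        rw [hg]
        split_ifs with hmi
        · exact h m (by simpa [hmi] using hm)
        · rfl
      simpa using add_mem h1 h2

/-- Setting the variables in `s` to zero is a ring map to the power series in the remaining ones, a
domain, and the coefficient criterion identifies its kernel. -/
instance isPrime_span_X_image [IsDomain R] (s : Finset σ) :
    (Ideal.span (X '' (s : Set σ) : Set (MvPowerSeries σ R))).IsPrime := by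
  classical
  let e : {i // i ∉ s} ↪ σ := Function.Embedding.subtype _
  have : Ideal.span (X '' (s : Set σ) : Set (MvPowerSeries σ R)) =
      RingHom.ker (killCompl (R := R) e) := by
    ext f
    rw [mem_span_X_image_iff, RingHom.mem_ker, MvPowerSeries.ext_iff]
    constructor
    · intro h x
      rw [coeff_killCompl]
      refine h _ fun i hi => Finsupp.embDomain_of_notMem_range _ _ _ ?_
      rintro ⟨j, rfl⟩
      exact j.2 hi
    · intro h m hm
      have h1 := h (m.comapDomain e e.injective.injOn)
      rw [coeff_killCompl, Finsupp.embDomain_eq_mapDomain, Finsupp.mapDomain_comapDomain] at h1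
      · simpa using h1
      · exact e.injective
      · intro i hi
        refine ⟨⟨i, fun his => ?_⟩, rfl⟩
        exact (Finsupp.mem_support_iff.1 hi) (hm i his)
  rw [this]
  have : IsDomain (MvPowerSeries { i // i ∉ s } R) := NoZeroDivisors.to_isDomain _
  exact RingHom.ker_isPrime _

theorem notMem_span_X_image (s : Finset σ) (f : MvPowerSeries σ R) (m : σ →₀ ℕ)
    (hm : ∀ i ∈ s, m i = 0) (hf : coeff m f ≠ 0) : f ∉ Ideal.span (X '' (s : Set σ)) :=
  fun h => hf ((mem_span_X_image_iff s f).1 h m hm)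

theorem X_notMem_span [Nontrivial R] (s : Finset σ) (i : σ) (hi : i ∉ s) :
    (X i : MvPowerSeries σ R) ∉ Ideal.span (X '' (s : Set σ)) :=
  notMem_span_X_image s _ (Finsupp.single i 1)
    (fun j hj => Finsupp.single_eq_of_ne (by rintro rfl; exact hi hj)) (by simp [coeff_index_single_self_X])

end MvPowerSeries

/-! ### The power series ring and the polynomial ring over it are Cohen-Macaulay -/

namespace NonGenericII

open LocalDepth RingTheory.Sequence

variable (O : Type u) [CommRing O] [IsDomain O]

/-- The ideal of `O⟦a₀, a₁, Y₀, Y₁⟧` generated by a set of variables. -/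
noncomputable abbrev varIdeal (s : Finset (Fin 4)) : Ideal (Coeff O) :=
  Ideal.span (MvPowerSeries.X '' (s : Set (Fin 4)))

/-- The four variables followed by `x` are weakly regular because ideals of variables are prime and
omit the next entry. Killing the variables leaves a quotient of `O`, of dimension at most one, so
the dimension is at most five. -/
theorem isCM_coeff [IsLocalRing O] [IsNoetherianRing O] (x : O)
    (hx : x ∈ IsLocalRing.maximalIdeal O) (hx0 : x ≠ 0) (hd : ringKrullDim O ≤ 1) :
    IsCM (Coeff O) := by
  classical
  let X : Fin 4 → Coeff O := MvPowerSeries.X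
  have hXm : ∀ i, X i ∈ IsLocalRing.maximalIdeal (Coeff O) := fun i => by
    rw [IsLocalRing.mem_maximalIdeal, mem_nonunits_iff, MvPowerSeries.isUnit_iff_constantCoeff]
    simp [X]
  have hCm : MvPowerSeries.C x ∈ IsLocalRing.maximalIdeal (Coeff O) := by
    rw [IsLocalRing.mem_maximalIdeal, mem_nonunits_iff] at hx ⊢
    rwa [MvPowerSeries.isUnit_iff_constantCoeff, MvPowerSeries.constantCoeff_C]
  have hofList : ∀ l : List (Fin 4), Ideal.ofList (l.map X) = varIdeal O l.toFinset := fun l => by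
    rw [Ideal.ofList, varIdeal]
    congr 1
    ext z
    simp [X]
  have step : ∀ (l : List (Fin 4)) (i : Fin 4), i ∉ l.toFinset → IsWeaklyRegular (Coeff O) (l.map X) →
      IsWeaklyRegular (Coeff O) ((l ++ [i]).map X) := by
    intro l i hi h
    rw [List.map_append]
    refine isWeaklyRegular_append_singleton _ _ h fun g hg => ?_
    rw [hofList] at hg ⊢
    exact ((MvPowerSeries.isPrime_span_X_image l.toFinset).mem_or_mem hg).resolve_left
      (MvPowerSeries.X_notMem_span _ i hi)
  have h4 : IsWeaklyRegular (Coeff O) ([0, 1, 2, 3].map X) := by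
    refine step [0, 1, 2] 3 (by decide) (step [0, 1] 2 (by decide) (step [0] 1 (by decide)
      (step [] 0 (by decide) (IsWeaklyRegular.nil _ _))))
  refine ⟨[0, 1, 2, 3].map X ++ [MvPowerSeries.C x], ?_, ?_, ?_⟩
  · intro r hr
    rcases List.mem_append.1 hr with hr | hr
    · obtain ⟨i, -, rfl⟩ := List.mem_map.1 hr
      exact hXm i
    · rw [List.mem_singleton.1 hr]; exact hCm
  · refine isWeaklyRegular_append_singleton _ _ h4 fun g hg => ?_
    rw [hofList] at hg ⊢
    refine ((MvPowerSeries.isPrime_span_X_image _).mem_or_mem hg).resolve_left ?_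
    exact MvPowerSeries.notMem_span_X_image _ _ 0 (by simp) (by simpa using hx0)
  · let T : Finset (Coeff O) := Finset.univ.image X
    have h1 : ringKrullDim (Coeff O) ≤
        ringKrullDim (Coeff O ⧸ Ideal.span (T : Set (Coeff O))) + T.card := by
      refine ringKrullDim_le_ringKrullDim_quotient_add_card T ?_
      rw [IsLocalRing.ringJacobson_eq_maximalIdeal]
      intro z hz
      obtain ⟨i, -, rfl⟩ := Finset.mem_image.1 (Finset.mem_coe.1 hz)
      exact hXm i
    have hT : (T : Set (Coeff O)) = MvPowerSeries.X '' ((Finset.univ : Finset (Fin 4)) : Set (Fin 4)) := by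
      simp [T, X]
    have h2 : ringKrullDim (Coeff O ⧸ Ideal.span (T : Set (Coeff O))) ≤ 1 := by
      refine (ringKrullDim_le_of_surjective
        ((Ideal.Quotient.mk _).comp (MvPowerSeries.C : O →+* Coeff O)) ?_).trans hd
      intro z
      obtain ⟨z, rfl⟩ := Ideal.Quotient.mk_surjective z
      refine ⟨MvPowerSeries.constantCoeff z, Ideal.Quotient.eq.2 ?_⟩
      rw [hT, MvPowerSeries.mem_span_X_image_iff]
      intro m hm
      have : m = 0 := Finsupp.ext fun i => hm i (Finset.mem_univ i)
      simp [this]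
    have h3 : T.card ≤ 4 := Finset.card_image_le.trans (by simp)
    have h5 : (T.card : WithBot ℕ∞) ≤ ((4 : ℕ) : WithBot ℕ∞) := by exact_mod_cast h3
    calc ringKrullDim (Coeff O) ≤ _ := h1
      _ ≤ 1 + ((4 : ℕ) : WithBot ℕ∞) := add_le_add h2 h5
      _ = _ := by norm_num

theorem isCMRing_poly [IsLocalRing O] [IsNoetherianRing O] (x : O)
    (hx : x ∈ IsLocalRing.maximalIdeal O) (hx0 : x ≠ 0) (hd : ringKrullDim O ≤ 1) :
    IsCMRing (Poly O) :=
  IsCMRing.mvPolynomial_fin (fun p _ => (isCM_coeff O x hx hx0 hd).localization p) 3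

end NonGenericII

/-! ### Kernels of the maps to Laurent polynomial rings -/

namespace ExtendedRees

open Polynomial

/-- If `ψ` sends `X` to the fraction `y / c` and `y` is regular modulo `c`, the kernel of `ψ` is
generated by `y - c X` and the constants in the kernel. -/
theorem mem_of_map_eq_zero {D E : Type*} [CommRing D] [CommRing E] (ψ : D[X] →+* E) (K : Ideal D)
    (hK : ∀ d, ψ (C d) = 0 ↔ d ∈ K) (y c : D) (hψ : ψ (C c) * ψ Polynomial.X = ψ (C y))
    (hdiv : ∀ z, y * z ∈ K ⊔ Ideal.span {c} → z ∈ K ⊔ Ideal.span {c}) (p : D[X]) (hp : ψ p = 0) :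
    p ∈ K.map C ⊔ Ideal.span {C y - C c * Polynomial.X} := by
  have hpow : ∀ (n : ℕ) (z : D), y ^ n * z ∈ K ⊔ Ideal.span {c} → z ∈ K ⊔ Ideal.span {c} := by
    intro n
    induction n with
    | zero => intro z hz; simpa using hz
    | succ n ih => intro z hz; exact ih z (hdiv _ (by rwa [← mul_assoc, ← pow_succ']))
  suffices h : ∀ (n : ℕ) (p : D[X]), p.natDegree < n + 1 → ψ p = 0 →
      p ∈ K.map C ⊔ Ideal.span {C y - C c * Polynomial.X} from h p.natDegree p (Nat.lt_succ_self _) hp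
  intro n
  induction n with
  | zero =>
    intro p hdeg hp
    have h0 : p = C (p.coeff 0) := eq_C_of_natDegree_le_zero (by omega)
    rw [h0] at hp ⊢
    exact Ideal.mem_sup_left (Ideal.mem_map_of_mem C ((hK _).1 hp))
  | succ n ih =>
    intro p hdeg hp
    have hmem : p.coeff (n + 1) ∈ K ⊔ Ideal.span {c} := by
      refine hpow (n + 1) _ ?_
      -- Clearing denominators: multiplying `ψ p = 0` by `c ^ (n + 1)` replaces `X ^ k` by `y ^ k c
      -- ^ (n + 1 - k)`. Modulo `c` only the top term survives, and regularity of `y` puts the top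
      -- coefficient in `K + (c)`.
      have h1 : ∑ k ∈ Finset.range (n + 2), p.coeff k * y ^ k * c ^ (n + 1 - k) ∈ K := by
        rw [← hK, map_sum, map_sum]
        have h2 : ψ (C c) ^ (n + 1) * ψ p = 0 := by rw [hp, mul_zero]
        rw [← h2]
        conv_rhs => rw [p.as_sum_range_C_mul_X_pow' hdeg]
        rw [map_sum, Finset.mul_sum]
        refine Finset.sum_congr rfl fun k hk => ?_
        have hk' : n + 1 = k + (n + 1 - k) := by
          have := Finset.mem_range.1 hk; omega
        have h3 : ψ (C c) ^ (n + 1) = ψ (C c) ^ k * ψ (C c) ^ (n + 1 - k) := by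
          rw [← pow_add, ← hk']
        rw [h3]
        simp only [map_mul, map_pow]
        rw [← hψ]
        ring
      rw [Finset.sum_range_succ] at h1
      have h4 : ∑ k ∈ Finset.range (n + 1), p.coeff k * y ^ k * c ^ (n + 1 - k) ∈ Ideal.span {c} := by
        refine Ideal.sum_mem _ fun k hk => Ideal.mul_mem_left _ _ ?_
        exact Ideal.mem_span_singleton.2 (dvd_pow_self c (by have := Finset.mem_range.1 hk; omega))
      have h5 := sub_mem (Ideal.mem_sup_left (T := Ideal.span {c}) h1)
        (Ideal.mem_sup_right (S := K) h4)
      rw [add_sub_cancel_left, Nat.sub_self, pow_zero, mul_one, mul_comm] at h5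
      exact h5
    obtain ⟨k, hk, q, hq, hkq⟩ := Submodule.mem_sup.1 hmem
    obtain ⟨q, rfl⟩ := Ideal.mem_span_singleton'.1 hq
    have hkm : C k * Polynomial.X ^ (n + 1) ∈ K.map C ⊔ Ideal.span {C y - C c * Polynomial.X} :=
      Ideal.mul_mem_right _ _ (Ideal.mem_sup_left (Ideal.mem_map_of_mem C hk))
    have hqm : C q * Polynomial.X ^ n * (C y - C c * Polynomial.X) ∈ K.map C ⊔ Ideal.span {C y - C c * Polynomial.X} :=
      Ideal.mul_mem_left _ _ (Ideal.mem_sup_right (Ideal.mem_span_singleton_self _))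
    have hψk : ψ (C k) = 0 := (hK k).2 hk
    -- With top coefficient `k + q c`, the generator `y - c X` trades `q c X ^ (n + 1)` for `q y X ^
    -- n`, which lowers the degree bound.
    have hr := ih (p - C k * Polynomial.X ^ (n + 1) + C q * Polynomial.X ^ n * (C y - C c * Polynomial.X)) ?_ ?_
    · have := sub_mem (add_mem hr hkm) hqm
      convert this using 1
      ring
    · rw [Nat.lt_succ_iff, natDegree_le_iff_coeff_eq_zero]
      intro m hm
      rcases Nat.lt_or_ge (n + 1) m with h | h
      · have e1 : p.coeff m = 0 := coeff_eq_zero_of_natDegree_lt (by omega)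
        have e2 : C q * Polynomial.X ^ n * (C y - C c * Polynomial.X) = C (q * y) * Polynomial.X ^ n - C (q * c) * Polynomial.X ^ (n + 1) := by
          simp only [map_mul]; ring
        rw [e2]
        simp only [coeff_add, coeff_sub, coeff_C_mul, coeff_X_pow, e1]
        rw [if_neg (by omega), if_neg (by omega)]
        simp
      · obtain rfl : m = n + 1 := by omega
        have e2 : C q * Polynomial.X ^ n * (C y - C c * Polynomial.X) = C (q * y) * Polynomial.X ^ n - C (q * c) * Polynomial.X ^ (n + 1) := by
          simp only [map_mul]; ring
        rw [e2]
        simp only [coeff_add, coeff_sub, coeff_C_mul, coeff_X_pow]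
        rw [if_neg (show ¬ n + 1 = n by omega), ← hkq]
        simp
    · simp only [map_add, map_sub, map_mul, map_pow, hp, hψk, ← hψ]
      ring

section

variable {A : Type*} [CommRing A] (I : Ideal A) (y₀ y₁ : A)

/-- The map `A[c] → A[b₀, b₁, c]`. -/
noncomputable def incl₁ (A : Type*) [CommRing A] : A[X] →+* MvPolynomial (Fin 3) A :=
  eval₂RingHom MvPolynomial.C (MvPolynomial.X 2)

/-- The map `A[c][b₁] → A[b₀, b₁, c]`. -/
noncomputable def incl₂ (A : Type*) [CommRing A] : A[X][X] →+* MvPolynomial (Fin 3) A :=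
  eval₂RingHom (incl₁ A) (MvPolynomial.X 1)

/-- The map `A[c][b₁][b₀] → A[b₀, b₁, c]`. -/
noncomputable def incl₃ (A : Type*) [CommRing A] : A[X][X][X] →+* MvPolynomial (Fin 3) A :=
  eval₂RingHom (incl₂ A) (MvPolynomial.X 0)

@[simp] theorem incl₁_C (a : A) : incl₁ A (C a) = MvPolynomial.C a := by simp [incl₁]
@[simp] theorem incl₁_X : incl₁ A Polynomial.X = MvPolynomial.X 2 := by simp [incl₁]
@[simp] theorem incl₂_C (a : A[X]) : incl₂ A (C a) = incl₁ A a := by simp [incl₂]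
@[simp] theorem incl₂_X : incl₂ A Polynomial.X = MvPolynomial.X 1 := by simp [incl₂]
@[simp] theorem incl₃_C (a : A[X][X]) : incl₃ A (C a) = incl₂ A a := by simp [incl₃]
@[simp] theorem incl₃_X : incl₃ A Polynomial.X = MvPolynomial.X 0 := by simp [incl₃]

theorem incl₂_relator (y : A) : incl₂ A (C (C y) - C Polynomial.X * Polynomial.X) =
    MvPolynomial.C y - MvPolynomial.X 1 * MvPolynomial.X 2 := by
  refine ((incl₂ A).map_sub _ _).trans ?_
  rw [RingHom.map_mul, incl₂_C, incl₂_C, incl₁_C, incl₁_X, incl₂_X, mul_comm]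

theorem map_C_sub_C_mul_X {D E : Type*} [CommRing D] [CommRing E] (ψ : D[X] →+* E) (d e : D) :
    ψ (C d - C e * Polynomial.X) = ψ (C d) - ψ (C e) * ψ Polynomial.X := by
  rw [map_sub, map_mul]

theorem incl₃_relator (y : A) : incl₃ A (C (C (C y)) - C (C Polynomial.X) * Polynomial.X) =
    MvPolynomial.C y - MvPolynomial.X 0 * MvPolynomial.X 2 := by
  refine (map_C_sub_C_mul_X (incl₃ A) (C (C y)) (C Polynomial.X)).trans ?_
  rw [incl₃_C, incl₃_C, incl₂_C, incl₂_C, incl₁_C, incl₁_X, incl₃_X, mul_comm]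

theorem incl₃_surjective : Function.Surjective (incl₃ A) := by
  intro x
  induction x using MvPolynomial.induction_on with
  | C a => exact ⟨C (C (C a)), by simp⟩
  | add x y hx hy =>
    obtain ⟨x, rfl⟩ := hx
    obtain ⟨y, rfl⟩ := hy
    exact ⟨x + y, map_add _ _ _⟩
  | mul_X x i hx =>
    obtain ⟨x, rfl⟩ := hx
    have : ∃ z, incl₃ A z = MvPolynomial.X i := by
      fin_cases i
      · exact ⟨Polynomial.X, by simp⟩
      · exact ⟨C Polynomial.X, by simp⟩
      · exact ⟨C (C Polynomial.X), by simp⟩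
    obtain ⟨z, hz⟩ := this
    exact ⟨x * z, by rw [map_mul, hz]⟩

/-- The map `A[b₀, b₁, c] → (A / I)[T, T⁻¹]` with `c ↦ T`, `bᵢ ↦ yᵢ T⁻¹`. -/
noncomputable def toRees : MvPolynomial (Fin 3) A →+* LaurentPolynomial (A ⧸ I) :=
  MvPolynomial.eval₂Hom (LaurentPolynomial.C.comp (Ideal.Quotient.mk I))
    ![LaurentPolynomial.C (Ideal.Quotient.mk I y₀) * LaurentPolynomial.T (-1),
      LaurentPolynomial.C (Ideal.Quotient.mk I y₁) * LaurentPolynomial.T (-1),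
      LaurentPolynomial.T 1]

@[simp] theorem toRees_C (a : A) : toRees I y₀ y₁ (MvPolynomial.C a) =
    LaurentPolynomial.C (Ideal.Quotient.mk I a) := by simp [toRees]
@[simp] theorem toRees_X₀ : toRees I y₀ y₁ (MvPolynomial.X 0) =
    LaurentPolynomial.C (Ideal.Quotient.mk I y₀) * LaurentPolynomial.T (-1) := by simp [toRees]
@[simp] theorem toRees_X₁ : toRees I y₀ y₁ (MvPolynomial.X 1) =
    LaurentPolynomial.C (Ideal.Quotient.mk I y₁) * LaurentPolynomial.T (-1) := by simp [toRees]
@[simp] theorem toRees_X₂ : toRees I y₀ y₁ (MvPolynomial.X 2) = LaurentPolynomial.T 1 := by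
  simp [toRees]

theorem toRees_incl₁_eq_zero_iff (d : A[X]) :
    (toRees I y₀ y₁).comp (incl₁ A) d = 0 ↔ d ∈ I.map C := by
  have : (toRees I y₀ y₁).comp (incl₁ A) =
      (Polynomial.toLaurent).comp (mapRingHom (Ideal.Quotient.mk I)) := by
    refine Polynomial.ringHom_ext (fun a => ?_) ?_ <;> simp
  rw [this, RingHom.comp_apply, map_eq_zero_iff _ Polynomial.toLaurent_injective,
    ← RingHom.mem_ker, Polynomial.ker_mapRingHom, Ideal.mk_ker]

theorem mem_map_sup_span_X_iff (d : A[X]) :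
    d ∈ I.map C ⊔ Ideal.span {Polynomial.X} ↔ d.coeff 0 ∈ I := by
  have hd : d = C (d.coeff 0) + d.divX * Polynomial.X := by rw [add_comm]; exact (divX_mul_X_add d).symm
  constructor
  · intro h
    obtain ⟨e, he, f, hf, rfl⟩ := Submodule.mem_sup.1 h
    obtain ⟨f, rfl⟩ := Ideal.mem_span_singleton'.1 hf
    simpa using Ideal.mem_map_C_iff.1 he 0
  · intro h
    rw [hd]
    exact add_mem (Ideal.mem_sup_left (Ideal.mem_map_of_mem C h))
      (Ideal.mem_sup_right (Ideal.mul_mem_left _ _ (Ideal.mem_span_singleton_self Polynomial.X)))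

/-- The kernel of `A[c][b₁] → (A / I)[T, T⁻¹]`. -/
noncomputable def ker₂ : Ideal A[X][X] := (I.map C).map C ⊔ Ideal.span {C (C y₁) - C Polynomial.X * Polynomial.X}

variable {I y₀ y₁} (h₁ : ∀ z, y₁ * z ∈ I → z ∈ I)
include h₁

/-- The general kernel statement with `b₁` in the role of `y₁ / c` over `A[c]`. Modulo `c` the base
becomes `A / I`, where `y₁` is regular by assumption. Adjoining `b₀` afterwards is a second
application over `A[c][b₁]`. -/
theorem toRees_incl₂_eq_zero_iff (d : A[X][X]) :
    (toRees I y₀ y₁).comp (incl₂ A) d = 0 ↔ d ∈ ker₂ I y₁ := by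
  constructor
  · refine mem_of_map_eq_zero ((toRees I y₀ y₁).comp (incl₂ A)) (I.map C) (fun d => ?_) (C y₁) Polynomial.X
      ?_ (fun z hz => ?_) d
    · rw [← toRees_incl₁_eq_zero_iff I y₀ y₁]; simp
    · simp
    · rw [mem_map_sup_span_X_iff] at hz ⊢
      exact h₁ _ (by simpa using hz)
  · rw [← RingHom.mem_ker]
    revert d
    change ker₂ I y₁ ≤ _
    refine sup_le ?_ ?_
    · refine Ideal.map_le_iff_le_comap.2 fun d hd => ?_
      rw [← toRees_incl₁_eq_zero_iff I y₀ y₁] at hd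
      simpa [RingHom.mem_ker] using hd
    · rw [Ideal.span_singleton_le_iff_mem, RingHom.mem_ker]
      simp

/-- If `y₁` is regular modulo `I` and `y₀` is regular modulo `I` and `y₁`, the kernel of `toRees`
is generated by `I` and `yᵢ - bᵢ c`. -/
theorem mem_of_toRees_eq_zero (h₀ : ∀ z, y₀ * z ∈ I ⊔ Ideal.span {y₁} → z ∈ I ⊔ Ideal.span {y₁})
    (x : MvPolynomial (Fin 3) A) (hx : toRees I y₀ y₁ x = 0) :
    x ∈ I.map MvPolynomial.C ⊔ Ideal.span {MvPolynomial.C y₀ - MvPolynomial.X 0 * MvPolynomial.X 2,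
      MvPolynomial.C y₁ - MvPolynomial.X 1 * MvPolynomial.X 2} := by
  obtain ⟨q, rfl⟩ := incl₃_surjective x
  let Z := (I.map MvPolynomial.C ⊔ Ideal.span
    {MvPolynomial.C y₀ - MvPolynomial.X 0 * MvPolynomial.X 2,
      MvPolynomial.C y₁ - MvPolynomial.X 1 * MvPolynomial.X 2} : Ideal (MvPolynomial (Fin 3) A))
  -- Modulo `c` the relator `y₁ - c b₁` becomes `y₁`, so dividing `A[c][b₁]` by `ker₂` and `c` gives
  -- polynomials in `b₁` over `A / (I + y₁)`. There regularity of `y₀` can be tested on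
  -- coefficients.
  let θ : A[X][X] →+* (A ⧸ (I ⊔ Ideal.span {y₁}))[X] :=
    mapRingHom ((Ideal.Quotient.mk (I ⊔ Ideal.span {y₁})).comp constantCoeff)
  have hθ : ∀ z, z ∈ ker₂ I y₁ ⊔ Ideal.span {C Polynomial.X} ↔ θ z = 0 := by
    intro z
    constructor
    · rw [← RingHom.mem_ker]
      revert z
      change ker₂ I y₁ ⊔ Ideal.span {C Polynomial.X} ≤ _
      refine sup_le (sup_le ?_ ?_) ?_
      · rw [Ideal.map_le_iff_le_comap, Ideal.map_le_iff_le_comap]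
        intro a ha
        simpa [θ, RingHom.mem_ker, Ideal.Quotient.eq_zero_iff_mem] using Ideal.mem_sup_left ha
      · rw [Ideal.span_singleton_le_iff_mem, RingHom.mem_ker]
        simpa [θ, Ideal.Quotient.eq_zero_iff_mem] using
          Ideal.mem_sup_right (Ideal.mem_span_singleton_self _)
      · rw [Ideal.span_singleton_le_iff_mem, RingHom.mem_ker]
        simp [θ]
    · intro hz
      have hz' : z ∈ Ideal.map C (RingHom.ker
          ((Ideal.Quotient.mk (I ⊔ Ideal.span {y₁})).comp (constantCoeff (R := A)))) := by
        rw [← Polynomial.ker_mapRingHom]; exact hz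
      revert hz'
      refine fun h => Ideal.map_le_iff_le_comap.2 (fun w hw => ?_) h
      have hw0 : w.coeff 0 ∈ I ⊔ Ideal.span {y₁} := by
        simpa [RingHom.mem_ker, Ideal.Quotient.eq_zero_iff_mem] using hw
      obtain ⟨i, hi, j, hj, hij⟩ := Submodule.mem_sup.1 hw0
      obtain ⟨j, rfl⟩ := Ideal.mem_span_singleton'.1 hj
      have hd : w = C i + C j * C y₁ + w.divX * Polynomial.X := by
        rw [← map_mul, ← map_add, hij, add_comm]; exact (divX_mul_X_add w).symm
      rw [Ideal.mem_comap, hd]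
      have e1 : (C (C i) : A[X][X]) ∈ ker₂ I y₁ ⊔ Ideal.span {C Polynomial.X} :=
        Ideal.mem_sup_left (Ideal.mem_sup_left (Ideal.mem_map_of_mem C (Ideal.mem_map_of_mem C hi)))
      have e2 : (C (C y₁) - C Polynomial.X * Polynomial.X : A[X][X]) ∈ ker₂ I y₁ ⊔ Ideal.span {C Polynomial.X} :=
        Ideal.mem_sup_left (Ideal.mem_sup_right (Ideal.mem_span_singleton_self _))
      have e3 : (C Polynomial.X : A[X][X]) ∈ ker₂ I y₁ ⊔ Ideal.span {C Polynomial.X} :=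
        Ideal.mem_sup_right (Ideal.mem_span_singleton_self _)
      have e4 := add_mem (add_mem e1 (Ideal.mul_mem_left _ (C (C j)) e2))
        (Ideal.mul_mem_right (C (C j) * Polynomial.X + C w.divX) _ e3)
      convert e4 using 1
      simp only [map_add, map_mul]
      ring
  have h := mem_of_map_eq_zero ((toRees I y₀ y₁).comp (incl₃ A)) (ker₂ I y₁) (fun d => by
      rw [← toRees_incl₂_eq_zero_iff (y₀ := y₀) h₁]; simp) (C (C y₀)) (C Polynomial.X)
    (by simp)
    (fun z hz => by
      rw [hθ] at hz ⊢
      rw [map_mul] at hz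
      ext n
      have hn := congrArg (fun w => Polynomial.coeff w n) hz
      obtain ⟨t, ht⟩ := Ideal.Quotient.mk_surjective ((θ z).coeff n)
      simp only [θ, coe_mapRingHom, map_C, coeff_C_mul, coeff_zero] at hn ht ⊢
      rw [← ht] at hn ⊢
      simp only [RingHom.comp_apply, constantCoeff_apply, coeff_C_zero] at hn
      rw [← map_mul, Ideal.Quotient.eq_zero_iff_mem] at hn
      rw [Ideal.Quotient.eq_zero_iff_mem]
      exact h₀ _ hn) q hx
  have hle : (ker₂ I y₁).map C ⊔ Ideal.span {C (C (C y₀)) - C (C Polynomial.X) * Polynomial.X} ≤ Z.comap (incl₃ A) := by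
    refine sup_le (Ideal.map_le_iff_le_comap.2 (sup_le ?_ ?_)) ?_
    · rw [Ideal.map_le_iff_le_comap, Ideal.map_le_iff_le_comap]
      intro a ha
      have : MvPolynomial.C a ∈ Z := Ideal.mem_sup_left (Ideal.mem_map_of_mem _ ha)
      simpa using this
    · rw [Ideal.span_singleton_le_iff_mem]
      have : MvPolynomial.C y₁ - MvPolynomial.X 1 * MvPolynomial.X 2 ∈ Z :=
        Ideal.mem_sup_right (Ideal.subset_span (by simp))
      rw [← incl₂_relator] at this
      exact (congrArg (· ∈ Z) (incl₃_C _)).mpr this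
    · rw [Ideal.span_singleton_le_iff_mem]
      have : MvPolynomial.C y₀ - MvPolynomial.X 0 * MvPolynomial.X 2 ∈ Z :=
        Ideal.mem_sup_right (Ideal.subset_span (by simp))
      rw [← incl₃_relator] at this
      exact this
  exact hle h

/-- If `y₀ ∈ I` and `y₁` is regular modulo `I`, the kernel of `toRees` is generated by `I`, `b₀`
and `y₁ - b₁ c`. -/
theorem mem_of_toRees_eq_zero' (h₀ : y₀ ∈ I) (x : MvPolynomial (Fin 3) A)
    (hx : toRees I y₀ y₁ x = 0) :
    x ∈ I.map MvPolynomial.C ⊔ Ideal.span {MvPolynomial.X 0,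
      MvPolynomial.C y₁ - MvPolynomial.X 1 * MvPolynomial.X 2} := by
  obtain ⟨q, rfl⟩ := incl₃_surjective x
  let Z := (I.map MvPolynomial.C ⊔ Ideal.span {MvPolynomial.X 0,
      MvPolynomial.C y₁ - MvPolynomial.X 1 * MvPolynomial.X 2} : Ideal (MvPolynomial (Fin 3) A))
  have hd : q = C (q.coeff 0) + q.divX * Polynomial.X := by rw [add_comm]; exact (divX_mul_X_add q).symm
  have hX : MvPolynomial.X 0 ∈ Z := Ideal.mem_sup_right (Ideal.subset_span (by simp))
  -- As `y₀ ∈ I`, the variable `b₀` maps to zero, and only the part of `q` without `b₀` is seen by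
  -- the map.
  have h2 : q.coeff 0 ∈ ker₂ I y₁ := by
    rw [← toRees_incl₂_eq_zero_iff (y₀ := y₀) h₁]
    rw [hd] at hx
    simpa [Ideal.Quotient.eq_zero_iff_mem.2 h₀] using hx
  have hle : ker₂ I y₁ ≤ Z.comap (incl₂ A) := by
    refine sup_le ?_ ?_
    · rw [Ideal.map_le_iff_le_comap, Ideal.map_le_iff_le_comap]
      intro a ha
      have : MvPolynomial.C a ∈ Z := Ideal.mem_sup_left (Ideal.mem_map_of_mem _ ha)
      simpa using this
    · rw [Ideal.span_singleton_le_iff_mem]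
      have : MvPolynomial.C y₁ - MvPolynomial.X 1 * MvPolynomial.X 2 ∈ Z :=
        Ideal.mem_sup_right (Ideal.subset_span (by simp))
      rw [← incl₂_relator] at this
      exact this
  rw [hd, map_add, map_mul, incl₃_C, incl₃_X]
  exact add_mem (hle h2) (Ideal.mul_mem_left _ _ hX)

end

/-- `y₁ - b₁ c` is regular modulo `y₀ - b₀ c`. -/
theorem mem_span_of_mul_mem_span {A : Type*} [CommRing A] [IsDomain A] {y₀ y₁ : A} (h₀ : y₀ ≠ 0)
    (h₁ : y₁ ≠ 0) (x : MvPolynomial (Fin 3) A)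
    (hx : (MvPolynomial.C y₁ - MvPolynomial.X 1 * MvPolynomial.X 2) * x ∈
      Ideal.span {MvPolynomial.C y₀ - MvPolynomial.X 0 * MvPolynomial.X 2}) :
    x ∈ Ideal.span {MvPolynomial.C y₀ - MvPolynomial.X 0 * MvPolynomial.X 2} := by
  -- Putting `b₀ = y₀ / c` embeds the quotient by `y₀ - b₀ c` into the field of fractions of
  -- `A[c][b₁]`. So it is a domain, in which `y₁ - b₁ c` is nonzero.
  let F := FractionRing A[X][X]
  let i : A[X][X] →+* F := algebraMap _ _
  have hi : Function.Injective i := IsFractionRing.injective _ _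
  have hc : i (C Polynomial.X) ≠ 0 := by rw [Ne, map_eq_zero_iff i hi]; simp
  let θ : MvPolynomial (Fin 3) A →+* F := MvPolynomial.eval₂Hom (i.comp (C.comp C))
    ![i (C (C y₀)) / i (C Polynomial.X), i Polynomial.X, i (C Polynomial.X)]
  have hθ : ∀ x, θ x = 0 →
      x ∈ Ideal.span {MvPolynomial.C y₀ - MvPolynomial.X 0 * MvPolynomial.X 2} := by
    intro x hx
    obtain ⟨q, rfl⟩ := incl₃_surjective x
    have hcomp : ∀ d, θ (incl₂ A d) = i d := by
      intro d
      have : θ.comp (incl₂ A) = i := by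
        refine Polynomial.ringHom_ext (fun d => ?_) (by simp [θ])
        have : (θ.comp (incl₁ A)) = i.comp C :=
          Polynomial.ringHom_ext (fun a => by simp [θ]) (by simp [θ])
        simpa using RingHom.congr_fun this d
      exact RingHom.congr_fun this d
    have h := mem_of_map_eq_zero (θ.comp (incl₃ A)) ⊥ (fun d => by
        rw [RingHom.comp_apply, incl₃_C, hcomp, map_eq_zero_iff i hi, Ideal.mem_bot])
      (C (C y₀)) (C Polynomial.X) (by
        rw [RingHom.comp_apply, RingHom.comp_apply, RingHom.comp_apply, incl₃_C, incl₃_C, hcomp,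
          hcomp, incl₃_X]
        simp only [θ, MvPolynomial.coe_eval₂Hom, MvPolynomial.eval₂_X, Matrix.cons_val_zero]
        exact mul_div_cancel₀ _ hc) (fun z hz => by
        rw [bot_sup_eq, Ideal.mem_span_singleton] at hz ⊢
        -- The regularity needed for the kernel statement: `c` is prime in `A[c][b₁]` and does not
        -- divide the nonzero constant `y₀`.
        have hp : Prime (C Polynomial.X : A[X][X]) := Polynomial.prime_C_iff.2 Polynomial.prime_X
        refine (hp.dvd_or_dvd hz).resolve_left fun h => ?_
        rw [Polynomial.C_dvd_iff_dvd_coeff] at h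
        have := h 0
        rw [coeff_C_zero, Polynomial.X_dvd_iff, coeff_C_zero] at this
        exact h₀ this) q hx
    rw [Ideal.map_bot, bot_sup_eq] at h
    obtain ⟨w, rfl⟩ := Ideal.mem_span_singleton'.1 h
    refine Ideal.mem_span_singleton'.2 ⟨incl₃ A w, ?_⟩
    rw [← incl₃_relator]
    exact (RingHom.map_mul _ _ _).symm
  have hθ0 : θ (MvPolynomial.C y₀ - MvPolynomial.X 0 * MvPolynomial.X 2) = 0 := by
    have h1 : θ (MvPolynomial.X 0) = i (C (C y₀)) / i (C Polynomial.X) := by simp [θ]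
    have h2 : θ (MvPolynomial.X 2) = i (C Polynomial.X) := by simp [θ]
    have h3 : θ (MvPolynomial.C y₀) = i (C (C y₀)) := by simp [θ]
    rw [map_sub, map_mul, h1, h2, h3, div_mul_cancel₀ _ hc, sub_self]
  refine hθ x ?_
  obtain ⟨w, hw⟩ := Ideal.mem_span_singleton'.1 hx
  have h2 : θ (MvPolynomial.C y₁ - MvPolynomial.X 1 * MvPolynomial.X 2) * θ x = 0 := by
    rw [← map_mul, ← hw, map_mul, hθ0, mul_zero]
  refine (mul_eq_zero.1 h2).resolve_left fun h => ?_
  have h3 : i (C (C y₁) - Polynomial.X * C Polynomial.X) = 0 := by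
    rw [← h]; simp only [map_sub, map_mul, θ, MvPolynomial.coe_eval₂Hom, MvPolynomial.eval₂_X, MvPolynomial.eval₂_C]; simp
  rw [map_eq_zero_iff i hi] at h3
  have h4 := congrArg (fun w => (Polynomial.coeff w 0).coeff 0) h3
  simp at h4
  exact h₁ h4

end ExtendedRees

/-! ### Regularity in the graded ring `S` -/

namespace ExtendedRees

/-- `T ^ n` is a unit and multiplication by `z` acts coefficientwise, so regularity of `q` modulo
the kernel reduces to regularity of `z` modulo `I`. All regularity statements below except the one
modulo `c` come from this. -/
theorem toRees_eq_zero_of_mul {A : Type*} [CommRing A] {I : Ideal A} {y₀ y₁ z : A}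
    (hz : ∀ w, z * w ∈ I → w ∈ I) {q x : MvPolynomial (Fin 3) A} {n : ℤ}
    (hq : toRees I y₀ y₁ q = LaurentPolynomial.C (Ideal.Quotient.mk I z) * LaurentPolynomial.T n)
    (h : toRees I y₀ y₁ (q * x) = 0) : toRees I y₀ y₁ x = 0 := by
  rw [map_mul, hq] at h
  have h1 : LaurentPolynomial.C (Ideal.Quotient.mk I z) * toRees I y₀ y₁ x = 0 := by
    have h2 : LaurentPolynomial.T (-n) * (LaurentPolynomial.C (Ideal.Quotient.mk I z) *
      LaurentPolynomial.T n * toRees I y₀ y₁ x) = 0 := by rw [h, mul_zero]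
    have h3 : (LaurentPolynomial.T (-n) * LaurentPolynomial.T n : LaurentPolynomial (A ⧸ I)) = 1 := by
      rw [← LaurentPolynomial.T_add, neg_add_cancel, LaurentPolynomial.T_zero]
    linear_combination h2 - LaurentPolynomial.C (Ideal.Quotient.mk I z) * toRees I y₀ y₁ x * h3
  ext k
  have h2 := congrArg (fun f : LaurentPolynomial (A ⧸ I) => f.coeff k) h1
  obtain ⟨w, hw⟩ := Ideal.Quotient.mk_surjective ((toRees I y₀ y₁ x).coeff k)
  have h3 : Ideal.Quotient.mk I z * (toRees I y₀ y₁ x).coeff k = 0 := by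
    rw [← LaurentPolynomial.smul_eq_C_mul] at h2
    exact h2
  rw [← hw, ← map_mul, Ideal.Quotient.eq_zero_iff_mem] at h3
  exact hw.symm.trans (Ideal.Quotient.eq_zero_iff_mem.2 (hz _ h3))

theorem ker_toRees_of_regular {A : Type*} [CommRing A] {I : Ideal A} {y₀ y₁ : A}
    (h₁ : ∀ z, y₁ * z ∈ I → z ∈ I)
    (h₀ : ∀ z, y₀ * z ∈ I ⊔ Ideal.span {y₁} → z ∈ I ⊔ Ideal.span {y₁}) :
    RingHom.ker (toRees I y₀ y₁) = I.map MvPolynomial.C ⊔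
      Ideal.span {MvPolynomial.C y₀ - MvPolynomial.X 0 * MvPolynomial.X 2,
        MvPolynomial.C y₁ - MvPolynomial.X 1 * MvPolynomial.X 2} := by
  refine le_antisymm (fun x hx => mem_of_toRees_eq_zero h₁ h₀ x hx) (sup_le ?_ ?_)
  · rw [Ideal.map_le_iff_le_comap]
    intro a ha
    simp [RingHom.mem_ker, Ideal.Quotient.eq_zero_iff_mem.2 ha]
  · rw [Ideal.span_le]
    rintro _ (rfl | rfl) <;> simp [RingHom.mem_ker]

theorem ker_toRees_of_mem {A : Type*} [CommRing A] {I : Ideal A} {y₀ y₁ : A}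
    (h₁ : ∀ z, y₁ * z ∈ I → z ∈ I) (h₀ : y₀ ∈ I) :
    RingHom.ker (toRees I y₀ y₁) = I.map MvPolynomial.C ⊔
      Ideal.span {MvPolynomial.X 0, MvPolynomial.C y₁ - MvPolynomial.X 1 * MvPolynomial.X 2} := by
  refine le_antisymm (fun x hx => mem_of_toRees_eq_zero' h₁ h₀ x hx) (sup_le ?_ ?_)
  · rw [Ideal.map_le_iff_le_comap]
    intro a ha
    simp [RingHom.mem_ker, Ideal.Quotient.eq_zero_iff_mem.2 ha]
  · rw [Ideal.span_le]
    rintro _ (rfl | rfl) <;> simp [RingHom.mem_ker, Ideal.Quotient.eq_zero_iff_mem.2 h₀]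

end ExtendedRees

/-! ### Quotients of the polynomial ring inside Laurent polynomials -/

namespace NonGenericII

open ExtendedRees MvPolynomial

variable (O : Type u) [CommRing O]

/-- The ideal of `O⟦a₀, a₁, Y₀, Y₁⟧[b₀, b₁, c]` generated by `Yᵢ - bᵢ c`. -/
noncomputable def relIdeal₂ : Ideal (Poly O) :=
  Ideal.span {C (MvPowerSeries.X 2) - MvPolynomial.X 0 * MvPolynomial.X 2, C (MvPowerSeries.X 3) - MvPolynomial.X 1 * MvPolynomial.X 2}

/-- The element `p + a₁` of the coefficient ring. -/
noncomputable def ca₁' (p : ℕ) : Coeff O := MvPowerSeries.X 1 + (p : Coeff O)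

/-- The relator `(p + a₁) b₀ + a₀ b₁`. -/
noncomputable def relator₃ (p : ℕ) : Poly O :=
  C (ca₁' O p) * MvPolynomial.X 0 + C (MvPowerSeries.X 0) * MvPolynomial.X 1

theorem relIdeal_eq (p : ℕ) : relIdeal O p = relIdeal₂ O ⊔ Ideal.span {relator₃ O p} := by
  have h3 : relators O p 2 = relator₃ O p := by
    simp [relators, relator₃, ca₁']; ring
  have h : Set.range (relators O p) = {C (MvPowerSeries.X 2) - MvPolynomial.X 0 * MvPolynomial.X 2,
      C (MvPowerSeries.X 3) - MvPolynomial.X 1 * MvPolynomial.X 2} ∪ {relator₃ O p} := by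
    ext x
    rw [← h3]
    simp only [Set.mem_range, Fin.exists_fin_succ, Set.mem_union, Set.mem_insert_iff,
      Set.mem_singleton_iff, relators]
    simp [eq_comm, or_assoc]
  rw [relIdeal, h, Ideal.span_union]
  rfl

variable {O} in
theorem mk_eq_zero_iff (p : ℕ) (x : Poly O) :
    mk O p x = 0 ↔ ∃ g, x - relator₃ O p * g ∈ relIdeal₂ O := by
  rw [mk_eq_zero, relIdeal_eq]
  constructor
  · intro h
    obtain ⟨j, hj, k, hk, rfl⟩ := Submodule.mem_sup.1 h
    obtain ⟨g, rfl⟩ := Ideal.mem_span_singleton'.1 hk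
    exact ⟨g, by convert hj using 1; ring⟩
  · rintro ⟨g, hg⟩
    have := add_mem (Ideal.mem_sup_left (T := Ideal.span {relator₃ O p}) hg)
      (Ideal.mem_sup_right (Ideal.mul_mem_right g _ (Ideal.mem_span_singleton_self _)))
    simpa using this

theorem relIdeal₂_le (p : ℕ) {x : Poly O} (hx : x ∈ relIdeal₂ O) : mk O p x = 0 :=
  (mk_eq_zero_iff p x).2 ⟨0, by simpa using hx⟩

variable [IsDomain O] (p : ℕ)

/-- The maps of extended Rees type with `bᵢ c = Yᵢ`. -/
noncomputable abbrev rees (I : Ideal (Coeff O)) : Poly O →+* LaurentPolynomial (Coeff O ⧸ I) :=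
  toRees I (MvPowerSeries.X 2) (MvPowerSeries.X 3)

theorem varIdeal_insert (s : Finset (Fin 4)) (i : Fin 4) :
    varIdeal O (insert i s) = varIdeal O s ⊔ Ideal.span {MvPowerSeries.X i} := by
  rw [varIdeal, Finset.coe_insert, Set.image_insert_eq, Ideal.span_insert, sup_comm]

theorem varIdeal_empty : varIdeal O ∅ = ⊥ := by simp [varIdeal]

variable {O} in
theorem mem_varIdeal_of_mul {s : Finset (Fin 4)} {i : Fin 4} (hi : i ∉ s) (z : Coeff O)
    (hz : MvPowerSeries.X i * z ∈ varIdeal O s) : z ∈ varIdeal O s :=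
  ((MvPowerSeries.isPrime_span_X_image s).mem_or_mem hz).resolve_left
    (MvPowerSeries.X_notMem_span _ i hi)

theorem ca₁'_notMem {s : Finset (Fin 4)} (hs : (1 : Fin 4) ∉ s) : ca₁' O p ∉ varIdeal O s := by
  refine MvPowerSeries.notMem_span_X_image s _ (Finsupp.single 1 1)
    (fun j hj => Finsupp.single_eq_of_ne (by rintro rfl; exact hs hj)) ?_
  have h : MvPowerSeries.coeff (Finsupp.single (1 : Fin 4) 1) (p : Coeff O) = 0 := by
    classical
    rw [← map_natCast (MvPowerSeries.C (σ := Fin 4) (R := O)), MvPowerSeries.coeff_C,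
      if_neg (by simp)]
  rw [ca₁', map_add, h, add_zero, MvPowerSeries.coeff_index_single_self_X]
  exact one_ne_zero

variable {O p} in
theorem mem_varIdeal_of_ca₁'_mul {s : Finset (Fin 4)} (hs : (1 : Fin 4) ∉ s) (z : Coeff O)
    (hz : ca₁' O p * z ∈ varIdeal O s) : z ∈ varIdeal O s :=
  ((MvPowerSeries.isPrime_span_X_image s).mem_or_mem hz).resolve_left (ca₁'_notMem O p hs)

/-- `Y₁`, then `Y₀`, is a regular sequence modulo the variables in `s`, as required by the
computation of the kernel of `toRees`. -/
theorem ker_rees_of_disjoint (s : Finset (Fin 4)) (h₂ : (2 : Fin 4) ∉ s) (h₃ : (3 : Fin 4) ∉ s) :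
    RingHom.ker (rees O (varIdeal O s)) = (varIdeal O s).map C ⊔ relIdeal₂ O := by
  refine ker_toRees_of_regular (fun z hz => mem_varIdeal_of_mul h₃ z hz) fun z hz => ?_
  rw [← varIdeal_insert] at hz ⊢
  exact mem_varIdeal_of_mul (by simpa using h₂) z hz

theorem ker_rees_of_mem (I : Ideal (Coeff O)) (h₂ : MvPowerSeries.X 2 ∈ I)
    (h₃ : ∀ z, MvPowerSeries.X 3 * z ∈ I → z ∈ I) :
    RingHom.ker (rees O I) = I.map C ⊔ Ideal.span {MvPolynomial.X 0} ⊔ relIdeal₂ O := by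
  rw [rees, ker_toRees_of_mem h₃ h₂, sup_assoc]
  refine le_antisymm (sup_le_sup_left ?_ _) (sup_le le_sup_left (sup_le ?_ ?_))
  · rw [Ideal.span_le]
    rintro _ (rfl | rfl)
    · exact Ideal.mem_sup_left (Ideal.mem_span_singleton_self _)
    · exact Ideal.mem_sup_right (Ideal.subset_span (by simp))
  · rw [Ideal.span_singleton_le_iff_mem]
    exact Ideal.mem_sup_right (Ideal.subset_span (by simp))
  · rw [relIdeal₂, Ideal.span_le]
    have hX : (MvPolynomial.X 0 : Poly O) ∈ I.map C ⊔ Ideal.span {MvPolynomial.X 0,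
        C (MvPowerSeries.X 3) - MvPolynomial.X 1 * MvPolynomial.X 2} := Ideal.mem_sup_right (Ideal.subset_span (by simp))
    rintro _ (rfl | rfl)
    · exact sub_mem (Ideal.mem_sup_left (Ideal.mem_map_of_mem _ h₂)) (Ideal.mul_mem_right _ _ hX)
    · exact Ideal.mem_sup_right (Ideal.subset_span (by simp))

theorem rees_X₀ (I : Ideal (Coeff O)) : rees O I (MvPolynomial.X 0) =
    LaurentPolynomial.C (Ideal.Quotient.mk I (MvPowerSeries.X 2)) * LaurentPolynomial.T (-1) :=
  toRees_X₀ _ _ _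
theorem rees_X₁ (I : Ideal (Coeff O)) : rees O I (MvPolynomial.X 1) =
    LaurentPolynomial.C (Ideal.Quotient.mk I (MvPowerSeries.X 3)) * LaurentPolynomial.T (-1) :=
  toRees_X₁ _ _ _
theorem rees_C (I : Ideal (Coeff O)) (z : Coeff O) : rees O I (C z) =
    LaurentPolynomial.C (Ideal.Quotient.mk I z) * LaurentPolynomial.T 0 := by
  rw [LaurentPolynomial.T_zero, mul_one]; exact toRees_C _ _ _ _

theorem rees_relator₃ (I : Ideal (Coeff O)) : rees O I (relator₃ O p) =
    LaurentPolynomial.C (Ideal.Quotient.mk I (ca₁' O p * MvPowerSeries.X 2 +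
      MvPowerSeries.X 0 * MvPowerSeries.X 3)) * LaurentPolynomial.T (-1) := by
  simp only [relator₃, map_add, map_mul, toRees_C, rees, toRees_X₀, toRees_X₁]
  ring

end NonGenericII

/-! ### Regular elements and syzygies in `S` -/

namespace NonGenericII

open ExtendedRees MvPolynomial

variable (O : Type u) [CommRing O] [IsDomain O] (p : ℕ)

theorem ker_rees_bot : RingHom.ker (rees O ⊥) = relIdeal₂ O := by
  have := ker_rees_of_disjoint O ∅ (by simp) (by simp)
  rwa [varIdeal_empty, Ideal.map_bot, bot_sup_eq] at this

theorem bot_isPrime : (⊥ : Ideal (Coeff O)).IsPrime := by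
  rw [← varIdeal_empty]; infer_instance

/-- It is the kernel of a map to Laurent polynomials over a domain. -/
theorem isPrime_relIdeal₂ : (relIdeal₂ O).IsPrime := by
  have := bot_isPrime O
  have : NoZeroDivisors (LaurentPolynomial (Coeff O ⧸ (⊥ : Ideal (Coeff O)))) := inferInstance
  rw [← ker_rees_bot]
  exact RingHom.ker_isPrime _

variable {O p}

theorem mem_relIdeal₂_of_rees {q x : Poly O} {z : Coeff O} {n : ℤ} (hz : z ≠ 0)
    (hq : rees O ⊥ q = LaurentPolynomial.C (Ideal.Quotient.mk ⊥ z) * LaurentPolynomial.T n)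
    (h : q * x ∈ relIdeal₂ O) : x ∈ relIdeal₂ O := by
  rw [← ker_rees_bot] at h ⊢
  refine toRees_eq_zero_of_mul (z := z) (fun w hw => ?_) hq h
  exact ((bot_isPrime O).mem_or_mem hw).resolve_left (by simpa using hz)

/-- In either case one of the two summands lies in the prime ideal, and the other is a product of
two elements outside it. The element is, up to the factor `T⁻¹`, the image of the third relator. -/
theorem relator_notMem (s : Finset (Fin 4)) (h : (1 : Fin 4) ∉ s ∧ (2 : Fin 4) ∉ s ∧ (0 : Fin 4) ∈ s ∨
    (0 : Fin 4) ∉ s ∧ (3 : Fin 4) ∉ s ∧ (2 : Fin 4) ∈ s) :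
    ca₁' O p * MvPowerSeries.X 2 + MvPowerSeries.X 0 * MvPowerSeries.X 3 ∉ varIdeal O s := by
  have hX : ∀ i ∈ s, (MvPowerSeries.X i : Coeff O) ∈ varIdeal O s := fun i hi =>
    Ideal.subset_span ⟨i, hi, rfl⟩
  rcases h with ⟨h1, h2, h0⟩ | ⟨h0, h3, h2⟩
  · rw [Ideal.add_mem_iff_left _ (Ideal.mul_mem_right _ _ (hX 0 h0))]
    intro h
    exact MvPowerSeries.X_notMem_span _ _ h2 (mem_varIdeal_of_ca₁'_mul h1 _ h)
  · rw [Ideal.add_mem_iff_right _ (Ideal.mul_mem_left _ _ (hX 2 h2))]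
    intro h
    exact MvPowerSeries.X_notMem_span _ _ h3 (mem_varIdeal_of_mul h0 _ h)

theorem relator_ne_zero :
    ca₁' O p * MvPowerSeries.X 2 + MvPowerSeries.X 0 * MvPowerSeries.X 3 ≠ 0 := fun h =>
  relator_notMem (O := O) (p := p) {0} (by decide) (by rw [h]; exact zero_mem _)

/-- The relator `a₁' b₀ + a₀ b₁` is regular modulo `Yᵢ - bᵢ c`. -/
theorem mem_relIdeal₂_of_relator₃_mul {x : Poly O} (h : relator₃ O p * x ∈ relIdeal₂ O) :
    x ∈ relIdeal₂ O :=
  mem_relIdeal₂_of_rees relator_ne_zero (rees_relator₃ O p ⊥) h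

theorem mem_of_mul_of_disjoint {s : Finset (Fin 4)} (h₂ : (2 : Fin 4) ∉ s) (h₃ : (3 : Fin 4) ∉ s)
    {q x : Poly O} {z : Coeff O} {n : ℤ} (hz : z ∉ varIdeal O s)
    (hq : rees O (varIdeal O s) q =
      LaurentPolynomial.C (Ideal.Quotient.mk _ z) * LaurentPolynomial.T n)
    (h : q * x ∈ (varIdeal O s).map C ⊔ relIdeal₂ O) :
    x ∈ (varIdeal O s).map C ⊔ relIdeal₂ O := by
  rw [← ker_rees_of_disjoint O s h₂ h₃] at h ⊢
  refine toRees_eq_zero_of_mul (z := z) (fun w hw => ?_) hq h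
  exact ((MvPowerSeries.isPrime_span_X_image s).mem_or_mem hw).resolve_left hz

theorem mem_of_mul_of_mem {s : Finset (Fin 4)} (h₂ : (2 : Fin 4) ∈ s) (h₃ : (3 : Fin 4) ∉ s)
    {q x : Poly O} {z : Coeff O} {n : ℤ} (hz : z ∉ varIdeal O s)
    (hq : rees O (varIdeal O s) q =
      LaurentPolynomial.C (Ideal.Quotient.mk _ z) * LaurentPolynomial.T n)
    (h : q * x ∈ (varIdeal O s).map C ⊔ Ideal.span {MvPolynomial.X 0} ⊔ relIdeal₂ O) :
    x ∈ (varIdeal O s).map C ⊔ Ideal.span {MvPolynomial.X 0} ⊔ relIdeal₂ O := by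
  have hX : MvPowerSeries.X 2 ∈ varIdeal O s := Ideal.subset_span ⟨2, h₂, rfl⟩
  rw [← ker_rees_of_mem O _ hX (fun z hz => mem_varIdeal_of_mul h₃ z hz)] at h ⊢
  refine toRees_eq_zero_of_mul (z := z) (fun w hw => ?_) hq h
  exact ((MvPowerSeries.isPrime_span_X_image s).mem_or_mem hw).resolve_left hz

/-- Since `Y₀ = b₀ c`, dividing by `b₀` also kills `Y₀`, so the quotient embeds in Laurent
polynomials over the power series modulo `Y₀`. -/
theorem mem_span_X₀_of_mul {q x : Poly O} {z : Coeff O} {n : ℤ} (hz : z ∉ varIdeal O {2})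
    (hq : rees O (varIdeal O {2}) q =
      LaurentPolynomial.C (Ideal.Quotient.mk _ z) * LaurentPolynomial.T n)
    (h : q * x ∈ Ideal.span {MvPolynomial.X 0} ⊔ relIdeal₂ O) :
    x ∈ Ideal.span {MvPolynomial.X 0} ⊔ relIdeal₂ O := by
  have e : (varIdeal O {2}).map C ⊔ Ideal.span {MvPolynomial.X 0} ⊔ relIdeal₂ O =
      Ideal.span {MvPolynomial.X 0} ⊔ relIdeal₂ O := by
    rw [sup_assoc, sup_eq_right]
    have : varIdeal O {2} = Ideal.span {MvPowerSeries.X 2} := by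
      simp [varIdeal]
    rw [this, Ideal.map_span, Set.image_singleton, Ideal.span_singleton_le_iff_mem]
    have h1 : C (MvPowerSeries.X 2) - MvPolynomial.X 0 * MvPolynomial.X 2 ∈ relIdeal₂ O :=
      Ideal.subset_span (by simp)
    have := add_mem (Ideal.mem_sup_right (S := Ideal.span {MvPolynomial.X 0}) h1)
      (Ideal.mem_sup_left (Ideal.mul_mem_right (MvPolynomial.X 2) _
        (Ideal.mem_span_singleton_self (MvPolynomial.X 0))))
    simpa using this
  rw [← e] at h ⊢
  exact mem_of_mul_of_mem (by simp) (by decide) hz hq h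

/-- Reduction modulo `Y₀, Y₁` and `c`. -/
noncomputable def modC : Poly O →+* MvPolynomial (Fin 3) (Coeff O ⧸ varIdeal O {2, 3}) :=
  eval₂Hom (C.comp (Ideal.Quotient.mk _)) ![MvPolynomial.X 0, MvPolynomial.X 1, 0]

theorem ker_modC : RingHom.ker (modC (O := O)) = Ideal.span {MvPolynomial.X 2} ⊔ relIdeal₂ O := by
  set Z := Ideal.span {MvPolynomial.X 2} ⊔ relIdeal₂ O with hZ
  have hc : (MvPolynomial.X 2 : Poly O) ∈ Z :=
    Ideal.mem_sup_left (Ideal.mem_span_singleton_self _)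
  have hY : ∀ i ∈ ({2, 3} : Finset (Fin 4)), (C (MvPowerSeries.X i) : Poly O) ∈ Z := by
    intro i hi
    have h0 : C (MvPowerSeries.X 2) - MvPolynomial.X 0 * MvPolynomial.X 2 ∈ Z :=
      Ideal.mem_sup_right (Ideal.subset_span (by simp))
    have h1 : C (MvPowerSeries.X 3) - MvPolynomial.X 1 * MvPolynomial.X 2 ∈ Z :=
      Ideal.mem_sup_right (Ideal.subset_span (by simp))
    rcases Finset.mem_insert.1 hi with rfl | hi
    · simpa using add_mem h0 (Ideal.mul_mem_left _ (MvPolynomial.X 0) hc)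
    · rw [Finset.mem_singleton] at hi
      subst hi
      simpa using add_mem h1 (Ideal.mul_mem_left _ (MvPolynomial.X 1) hc)
  refine le_antisymm (fun x hx => ?_) (sup_le ?_ ?_)
  · let κ : Poly O →+* Poly O := eval₂Hom C ![MvPolynomial.X 0, MvPolynomial.X 1, 0]
    have h1 : (Ideal.Quotient.mk Z).comp κ = Ideal.Quotient.mk Z := by
      refine MvPolynomial.ringHom_ext (fun a => by simp [κ]) fun i => ?_
      fin_cases i
      · simp [κ]
      · simp [κ]
      · simp [κ, Ideal.Quotient.eq_zero_iff_mem.2 hc]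
    have h2 : (MvPolynomial.map (Ideal.Quotient.mk (varIdeal O {2, 3}))).comp κ = modC := by
      refine MvPolynomial.ringHom_ext (fun a => by simp [κ, modC]) fun i => ?_
      fin_cases i <;> simp [κ, modC]
    rw [← Ideal.Quotient.eq_zero_iff_mem, ← h1, RingHom.comp_apply, Ideal.Quotient.eq_zero_iff_mem]
    have h3 : κ x ∈ (RingHom.ker (Ideal.Quotient.mk (varIdeal O {2, 3}))).map C := by
      rw [← MvPolynomial.ker_map, RingHom.mem_ker, ← RingHom.comp_apply, h2]
      exact hx
    rw [Ideal.mk_ker] at h3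
    refine (Ideal.map_le_iff_le_comap.2 (Ideal.span_le.2 ?_)) h3
    rintro _ ⟨i, hi, rfl⟩
    exact hY i hi
  · rw [Ideal.span_singleton_le_iff_mem]
    simp [RingHom.mem_ker, modC]
  · have hX : ∀ i ∈ ({2, 3} : Finset (Fin 4)),
        Ideal.Quotient.mk (varIdeal O {2, 3}) (MvPowerSeries.X i) = 0 := fun i hi =>
      Ideal.Quotient.eq_zero_iff_mem.2 (Ideal.subset_span ⟨i, hi, rfl⟩)
    rw [relIdeal₂, Ideal.span_le]
    rintro _ (rfl | rfl)
    · rw [SetLike.mem_coe, RingHom.mem_ker, map_sub, map_mul]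
      simp [modC, hX 2]
    · rw [SetLike.mem_coe, RingHom.mem_ker, map_sub, map_mul]
      simp [modC, hX 3]

/-- Modulo `c` the Laurent embedding is not available, but there `Y₀` and `Y₁` vanish and what
remains is a polynomial ring in `b₀, b₁` over a domain. The coefficient `a₀` of `b₁` shows that the
relator is nonzero in it. -/
theorem mem_span_X₂_of_relator₃_mul {x : Poly O}
    (h : relator₃ O p * x ∈ Ideal.span {MvPolynomial.X 2} ⊔ relIdeal₂ O) :
    x ∈ Ideal.span {MvPolynomial.X 2} ⊔ relIdeal₂ O := by
  rw [← ker_modC] at h ⊢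
  refine ((RingHom.ker_isPrime (modC (O := O))).mem_or_mem h).resolve_left fun h => ?_
  have h1 : modC (relator₃ O p) =
      C (Ideal.Quotient.mk _ (ca₁' O p)) * MvPolynomial.X 0 +
        C (Ideal.Quotient.mk _ (MvPowerSeries.X 0)) * MvPolynomial.X 1 := by
    simp [modC, relator₃]
  have h2 := congrArg (MvPolynomial.coeff (Finsupp.single 1 1)) (h1.symm.trans h)
  rw [coeff_add, coeff_C_mul, coeff_C_mul, coeff_X, coeff_X, if_neg (by
    rw [Finsupp.single_left_inj one_ne_zero]; decide), if_pos rfl, mul_zero, zero_add, mul_one, coeff_zero,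
    Ideal.Quotient.eq_zero_iff_mem] at h2
  exact MvPowerSeries.X_notMem_span _ _ (by decide) h2

/-- If the relator is regular modulo `q` and `q` is regular modulo `Yᵢ - bᵢ c`, then `q` is regular
in `S`. -/
theorem eq_zero_of_mk_mul {q : Poly O}
    (h₁ : ∀ x, relator₃ O p * x ∈ Ideal.span {q} ⊔ relIdeal₂ O → x ∈ Ideal.span {q} ⊔ relIdeal₂ O)
    (h₂ : q ∉ relIdeal₂ O) (x : S O p) (hx : mk O p q * x = 0) : x = 0 := by
  obtain ⟨x, rfl⟩ := mk_surjective O p x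
  rw [← map_mul, mk_eq_zero_iff] at hx
  obtain ⟨g, hg⟩ := hx
  have h3 : relator₃ O p * g ∈ Ideal.span {q} ⊔ relIdeal₂ O := by
    have := sub_mem (Ideal.mem_sup_left (T := relIdeal₂ O) (Ideal.mul_mem_right x _
      (Ideal.mem_span_singleton_self q))) (Ideal.mem_sup_right hg)
    simpa using this
  -- Exchange of a regular pair: `q x` is the relator times `g` modulo `relIdeal₂`, and `g` is a
  -- multiple `k q`, so `q` times `x` minus the relator times `k` lies in a prime ideal not
  -- containing `q`.
  obtain ⟨k, hk, j, hj, rfl⟩ := Submodule.mem_sup.1 (h₁ g h3)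
  obtain ⟨k, rfl⟩ := Ideal.mem_span_singleton'.1 hk
  rw [mk_eq_zero_iff]
  refine ⟨k, ((isPrime_relIdeal₂ O).mem_or_mem (x := q) ?_).resolve_left h₂⟩
  have := add_mem hg (Ideal.mul_mem_left _ (relator₃ O p) hj)
  convert this using 1
  ring

theorem notMem_relIdeal₂ {q : Poly O} {z : Coeff O} {n : ℤ} (hz : z ≠ 0)
    (hq : rees O ⊥ q = LaurentPolynomial.C (Ideal.Quotient.mk ⊥ z) * LaurentPolynomial.T n) :
    q ∉ relIdeal₂ O := fun h => by
  have h1 := mem_relIdeal₂_of_rees (x := 1) hz hq (by simpa using h)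
  exact (isPrime_relIdeal₂ O).ne_top ((Ideal.eq_top_iff_one _).2 h1)

theorem X_ne_zero (i : Fin 4) : (MvPowerSeries.X i : Coeff O) ≠ 0 := fun h =>
  MvPowerSeries.X_notMem_span ∅ i (by simp) (by rw [h]; exact zero_mem _)

theorem X₂_notMem : (MvPolynomial.X 2 : Poly O) ∉ relIdeal₂ O := fun h => by
  have h2 : (MvPolynomial.X 2 : Poly O) * MvPolynomial.X 0 ∈ relIdeal₂ O :=
    Ideal.mul_mem_right _ _ h
  have h1 : C (MvPowerSeries.X 2) - MvPolynomial.X 0 * MvPolynomial.X 2 ∈ relIdeal₂ O :=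
    Ideal.subset_span (by simp)
  refine notMem_relIdeal₂ (O := O) (X_ne_zero 2) (rees_C O ⊥ _) ?_
  have := add_mem h1 h2
  convert this using 1
  ring

theorem eq_zero_of_b₀_mul (x : S O p) (hx : b O p 0 * x = 0) : x = 0 :=
  eq_zero_of_mk_mul (q := MvPolynomial.X 0) (fun _ hx => mem_span_X₀_of_mul
    (relator_notMem _ (by decide)) (rees_relator₃ O p _) hx)
    (notMem_relIdeal₂ (X_ne_zero _) (rees_X₀ O _)) x hx

theorem eq_zero_of_c_mul (x : S O p) (hx : c O p * x = 0) : x = 0 :=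
  eq_zero_of_mk_mul (q := MvPolynomial.X 2) (fun _ hx => mem_span_X₂_of_relator₃_mul hx)
    X₂_notMem x hx

theorem map_varIdeal_singleton_zero : (varIdeal O {0}).map C =
    Ideal.span {(C (MvPowerSeries.X 0) : Poly O)} := by
  rw [varIdeal, Finset.coe_singleton, Set.image_singleton, Ideal.map_span, Set.image_singleton]

theorem eq_zero_of_a₀_mul (x : S O p) (hx : a₀ O p * x = 0) : x = 0 :=
  eq_zero_of_mk_mul (q := C (MvPowerSeries.X 0)) (fun x hx => by
    rw [← map_varIdeal_singleton_zero] at hx ⊢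
    exact mem_of_mul_of_disjoint (by decide) (by decide)
      (relator_notMem _ (by decide)) (rees_relator₃ O p _) hx)
    (notMem_relIdeal₂ (X_ne_zero _) (rees_C O ⊥ _)) x hx

theorem mk_C_X₀ : mk O p (C (MvPowerSeries.X 0)) = a₀ O p := rfl
theorem mk_ca₁' : mk O p (C (ca₁' O p)) = a₁' O p := rfl
theorem mk_X₀ : mk O p (MvPolynomial.X 0) = b O p 0 := rfl
theorem mk_X₁ : mk O p (MvPolynomial.X 1) = b O p 1 := rfl

/-- The syzygies of `(b₀, b₁)`. -/
theorem exists_of_b_mul {x y : S O p} (h : x * b O p 0 + y * b O p 1 = 0) :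
    ∃ w z, x = a₁' O p * w + b O p 1 * z ∧ y = a₀ O p * w - b O p 0 * z := by
  obtain ⟨x', rfl⟩ := mk_surjective O p x
  obtain ⟨y', rfl⟩ := mk_surjective O p y
  have h1 := h
  rw [← mk_X₀, ← mk_X₁, ← map_mul, ← map_mul, ← map_add, mk_eq_zero_iff] at h1
  obtain ⟨g, hg⟩ := h1
  -- Lifted to polynomials, `x b₀ + y b₁` equals `(a₁' b₀ + a₀ b₁) g` modulo `relIdeal₂`. So `b₁ (y
  -- - a₀ g)` is a multiple of `b₀`, and `b₁` is regular modulo `b₀`. The formula for `x` then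
  -- follows by cancelling `b₀` in `S`.
  have h2 : y' - C (MvPowerSeries.X 0) * g ∈ Ideal.span {MvPolynomial.X 0} ⊔ relIdeal₂ O := by
    refine mem_span_X₀_of_mul (q := MvPolynomial.X 1) (z := MvPowerSeries.X 3) (n := -1)
      (MvPowerSeries.X_notMem_span _ _ (by decide)) (rees_X₁ O _) ?_
    have := add_mem (Ideal.mem_sup_left (Ideal.mul_mem_left _ (C (ca₁' O p) * g - x')
      (Ideal.mem_span_singleton_self (MvPolynomial.X 0)))) (Ideal.mem_sup_right hg)
    convert this using 1
    rw [relator₃]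
    ring
  obtain ⟨k, hk, j, hj, hkj⟩ := Submodule.mem_sup.1 h2
  obtain ⟨k, rfl⟩ := Ideal.mem_span_singleton'.1 hk
  have hy : mk O p y' = a₀ O p * mk O p g - b O p 0 * mk O p (-k) := by
    have h3 : y' = C (MvPowerSeries.X 0) * g + k * MvPolynomial.X 0 + j := by
      rw [add_assoc, hkj]; ring
    rw [h3, map_add, map_add, relIdeal₂_le O p hj, map_mul, map_mul, mk_C_X₀, mk_X₀, map_neg]
    ring
  refine ⟨mk O p g, mk O p (-k), ?_, hy⟩
  refine sub_eq_zero.1 (eq_zero_of_b₀_mul _ ?_)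
  rw [hy] at h
  linear_combination h - mk O p g * relation O p

/-- The syzygies of `(a₀, b₀)`. -/
theorem exists_of_a₀_b₀_mul {x y : S O p} (h : x * a₀ O p + y * b O p 0 = 0) :
    ∃ w z, x = b O p 1 * w + b O p 0 * z ∧ y = a₁' O p * w - a₀ O p * z := by
  obtain ⟨x', rfl⟩ := mk_surjective O p x
  obtain ⟨y', rfl⟩ := mk_surjective O p y
  have h1 := h
  rw [← mk_X₀, ← mk_C_X₀, ← map_mul, ← map_mul, ← map_add, mk_eq_zero_iff] at h1
  obtain ⟨g, hg⟩ := h1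
  -- The same argument modulo `a₀`, where `b₀` is regular and the relator reduces to `a₁' b₀`.
  have h2 : y' - C (ca₁' O p) * g ∈ Ideal.span {C (MvPowerSeries.X 0)} ⊔ relIdeal₂ O := by
    rw [← map_varIdeal_singleton_zero]
    refine mem_of_mul_of_disjoint (q := MvPolynomial.X 0) (z := MvPowerSeries.X 2) (n := -1)
      (by decide) (by decide) (MvPowerSeries.X_notMem_span _ _ (by decide)) (rees_X₀ O _) ?_
    rw [map_varIdeal_singleton_zero]
    have := add_mem (Ideal.mem_sup_left (Ideal.mul_mem_left _ (MvPolynomial.X 1 * g - x')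
      (Ideal.mem_span_singleton_self (C (MvPowerSeries.X 0))))) (Ideal.mem_sup_right hg)
    convert this using 1
    rw [relator₃]
    ring
  obtain ⟨k, hk, j, hj, hkj⟩ := Submodule.mem_sup.1 h2
  obtain ⟨k, rfl⟩ := Ideal.mem_span_singleton'.1 hk
  have hy : mk O p y' = a₁' O p * mk O p g - a₀ O p * mk O p (-k) := by
    have h3 : y' = C (ca₁' O p) * g + k * C (MvPowerSeries.X 0) + j := by
      rw [add_assoc, hkj]; ring
    rw [h3, map_add, map_add, relIdeal₂_le O p hj, map_mul, map_mul, mk_C_X₀, mk_ca₁', map_neg]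
    ring
  refine ⟨mk O p g, mk O p (-k), ?_, hy⟩
  refine sub_eq_zero.1 (eq_zero_of_a₀_mul _ ?_)
  rw [hy] at h
  linear_combination h - mk O p g * relation O p

/-! ### The ideal `(a₀, b₀)` and regularity modulo it -/

theorem map_varIdeal_zero_two_sup : (varIdeal O {0, 2}).map C ⊔ Ideal.span {MvPolynomial.X 0} ⊔
    relIdeal₂ O = Ideal.span {C (MvPowerSeries.X 0), MvPolynomial.X 0} ⊔ relIdeal₂ O := by
  have hX : (MvPolynomial.X 0 : Poly O) ∈
      Ideal.span {C (MvPowerSeries.X 0), MvPolynomial.X 0} ⊔ relIdeal₂ O :=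
    Ideal.mem_sup_left (Ideal.subset_span (by simp))
  refine le_antisymm (sup_le (sup_le ?_ ?_) le_sup_right) (sup_le ?_ le_sup_right)
  · rw [varIdeal, Ideal.map_span, Ideal.span_le]
    rintro _ ⟨_, ⟨i, hi, rfl⟩, rfl⟩
    have hi' : i = 0 ∨ i = 2 := by simpa using hi
    rcases hi' with rfl | rfl
    · exact Ideal.mem_sup_left (Ideal.subset_span (by simp))
    · have h1 : C (MvPowerSeries.X 2) - MvPolynomial.X 0 * MvPolynomial.X 2 ∈ relIdeal₂ O :=
        Ideal.subset_span (by simp)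
      simpa using add_mem (Ideal.mem_sup_right h1) (Ideal.mul_mem_right (MvPolynomial.X 2) _ hX)
  · rw [Ideal.span_singleton_le_iff_mem]
    exact hX
  · rw [Ideal.span_le]
    rintro _ (rfl | rfl)
    · exact Ideal.mem_sup_left (Ideal.mem_sup_left (Ideal.mem_map_of_mem _
        (Ideal.subset_span ⟨0, by simp, rfl⟩)))
    · exact Ideal.mem_sup_left (Ideal.mem_sup_right (Ideal.mem_span_singleton_self _))

/-- The ideal `(a₀, b₀)` of `S`. -/
noncomputable def idealAB (O : Type u) [CommRing O] (p : ℕ) : Ideal (S O p) :=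
  Ideal.span {a₀ O p, b O p 0}

/-- The third relator lies in `(a₀, b₀)`, and so does `Y₀ = b₀ c`. The right side is therefore the
kernel of `rees` for the ideal `(a₀, Y₀)` by `ker_rees_of_mem`, so the quotient of `S` is again
inside a Laurent polynomial ring. -/
theorem mk_mem_idealAB_iff (x : Poly O) : mk O p x ∈ idealAB O p ↔
    x ∈ (varIdeal O {0, 2}).map C ⊔ Ideal.span {MvPolynomial.X 0} ⊔ relIdeal₂ O := by
  rw [map_varIdeal_zero_two_sup]
  have h1 : idealAB O p = (Ideal.span {C (MvPowerSeries.X 0), MvPolynomial.X 0}).map (mk O p) := by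
    rw [Ideal.map_span, Set.image_insert_eq, Set.image_singleton]; rfl
  have hk : RingHom.ker (mk O p) = relIdeal₂ O ⊔ Ideal.span {relator₃ O p} := by
    rw [← relIdeal_eq]; exact Ideal.mk_ker
  rw [h1, ← Ideal.mem_comap, Ideal.comap_map_of_surjective' _ (mk_surjective O p), hk, ← sup_assoc]
  have h2 : Ideal.span {relator₃ O p} ≤
      Ideal.span {C (MvPowerSeries.X 0), MvPolynomial.X 0} ⊔ relIdeal₂ O := by
    rw [Ideal.span_singleton_le_iff_mem, relator₃]
    exact Ideal.mem_sup_left (add_mem (Ideal.mul_mem_left _ _ (Ideal.subset_span (by simp)))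
      (Ideal.mul_mem_right _ _ (Ideal.subset_span (by simp))))
  rw [sup_eq_left.2 h2]

theorem mem_idealAB_of_a₁'_mul {s : S O p} (h : a₁' O p * s ∈ idealAB O p) : s ∈ idealAB O p := by
  obtain ⟨s, rfl⟩ := mk_surjective O p s
  rw [← mk_ca₁', ← map_mul, mk_mem_idealAB_iff] at h
  rw [mk_mem_idealAB_iff]
  exact mem_of_mul_of_mem (by simp) (by decide) (ca₁'_notMem O p (by decide)) (rees_C O _ _) h

/-- Modulo `(a₀, b₀)` the elements `a₁', b₁` form a regular sequence, so `(b₁, a₁')` has only the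
Koszul syzygy, a multiple of `(a₁', -b₁)`. -/
theorem exists_of_mem_idealAB {s t : S O p} (h : b O p 1 * s + a₁' O p * t ∈ idealAB O p) :
    ∃ u, s - a₁' O p * u ∈ idealAB O p ∧ t + b O p 1 * u ∈ idealAB O p := by
  obtain ⟨s, rfl⟩ := mk_surjective O p s
  obtain ⟨t, rfl⟩ := mk_surjective O p t
  let I := varIdeal O {0, 2} ⊔ Ideal.span {ca₁' O p}
  have hI2 : MvPowerSeries.X 2 ∈ I := Ideal.mem_sup_left (Ideal.subset_span ⟨2, by simp, rfl⟩)
  -- From `Y₁ z = k + w a₁'`, regularity of `a₁'` modulo `Y₁, a₀, Y₀` makes `w` a multiple of `Y₁`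
  -- modulo `(a₀, Y₀)`, and then `Y₁` cancels.
  have hI3 : ∀ z, MvPowerSeries.X 3 * z ∈ I → z ∈ I := by
    intro z hz
    obtain ⟨k, hk, j, hj, hkj⟩ := Submodule.mem_sup.1 hz
    obtain ⟨w, rfl⟩ := Ideal.mem_span_singleton'.1 hj
    have h1 : w ∈ varIdeal O {3, 0, 2} := by
      refine mem_varIdeal_of_ca₁'_mul (p := p) (by decide) _ ?_
      rw [varIdeal_insert, mul_comm]
      have := sub_mem (Ideal.mem_sup_right (S := varIdeal O {0, 2}) (Ideal.mul_mem_right z _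
        (Ideal.mem_span_singleton_self (MvPowerSeries.X 3)))) (Ideal.mem_sup_left hk)
      rwa [← hkj, add_sub_cancel_left] at this
    rw [varIdeal_insert] at h1
    obtain ⟨v, hv, j', hj', rfl⟩ := Submodule.mem_sup.1 h1
    obtain ⟨w', rfl⟩ := Ideal.mem_span_singleton'.1 hj'
    have h2 : z - w' * ca₁' O p ∈ varIdeal O {0, 2} := by
      refine mem_varIdeal_of_mul (i := 3) (by decide) _ ?_
      have := add_mem hk (Ideal.mul_mem_right (ca₁' O p) _ hv)
      convert this using 1
      linear_combination -hkj
    have := add_mem (Ideal.mem_sup_left h2)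
      (Ideal.mem_sup_right (Ideal.mul_mem_left _ w' (Ideal.mem_span_singleton_self (ca₁' O p))))
    rwa [sub_add_cancel] at this
  rw [← mk_X₁, ← mk_ca₁', ← map_mul, ← map_mul, ← map_add, mk_mem_idealAB_iff] at h
  have hker := ker_rees_of_mem O I hI2 hI3
  have hmap : I.map C ⊔ Ideal.span {MvPolynomial.X 0} ⊔ relIdeal₂ O =
      (varIdeal O {0, 2}).map C ⊔ Ideal.span {MvPolynomial.X 0} ⊔ relIdeal₂ O ⊔
        Ideal.span {C (ca₁' O p)} := by
    rw [Ideal.map_sup, Ideal.map_span (C (σ := Fin 3)) {ca₁' O p}, Set.image_singleton]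
    ac_rfl
  have hs : s ∈ RingHom.ker (rees O I) := by
    refine toRees_eq_zero_of_mul (q := MvPolynomial.X 1) hI3 (rees_X₁ O I) ?_
    rw [← RingHom.mem_ker, hker, hmap]
    have := sub_mem (Ideal.mem_sup_left (T := Ideal.span {C (ca₁' O p)}) h) (Ideal.mem_sup_right
      (Ideal.mul_mem_right t _ (Ideal.mem_span_singleton_self (C (ca₁' O p)))))
    simpa using this
  rw [hker, hmap] at hs
  obtain ⟨k, hk, j, hj, rfl⟩ := Submodule.mem_sup.1 hs
  obtain ⟨u, rfl⟩ := Ideal.mem_span_singleton'.1 hj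
  have hk' := (mk_mem_idealAB_iff (p := p) k).2 hk
  refine ⟨mk O p u, ?_, mem_idealAB_of_a₁'_mul ?_⟩
  · rw [map_add, map_mul, mk_ca₁']
    convert hk' using 1
    ring
  · rw [← mk_mem_idealAB_iff (p := p)] at h
    have := sub_mem h (Ideal.mul_mem_left _ (b O p 1) hk')
    convert this using 1
    simp only [map_add, map_mul, mk_ca₁', mk_X₁]
    ring

end NonGenericII

/-! ### Graded modules and vanishing of `Ext` -/

namespace CategoryTheory.ShortComplex.ShortExact

open Abelian

variable {C : Type*} [Category C] [Abelian C] [HasExt C] {T : ShortComplex C} (hT : T.ShortExact)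
  [Projective T.X₂] {Y : C}
include hT

/-- For projective `T.X₂` every class in `Ext¹` is the connecting image of a map from `T.X₁`, and it
dies once that map extends. -/
theorem subsingleton_ext_one (h : ∀ f : T.X₁ ⟶ Y, ∃ g : T.X₂ ⟶ Y, T.f ≫ g = f) :
    Subsingleton (Ext T.X₃ Y 1) := by
  refine subsingleton_of_forall_eq 0 fun x => ?_
  have hx : (Ext.mk₀ T.g).comp x (zero_add 1) = 0 := Ext.eq_zero_of_projective _
  obtain ⟨y, rfl⟩ := Ext.contravariant_sequence_exact₃ hT _ x hx (n₀ := 0) rfl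
  obtain ⟨f, rfl⟩ := Ext.addEquiv₀.symm.surjective y
  obtain ⟨g, rfl⟩ := h f
  rw [Ext.addEquiv₀_symm_apply, ← Ext.mk₀_comp_mk₀, ← Ext.comp_assoc_of_second_deg_zero,
    hT.extClass_comp, Ext.zero_comp]

theorem subsingleton_ext_succ {i : ℕ} (h : Subsingleton (Ext T.X₁ Y i)) :
    Subsingleton (Ext T.X₃ Y (i + 1)) := by
  refine subsingleton_of_forall_eq 0 fun x => ?_
  have hx : (Ext.mk₀ T.g).comp x (zero_add (i + 1)) = 0 := Ext.eq_zero_of_projective _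
  obtain ⟨y, rfl⟩ := Ext.contravariant_sequence_exact₃ hT _ x hx (n₀ := i) (add_comm _ _)
  rw [Subsingleton.elim y 0, Ext.comp_zero]

end CategoryTheory.ShortComplex.ShortExact

/-! ### Degree-preserving parts of linear maps -/

namespace GrMod

variable {A : Type u} [CommRing A] {𝒜 : ℤ → AddSubgroup A} {M N K : GrMod 𝒜}

theorem proj_smul (M : GrMod 𝒜) {i : ℤ} {a : A} (ha : a ∈ 𝒜 i) (j : ℤ) (x : M.carrier) :
    Grading.proj M.isInternal (i + j) (a • x) = a • Grading.proj M.isInternal j x := by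
  induction Grading.mem_iSup M.isInternal x using AddSubgroup.iSup_induction' with
  | hp k x hx =>
    have hax := M.smul_mem ha hx
    by_cases h : j = k
    · subst h
      rw [Grading.proj_of_mem _ _ _ hx, Grading.proj_of_mem _ _ _ hax]
    · rw [Grading.proj_of_ne _ _ _ h _ hx, Grading.proj_of_ne _ _ _ (by simpa using h) _ hax,
        smul_zero]
  | h1 => simp
  | hadd x y _ _ hx hy => rw [smul_add, map_add, map_add, hx, hy, smul_add]

theorem exists_homogenize_aux (g : M.carrier →+ N.carrier) :
    ∃ g' : M.carrier →+ N.carrier, ∀ i, ∀ x ∈ M.deg i, g' x = Grading.proj N.isInternal i (g x) := by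
  classical
  let _ := M.isInternal.chooseDecomposition
  refine ⟨(DirectSum.toAddMonoid fun i => ((Grading.proj N.isInternal i).comp
    (g.comp (M.deg i).subtype))).comp (DirectSum.decomposeAddEquiv M.deg).toAddMonoidHom,
    fun i x hx => ?_⟩
  have : DirectSum.decompose M.deg x = DirectSum.of (fun i => M.deg i) i ⟨x, hx⟩ :=
    DirectSum.decompose_coe M.deg (⟨x, hx⟩ : M.deg i)
  simp [this]

/-- The degree-preserving part of a linear map. -/
theorem exists_homogenize (hA : DirectSum.IsInternal 𝒜) (g : M.carrier →ₗ[A] N.carrier) :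
    ∃ g' : M ⟶ N, ∀ i, ∀ x ∈ M.deg i, g'.lin x = Grading.proj N.isInternal i (g x) := by
  obtain ⟨g', hg'⟩ := exists_homogenize_aux g.toAddMonoidHom
  refine ⟨⟨{ g' with map_smul' := fun a x => ?_ }, fun i x hx => ?_⟩, hg'⟩
  · change g' (a • x) = a • g' x
    induction Grading.mem_iSup hA a using AddSubgroup.iSup_induction' with
    | hp i a ha =>
      induction Grading.mem_iSup M.isInternal x using AddSubgroup.iSup_induction' with
      | hp j x hx =>
        rw [hg' _ _ (M.smul_mem ha hx), hg' _ _ hx]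
        change Grading.proj N.isInternal (i + j) (g (a • x)) = _
        rw [map_smul, proj_smul N ha]
        rfl
      | h1 => simp
      | hadd x y _ _ hx hy => rw [smul_add, map_add, map_add, hx, hy, smul_add]
    | h1 => simp
    | hadd x y _ _ hx hy => rw [add_smul, map_add, hx, hy, add_smul]
  · change g' x ∈ _
    rw [hg' _ _ hx]
    exact Grading.proj_mem _ _ _

theorem hom_ext_of_mem {f g : M ⟶ N} (h : ∀ i, ∀ x ∈ M.deg i, f.lin x = g.lin x) : f = g := by
  refine hom_ext (LinearMap.ext fun x => ?_)
  induction Grading.mem_iSup M.isInternal x using AddSubgroup.iSup_induction' with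
  | hp i x hx => exact h i x hx
  | h1 => simp
  | hadd x y _ _ hx hy => rw [map_add, map_add, hx, hy]

/-- A degree-preserving map which extends as a linear map extends as a degree-preserving map. -/
theorem exists_extension (hA : DirectSum.IsInternal 𝒜) (k : M ⟶ N) (f : M ⟶ K)
    (g : N.carrier →ₗ[A] K.carrier) (h : ∀ x, g (k.lin x) = f.lin x) : ∃ g' : N ⟶ K, k ≫ g' = f := by
  obtain ⟨g', hg'⟩ := exists_homogenize hA g
  refine ⟨g', hom_ext_of_mem fun i x hx => ?_⟩
  change g'.lin (k.lin x) = f.lin x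
  rw [hg' i _ (k.map_mem i x hx), h, Grading.proj_of_mem _ _ _ (f.map_mem i x hx)]

theorem exists_lift (hA : DirectSum.IsInternal 𝒜) (e : N ⟶ K) (f : M ⟶ K)
    (g : M.carrier →ₗ[A] N.carrier) (h : ∀ x, e.lin (g x) = f.lin x) : ∃ g' : M ⟶ N, g' ≫ e = f := by
  obtain ⟨g', hg'⟩ := exists_homogenize hA g
  refine ⟨g', hom_ext_of_mem fun i x hx => ?_⟩
  change e.lin (g'.lin x) = f.lin x
  have := Grading.map_proj N.isInternal K.isInternal e.lin.toAddMonoidHom e.map_mem i (g x)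
  rw [hg' i _ hx]
  refine this.trans ?_
  change Grading.proj K.isInternal i (e.lin (g x)) = _
  rw [h, Grading.proj_of_mem _ _ _ (f.map_mem i x hx)]

end GrMod

/-! ### Projectives and exactness for finitely generated graded modules -/

namespace GrCoh

variable {A : Type u} [CommRing A] {𝒜 : ℤ → AddSubgroup A} {M N K : GrCoh 𝒜}

open GrMod

theorem surjective_of_epi (f : M ⟶ N) [Epi f] : Function.Surjective f.hom.lin := by
  intro x
  let π : N ⟶ (⟨coker f.hom, isFG_coker _ N.property⟩ : GrCoh 𝒜) :=
    (isFG 𝒜).homMk (cokerπ f.hom)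
  have h : f ≫ π = f ≫ (isFG 𝒜).homMk 0 := by
    apply ObjectProperty.hom_ext
    refine (comp_cokerπ f.hom).trans ?_
    refine GrMod.hom_ext (LinearMap.ext fun _ => rfl)
  rw [cancel_epi] at h
  have h' : (cokerπ f.hom).lin x = 0 := LinearMap.congr_fun (congrArg (fun g => g.hom.lin) h) x
  exact (Submodule.Quotient.mk_eq_zero _).1 h'

/-- Replacing an ungraded lift by its degree-preserving part still gives a lift, because the maps to
be lifted preserve degrees. -/
theorem projective_of_projective (hA : DirectSum.IsInternal 𝒜) [Module.Projective A M.obj.carrier] :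
    Projective M where
  factors {E X} f e _ := by
    obtain ⟨g, hg⟩ := Module.projective_lifting_property e.hom.lin f.hom.lin (surjective_of_epi e)
    obtain ⟨g', hg'⟩ := exists_lift hA e.hom f.hom g (fun x => LinearMap.congr_fun hg x)
    exact ⟨(isFG 𝒜).homMk g', ObjectProperty.hom_ext _ hg'⟩

theorem mono_of_injective (f : M ⟶ N) (hf : Function.Injective f.hom.lin) : Mono f :=
  ⟨fun a b h => by
    apply ObjectProperty.hom_ext
    refine GrMod.hom_ext (LinearMap.ext fun x => hf ?_)
    exact LinearMap.congr_fun (congrArg (fun g => g.hom.lin) h) x⟩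

variable [IsNoetherianRing A]

theorem shortExact (f : M ⟶ N) (g : N ⟶ K) (hf : Function.Injective f.hom.lin)
    (hg : Function.Surjective g.hom.lin) (hfg : Function.Exact f.hom.lin g.hom.lin) :
    (ShortComplex.mk f g (by
      apply ObjectProperty.hom_ext
      refine GrMod.hom_ext (LinearMap.ext fun x => hfg.apply_apply_eq_zero x))).ShortExact where
  mono_f := mono_of_injective f hf
  epi_g := ⟨fun a b h => by
    apply ObjectProperty.hom_ext
    refine GrMod.hom_ext (LinearMap.ext fun x => ?_)
    obtain ⟨y, rfl⟩ := hg x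
    exact LinearMap.congr_fun (congrArg (fun g => g.hom.lin) h) y⟩
  exact := by
    have key : ∀ {W : GrCoh 𝒜} (k : W ⟶ N), k ≫ g = 0 → ∃ l : W ⟶ M, l ≫ f = k := by
      intro W k hk
      have h1 : ∀ w, k.hom.lin w ∈ LinearMap.range f.hom.lin := fun w =>
        (hfg _).1 (LinearMap.congr_fun (congrArg (fun g => g.hom.lin) hk) w)
      let e := LinearEquiv.ofInjective f.hom.lin hf
      let l : W.obj.carrier →ₗ[A] M.obj.carrier :=
        e.symm.toLinearMap ∘ₗ k.hom.lin.codRestrict _ h1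
      have hl : ∀ w, f.hom.lin (l w) = k.hom.lin w := fun w =>
        congrArg Subtype.val (e.apply_symm_apply (k.hom.lin.codRestrict _ h1 w))
      refine ⟨(isFG 𝒜).homMk ⟨l, fun i x hx => ?_⟩, ?_⟩
      · apply mem_deg_of_injective f.hom hf
        rw [hl]
        exact k.hom.map_mem i x hx
      · apply ObjectProperty.hom_ext
        exact GrMod.hom_ext (LinearMap.ext hl)
    have : Mono f := mono_of_injective f hf
    refine ShortComplex.exact_of_f_is_kernel _ (KernelFork.IsLimit.ofι' (i := f) _ fun k hk =>
      ⟨(key k hk).choose, (key k hk).choose_spec⟩)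

end GrCoh

/-! ### Dimension shifting for cokernels in an exact complex -/

namespace GrMod

variable {A : Type u} [CommRing A] {𝒜 : ℤ → AddSubgroup A} {M N K : GrMod 𝒜}
  {f : M ⟶ N} {g : N ⟶ K}

theorem comp_eq_zero_of_exact (h : Function.Exact f.lin g.lin) : f ≫ g = 0 :=
  hom_ext (LinearMap.ext fun x => h.apply_apply_eq_zero x)

theorem cokerDesc_injective (h : Function.Exact f.lin g.lin) :
    Function.Injective (cokerDesc f g (comp_eq_zero_of_exact h)).lin := by
  rw [← LinearMap.ker_eq_bot, LinearMap.ker_eq_bot']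
  intro x hx
  obtain ⟨x, rfl⟩ := Submodule.mkQ_surjective _ x
  exact (Submodule.Quotient.mk_eq_zero _).2 ((h x).1 hx)

theorem exact_cokerDesc (h : Function.Exact f.lin g.lin) :
    Function.Exact (cokerDesc f g (comp_eq_zero_of_exact h)).lin (cokerπ g).lin := by
  intro x
  refine (Submodule.Quotient.mk_eq_zero (LinearMap.range g.lin)).trans ⟨?_, ?_⟩
  · rintro ⟨y, rfl⟩
    exact ⟨Submodule.Quotient.mk y, rfl⟩
  · rintro ⟨y, rfl⟩
    obtain ⟨y, rfl⟩ := Submodule.mkQ_surjective _ y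
    exact ⟨y, rfl⟩

theorem cokerπ_surjective (g : N ⟶ K) : Function.Surjective (cokerπ g).lin :=
  Submodule.mkQ_surjective _

end GrMod

section Coker

open GrMod Abelian

variable {A : Type u} [CommRing A] {𝒜 : ℤ → AddSubgroup A} {M N K : GrMod 𝒜}

/-- The cokernel as a finitely generated graded module. -/
def GrCoh.coker (f : M ⟶ N) (hN : isFG 𝒜 N) : GrCoh 𝒜 := ⟨GrMod.coker f, isFG_coker f hN⟩

variable {f : M ⟶ N} {g : N ⟶ K} (hN : isFG 𝒜 N) (hK : isFG 𝒜 K)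
  (h : Function.Exact f.lin g.lin)

section

variable [IsNoetherianRing A]

/-- Exactness identifies `coker f` with the image of `g`, so each spot of an exact complex gives one
short exact sequence for dimension shifting. -/
theorem GrCoh.shortExact_coker (h : Function.Exact f.lin g.lin) :
    (ShortComplex.mk (X₁ := GrCoh.coker f hN) (X₂ := ⟨K, hK⟩) (X₃ := GrCoh.coker g hK)
      ((isFG 𝒜).homMk (cokerDesc f g (comp_eq_zero_of_exact h))) ((isFG 𝒜).homMk (cokerπ g)) (by
      apply ObjectProperty.hom_ext
      exact GrMod.hom_ext (LinearMap.ext fun x =>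
        (exact_cokerDesc h).apply_apply_eq_zero x))).ShortExact :=
  GrCoh.shortExact (M := GrCoh.coker f hN) (N := ⟨K, hK⟩) (K := GrCoh.coker g hK) _ _
    (cokerDesc_injective h) (cokerπ_surjective g) (exact_cokerDesc h)

variable [hP : Module.Projective A K.carrier]
include hN h

/-- The extension in `H` only needs to be linear, since its degree-preserving part still extends.
Thus the graded vanishing reduces to statements about matrices over the ungraded ring. -/
theorem GrCoh.subsingleton_ext_one_coker (hA : DirectSum.IsInternal 𝒜) {Y : GrCoh 𝒜}
    (H : ∀ y : N ⟶ Y.obj, (∀ x, y.lin (f.lin x) = 0) →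
      ∃ z : K.carrier →ₗ[A] Y.obj.carrier, ∀ x, z (g.lin x) = y.lin x) :
    Subsingleton (Ext (GrCoh.coker g hK) Y 1) := by
  have : Projective (⟨K, hK⟩ : GrCoh 𝒜) :=
    GrCoh.projective_of_projective (M := ⟨K, hK⟩) hA
  refine (GrCoh.shortExact_coker hN hK h).subsingleton_ext_one fun φ => ?_
  obtain ⟨z, hz⟩ := H (cokerπ f ≫ φ.hom) fun x => by
    have := LinearMap.congr_fun (congrArg Hom.lin (comp_cokerπ f)) x
    exact (congrArg φ.hom.lin this).trans (map_zero _)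
  obtain ⟨ψ, hψ⟩ := exists_extension hA (cokerDesc f g (comp_eq_zero_of_exact h)) φ.hom z
    (fun x => by
      obtain ⟨x, rfl⟩ := Submodule.mkQ_surjective _ x
      exact hz x)
  exact ⟨(isFG 𝒜).homMk ψ, ObjectProperty.hom_ext _ hψ⟩

theorem GrCoh.subsingleton_ext_succ_coker (hA : DirectSum.IsInternal 𝒜) {Y : GrCoh 𝒜} {i : ℕ}
    (H : Subsingleton (Ext (GrCoh.coker f hN) Y i)) :
    Subsingleton (Ext (GrCoh.coker g hK) Y (i + 1)) := by
  have : Projective (⟨K, hK⟩ : GrCoh 𝒜) :=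
    GrCoh.projective_of_projective (M := ⟨K, hK⟩) hA
  exact (GrCoh.shortExact_coker hN hK h).subsingleton_ext_succ H

end

variable [hP : Module.Projective A K.carrier]
include h

theorem ModuleCat.subsingleton_ext_one_coker {Y : Type u} [AddCommGroup Y] [Module A Y]
    (H : ∀ y : N.carrier →ₗ[A] Y, (∀ x, y (f.lin x) = 0) →
      ∃ z : K.carrier →ₗ[A] Y, ∀ x, z (g.lin x) = y x) :
    Subsingleton (Ext.{u} (ModuleCat.of A (GrMod.coker g).carrier) (ModuleCat.of A Y) 1) := by
  have : Projective (ModuleCat.of A K.carrier) := ModuleCat.projective_of_categoryTheory_projective _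
  refine (LocalDepth.shortExact_of_linear _ _ (cokerDesc_injective h) (cokerπ_surjective g)
    (exact_cokerDesc h)).subsingleton_ext_one fun φ => ?_
  obtain ⟨z, hz⟩ := H (φ.hom ∘ₗ (cokerπ f).lin) fun x => by
    have := LinearMap.congr_fun (congrArg Hom.lin (comp_cokerπ f)) x
    exact (congrArg φ.hom this).trans (map_zero _)
  refine ⟨ModuleCat.ofHom z, ModuleCat.hom_ext (LinearMap.ext fun x => ?_)⟩
  obtain ⟨x, rfl⟩ := Submodule.mkQ_surjective _ x
  exact hz x

theorem ModuleCat.subsingleton_ext_succ_coker {Y : Type u} [AddCommGroup Y] [Module A Y] {i : ℕ}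
    (H : Subsingleton (Ext.{u} (ModuleCat.of A (GrMod.coker f).carrier) (ModuleCat.of A Y) i)) :
    Subsingleton (Ext.{u} (ModuleCat.of A (GrMod.coker g).carrier) (ModuleCat.of A Y) (i + 1)) := by
  have : Projective (ModuleCat.of A K.carrier) := ModuleCat.projective_of_categoryTheory_projective _
  exact (LocalDepth.shortExact_of_linear _ _ (cokerDesc_injective h) (cokerπ_surjective g)
    (exact_cokerDesc h)).subsingleton_ext_succ H

end Coker

/-! ### The matrix factorization `(M, N)` and `Ext` into line bundles -/

namespace NonGenericII

variable (O : Type u) [CommRing O] (p : ℕ)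

open GrMod

/-- The matrix `M`, as a map `L(m)² ⟶ L(m + 2) ⊕ L(m)`. -/
noncomputable def matMₙ (m n : ℤ) (h : m + 2 = n) : (line (deg O p) m).dsum (line (deg O p) m) ⟶
    (line (deg O p) n).dsum (line (deg O p) m) :=
  lift (desc (mulHom m n (b_mem O p 0) h) (mulHom m n (b_mem O p 1) h))
    (desc (-mulHom m m (a₀_mem O p) (add_zero m)) (mulHom m m (a₁'_mem O p) (add_zero m)))

/-- The adjugate `N` of `M`, as a map `L(m) ⊕ L(m - 2) ⟶ L(m)²`. -/
noncomputable def matNₙ (k m : ℤ) (h : k + 2 = m) : (line (deg O p) m).dsum (line (deg O p) k) ⟶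
    (line (deg O p) m).dsum (line (deg O p) m) :=
  lift (desc (mulHom m m (a₁'_mem O p) (add_zero m)) (-mulHom k m (b_mem O p 1) h))
    (desc (mulHom m m (a₀_mem O p) (add_zero m)) (mulHom k m (b_mem O p 0) h))

variable {O p}

variable (O p) in
/-- The matrix `M`, acting on column vectors. -/
noncomputable def colM : S O p × S O p →ₗ[S O p] S O p × S O p :=
  (matM O p).lin

variable (O p) in
/-- The matrix `N`, acting on column vectors. -/
noncomputable def colN : S O p × S O p →ₗ[S O p] S O p × S O p :=
  (matNₙ O p 0 2 rfl).lin

theorem colM_apply (x y : S O p) : colM O p (x, y) =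
    (b O p 0 * x + b O p 1 * y, -(a₀ O p * x) + a₁' O p * y) := rfl

theorem colN_apply (x y : S O p) : colN O p (x, y) =
    (a₁' O p * x + -(b O p 1 * y), a₀ O p * x + b O p 0 * y) := rfl

theorem isFG_line_dsum (m n : ℤ) :
    isFG (deg O p) ((line (deg O p) m).dsum (line (deg O p) n)) :=
  isFG_dsum (L O p m).property (L O p n).property

instance (m n : ℤ) : Module.Projective (S O p)
    ((line (deg O p) m).dsum (line (deg O p) n)).carrier :=
  inferInstanceAs (Module.Projective (S O p) (S O p × S O p))

variable [IsDomain O]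

/-- `M N` is the determinant, which is zero in `S`. Conversely the columns of `N` generate the
syzygies of the first row `(b₀, b₁)` of `M`, so vanishing of the first coordinate alone gives
membership in the image. -/
theorem exact_colN_colM : Function.Exact (colN O p) (colM O p) := by
  rintro ⟨x, y⟩
  constructor
  · intro hxy
    have h1 : x * b O p 0 + y * b O p 1 = 0 := by
      have : b O p 0 * x + b O p 1 * y = 0 := congrArg Prod.fst hxy
      linear_combination this
    obtain ⟨w, z, rfl, rfl⟩ := exists_of_b_mul h1
    refine ⟨(w, -z), ?_⟩
    rw [colN_apply]
    exact Prod.ext (by ring) (by ring)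
  · rintro ⟨⟨w, z⟩, hwz⟩
    rw [← hwz, colN_apply, colM_apply]
    have := relation O p
    exact Prod.ext (show _ = (0 : S O p) by linear_combination w * this)
      (show _ = (0 : S O p) by linear_combination z * this)

/-- Here the second row `(a₀, b₀)` of `N` is used; its syzygies are generated by the columns of `M`.
-/
theorem exact_colM_colN : Function.Exact (colM O p) (colN O p) := by
  rintro ⟨x, y⟩
  constructor
  · intro hxy
    have h1 : x * a₀ O p + y * b O p 0 = 0 := by
      have : a₀ O p * x + b O p 0 * y = 0 := congrArg Prod.snd hxy
      linear_combination this
    obtain ⟨w, z, rfl, rfl⟩ := exists_of_a₀_b₀_mul h1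
    refine ⟨(z, w), ?_⟩
    rw [colM_apply]
    exact Prod.ext (by ring) (by ring)
  · rintro ⟨⟨w, z⟩, hwz⟩
    rw [← hwz, colM_apply, colN_apply]
    have := relation O p
    exact Prod.ext (show _ = (0 : S O p) by linear_combination w * this)
      (show _ = (0 : S O p) by linear_combination z * this)

theorem exact_N_M (k m n : ℤ) (h : k + 2 = m) (h' : m + 2 = n) :
    Function.Exact (matNₙ O p k m h).lin (matMₙ O p m n h').lin :=
  exact_colN_colM

theorem exact_M_N (k m : ℤ) (h : k + 2 = m) :
    Function.Exact (matMₙ O p k m h).lin (matNₙ O p k m h).lin :=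
  exact_colM_colN

/-- The linear map `S² → Y` with given values. -/
noncomputable def ofPair {Y : Type*} [AddCommGroup Y] [Module (S O p) Y] (y₁ y₂ : Y) :
    S O p × S O p →ₗ[S O p] Y :=
  (LinearMap.toSpanSingleton _ _ y₁).coprod (LinearMap.toSpanSingleton _ _ y₂)

@[simp] theorem ofPair_apply {Y : Type*} [AddCommGroup Y] [Module (S O p) Y] (y₁ y₂ : Y)
    (x y : S O p) : ofPair y₁ y₂ (x, y) = x • y₁ + y • y₂ := by
  simp [ofPair]

theorem apply_pair {Y : Type*} [AddCommGroup Y] [Module (S O p) Y] (f : S O p × S O p →ₗ[S O p] Y)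
    (x y : S O p) : f (x, y) = x • f (1, 0) + y • f (0, 1) := by
  rw [← map_smul, ← map_smul, ← map_add]
  simp

/-- A row vector killed by `N` is a multiple of `M`. -/
theorem exists_row_M {s₁ s₂ : S O p} (h : s₂ * b O p 0 = s₁ * b O p 1) :
    ∃ z₁ z₂, s₁ = z₁ * b O p 0 - z₂ * a₀ O p ∧ s₂ = z₁ * b O p 1 + z₂ * a₁' O p := by
  obtain ⟨w, z, h1, h2⟩ := exists_of_b_mul (x := s₂) (y := -s₁) (by linear_combination h)
  exact ⟨z, w, by linear_combination -h2, by linear_combination h1⟩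

/-- A row vector killed by `M` is a multiple of `N`. -/
theorem exists_row_N {s₁ s₂ : S O p} (h : s₁ * b O p 0 = s₂ * a₀ O p) :
    ∃ z₁ z₂, s₁ = z₁ * a₁' O p + z₂ * a₀ O p ∧ s₂ = -(z₁ * b O p 1) + z₂ * b O p 0 := by
  obtain ⟨w, z, h1, h2⟩ := exists_of_a₀_b₀_mul (x := -s₂) (y := s₁) (by linear_combination h)
  exact ⟨w, -z, by linear_combination h2, by linear_combination -h1⟩

/-- Exactness of the transposed complex. A row killed by the second column `(-b₁, b₀)` of `N` is, up
to sign and order, a syzygy of `(b₀, b₁)`, hence a combination of the rows of `M`. -/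
theorem exists_extension_M (y : S O p × S O p →ₗ[S O p] S O p) (hy : ∀ x, y (colN O p x) = 0) :
    ∃ z : S O p × S O p →ₗ[S O p] S O p, ∀ x, z (colM O p x) = y x := by
  have h1 : y (-b O p 1, b O p 0) = 0 := by
    have := hy (0, 1)
    rw [colN_apply] at this
    simpa using this
  rw [apply_pair] at h1
  obtain ⟨z₁, z₂, h2, h3⟩ := exists_row_M (s₁ := y (1, 0)) (s₂ := y (0, 1)) (by
    simp only [smul_eq_mul] at h1
    linear_combination h1)
  refine ⟨ofPair z₁ z₂, ?_⟩
  rintro ⟨x, x'⟩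
  rw [colM_apply, ofPair_apply, apply_pair y, h2, h3]
  simp only [smul_eq_mul]
  ring

theorem exists_extension_N (y : S O p × S O p →ₗ[S O p] S O p) (hy : ∀ x, y (colM O p x) = 0) :
    ∃ z : S O p × S O p →ₗ[S O p] S O p, ∀ x, z (colN O p x) = y x := by
  have h1 : y (b O p 0, -a₀ O p) = 0 := by
    have := hy (1, 0)
    rw [colM_apply] at this
    simpa using this
  rw [apply_pair] at h1
  obtain ⟨z₁, z₂, h2, h3⟩ := exists_row_N (s₁ := y (1, 0)) (s₂ := y (0, 1)) (by
    simp only [smul_eq_mul] at h1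
    linear_combination h1)
  refine ⟨ofPair z₁ z₂, ?_⟩
  rintro ⟨x, x'⟩
  rw [colN_apply, ofPair_apply, apply_pair y, h2, h3]
  simp only [smul_eq_mul]
  ring

open Abelian

/-- Both cokernels are treated at once because each is the syzygy of the other up to a shift: the
resolution is 2-periodic up to twist, and two steps lower all twists by two. -/
theorem ext_coker_L [IsNoetherianRing O] (t : ℤ) (i : ℕ) :
    ∀ (k m n : ℤ) (h : k + 2 = m) (h' : m + 2 = n),
    Subsingleton (Ext.{u + 1} (GrCoh.coker (matMₙ O p m n h') (isFG_line_dsum n m))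
      (L O p t) (i + 1)) ∧
    Subsingleton (Ext.{u + 1} (GrCoh.coker (matNₙ O p k m h) (isFG_line_dsum m m))
      (L O p t) (i + 1)) := by
  induction i with
  | zero =>
    intro k m n h h'
    exact ⟨GrCoh.subsingleton_ext_one_coker (isFG_line_dsum m m) _ (exact_N_M k m n h h')
        (isInternal_deg O p) fun y hy => exists_extension_M y.lin hy,
      GrCoh.subsingleton_ext_one_coker (isFG_line_dsum m k) _ (exact_M_N k m h)
        (isInternal_deg O p) fun y hy => exists_extension_N y.lin hy⟩
  | succ i ih =>
    intro k m n h h'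
    exact ⟨GrCoh.subsingleton_ext_succ_coker (isFG_line_dsum m m) _ (exact_N_M k m n h h')
        (isInternal_deg O p) (ih k m n h h').2,
      GrCoh.subsingleton_ext_succ_coker (isFG_line_dsum m k) _ (exact_M_N k m h)
        (isInternal_deg O p) (ih (k - 2) k m (sub_add_cancel _ _) h).1⟩

theorem ext_coker_S (i : ℕ) : ∀ (k m n : ℤ) (h : k + 2 = m) (h' : m + 2 = n),
    Subsingleton (Ext.{u} (ModuleCat.of (S O p) (coker (matMₙ O p m n h')).carrier)
      (ModuleCat.of (S O p) (S O p)) (i + 1)) ∧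
    Subsingleton (Ext.{u} (ModuleCat.of (S O p) (coker (matNₙ O p k m h)).carrier)
      (ModuleCat.of (S O p) (S O p)) (i + 1)) := by
  induction i with
  | zero =>
    intro k m n h h'
    exact ⟨ModuleCat.subsingleton_ext_one_coker (exact_N_M k m n h h')
        fun y hy => exists_extension_M y hy,
      ModuleCat.subsingleton_ext_one_coker (exact_M_N k m h)
        fun y hy => exists_extension_N y hy⟩
  | succ i ih =>
    intro k m n h h'
    exact ⟨ModuleCat.subsingleton_ext_succ_coker (exact_N_M k m n h h') (ih k m n h h').2,
      ModuleCat.subsingleton_ext_succ_coker (exact_M_N k m h)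
        (ih (k - 2) k m (sub_add_cancel _ _) h).1⟩

theorem ext_Q_L [IsNoetherianRing O] (n : ℤ) (i : ℕ) (hi : 1 ≤ i) :
    Subsingleton (Ext.{u + 1} (Q O p) (L O p n) i) := by
  obtain ⟨i, rfl⟩ := Nat.exists_eq_add_of_le' hi
  exact (ext_coker_L n i (-3) (-1) 1 rfl rfl).1

theorem ext_Q_S (i : ℕ) (hi : 1 ≤ i) : Subsingleton (Ext.{u} (ModuleCat.of (S O p) (Qmod O p))
    (ModuleCat.of (S O p) (S O p)) i) := by
  obtain ⟨i, rfl⟩ := Nat.exists_eq_add_of_le' hi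
  exact (ext_coker_S i (-3) (-1) 1 rfl rfl).1

end NonGenericII

/-! ### Graded pieces of `S` -/

namespace NonGenericII

open GrMod

variable {O : Type u} [CommRing O] {p : ℕ}

variable (O p) in
/-- The projection of `S` onto its part of degree `i`. -/
noncomputable abbrev prS (i : ℤ) : S O p →+ S O p := Grading.proj (isInternal_deg O p) i

theorem prS_mul {i j k : ℤ} (h : i + j = k) {a : S O p} (ha : a ∈ deg O p i) (x : S O p) :
    prS O p k (a * x) = a * prS O p j x := by
  subst h
  induction Grading.mem_iSup (isInternal_deg O p) x using AddSubgroup.iSup_induction' with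
  | hp k x hx =>
    have hax : a * x ∈ deg O p (i + k) := SetLike.GradedMul.mul_mem ha hx
    by_cases h : j = k
    · subst h
      rw [Grading.proj_of_mem _ _ _ hx, Grading.proj_of_mem _ _ _ hax]
    · rw [Grading.proj_of_ne _ _ _ h _ hx, Grading.proj_of_ne _ _ _ (by simpa using h) _ hax,
        mul_zero]
  | h1 => simp
  | hadd x y _ _ hx hy => rw [mul_add, map_add, map_add, hx, hy, mul_add]

theorem prS_mem (i : ℤ) (x : S O p) : prS O p i x ∈ deg O p i := Grading.proj_mem _ _ _

theorem prS_of_mem {i : ℤ} {x : S O p} (hx : x ∈ deg O p i) : prS O p i x = x :=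
  Grading.proj_of_mem _ _ _ hx

theorem mk_monomial_eq (d : Fin 3 →₀ ℕ) (a : Coeff O) (i : Fin 3) (hi : d i ≠ 0) (n : ℤ)
    (hd : Finsupp.weight weight d = n) : ∃ y ∈ deg O p (n - weight i),
      mk O p (MvPolynomial.monomial d a) = y * mk O p (MvPolynomial.X i) := by
  have h : d = (d - Finsupp.single i 1) + Finsupp.single i 1 :=
    (tsub_add_cancel_of_le (Finsupp.single_le_iff.2 (Nat.one_le_iff_ne_zero.2 hi))).symm
  refine ⟨mk O p (MvPolynomial.monomial (d - Finsupp.single i 1) a),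
    ⟨_, MvPolynomial.isWeightedHomogeneous_monomial _ _ _ ?_, rfl⟩, ?_⟩
  · rw [eq_sub_iff_add_eq, ← hd]
    conv_rhs => rw [h]
    rw [map_add, Finsupp.weight_single]
    simp
  · rw [← map_mul]
    congr 1
    rw [MvPolynomial.X, MvPolynomial.monomial_mul, mul_one, ← h]

theorem mem_of_monomial_mem {n : ℤ} (P : AddSubgroup (S O p))
    (h : ∀ d a, Finsupp.weight weight d = n → mk O p (MvPolynomial.monomial d a) ∈ P)
    {x : S O p} (hx : x ∈ deg O p n) : x ∈ P := by
  obtain ⟨q, hq, rfl⟩ := hx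
  change mk O p q ∈ P
  rw [← MvPolynomial.support_sum_monomial_coeff q, map_sum]
  exact sum_mem fun d hd => h d _ (hq (MvPolynomial.mem_support_iff.1 hd))

theorem weight_eq (d : Fin 3 →₀ ℕ) : Finsupp.weight weight d = 2 * d 0 + 2 * d 1 - 2 * (d 2 : ℤ) := by
  rw [Finsupp.weight_apply, Finsupp.sum_fintype _ _ (by simp), Fin.sum_univ_three]
  simp [weight]
  ring

/-- A monomial has weight twice the number of `bᵢ` minus twice the number of `c`, so positive weight
forces some `bᵢ` to occur. Likewise negative weight forces `c`. -/
theorem exists_of_mem_deg_pos {n : ℤ} (hn : 0 < n) {x : S O p} (hx : x ∈ deg O p n) :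
    ∃ y ∈ deg O p (n - 2), ∃ z ∈ deg O p (n - 2), x = y * b O p 0 + z * b O p 1 := by
  let P : AddSubgroup (S O p) :=
    { carrier := {x | ∃ y ∈ deg O p (n - 2), ∃ z ∈ deg O p (n - 2), x = y * b O p 0 + z * b O p 1}
      zero_mem' := ⟨0, zero_mem _, 0, zero_mem _, by simp⟩
      add_mem' := by
        rintro _ _ ⟨y, hy, z, hz, rfl⟩ ⟨y', hy', z', hz', rfl⟩
        exact ⟨y + y', add_mem hy hy', z + z', add_mem hz hz', by ring⟩
      neg_mem' := by
        rintro _ ⟨y, hy, z, hz, rfl⟩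
        exact ⟨-y, neg_mem hy, -z, neg_mem hz, by ring⟩ }
  refine mem_of_monomial_mem P (fun d a hd => ?_) hx
  have hw := weight_eq d
  rw [hd] at hw
  rcases (by omega : d 0 ≠ 0 ∨ d 1 ≠ 0) with h | h
  · obtain ⟨y, hy, hyx⟩ := mk_monomial_eq (p := p) d a 0 h n hd
    exact ⟨y, hy, 0, zero_mem _, by rw [hyx, zero_mul, add_zero]; rfl⟩
  · obtain ⟨y, hy, hyx⟩ := mk_monomial_eq (p := p) d a 1 h n hd
    exact ⟨0, zero_mem _, y, hy, by rw [hyx, zero_mul, zero_add]; rfl⟩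

theorem exists_of_mem_deg_neg {n : ℤ} (hn : n < 0) {x : S O p} (hx : x ∈ deg O p n) :
    ∃ y ∈ deg O p (n + 2), x = y * c O p := by
  let P : AddSubgroup (S O p) :=
    { carrier := {x | ∃ y ∈ deg O p (n + 2), x = y * c O p}
      zero_mem' := ⟨0, zero_mem _, by simp⟩
      add_mem' := by
        rintro _ _ ⟨y, hy, rfl⟩ ⟨y', hy', rfl⟩
        exact ⟨y + y', add_mem hy hy', by ring⟩
      neg_mem' := by
        rintro _ ⟨y, hy, rfl⟩
        exact ⟨-y, neg_mem hy, by ring⟩ }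
  refine mem_of_monomial_mem P (fun d a hd => ?_) hx
  have hw := weight_eq d
  rw [hd] at hw
  obtain ⟨y, hy, hyx⟩ := mk_monomial_eq (p := p) d a 2 (by omega) n hd
  refine ⟨y, ?_, hyx⟩
  rwa [show weight 2 = -2 from rfl, sub_neg_eq_add] at hy

/-! ### The embedding of `Q` as the ideal `(a₀, b₀)` -/

variable (O p) in
/-- The map `φ₂₃⁰` on modules. -/
noncomputable def toIdealAB : Qmod O p →ₗ[S O p] S O p := (φ₂₃ O p 0).hom.lin

variable (O p) in
/-- The projection `S² → Q`. -/
noncomputable def mkQmod : S O p × S O p →ₗ[S O p] Qmod O p := (cokerπ (matM O p)).lin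

theorem mkQmod_surjective : Function.Surjective (mkQmod O p) := cokerπ_surjective (matM O p)

theorem mkQmod_eq_zero_iff (x : S O p × S O p) : mkQmod O p x = 0 ↔ ∃ y, colM O p y = x :=
  Submodule.Quotient.mk_eq_zero (LinearMap.range (matM O p).lin)

theorem toIdealAB_mkQmod (x y : S O p) :
    toIdealAB O p (mkQmod O p (x, y)) = a₀ O p * x + b O p 0 * y := rfl

theorem toIdealAB_mem (x : Qmod O p) : toIdealAB O p x ∈ idealAB O p := by
  obtain ⟨⟨x, y⟩, rfl⟩ := mkQmod_surjective x
  rw [toIdealAB_mkQmod]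
  exact add_mem (Ideal.mul_mem_right _ _ (Ideal.subset_span (by simp)))
    (Ideal.mul_mem_right _ _ (Ideal.subset_span (by simp)))

theorem exists_of_mem_idealAB' {s : S O p} (hs : s ∈ idealAB O p) : ∃ q, toIdealAB O p q = s := by
  obtain ⟨x, y, rfl⟩ := Ideal.mem_span_pair.1 hs
  exact ⟨mkQmod O p (x, y), by rw [toIdealAB_mkQmod]; ring⟩

theorem a₀_mem_idealAB : a₀ O p ∈ idealAB O p := Ideal.subset_span (by simp)

theorem b₀_mem_idealAB : b O p 0 ∈ idealAB O p := Ideal.subset_span (by simp)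

variable [IsDomain O]

/-- The syzygies of `(a₀, b₀)` are generated by the columns of `M`, which vanish in `Q`. So `Q` can
be computed as an ideal of `S`. -/
theorem toIdealAB_injective : Function.Injective (toIdealAB O p) := by
  rw [← LinearMap.ker_eq_bot, LinearMap.ker_eq_bot']
  intro x hx
  obtain ⟨⟨x, y⟩, rfl⟩ := mkQmod_surjective x
  rw [toIdealAB_mkQmod] at hx
  obtain ⟨w, z, rfl, rfl⟩ := exists_of_a₀_b₀_mul (x := x) (y := y) (by linear_combination hx)
  rw [mkQmod_eq_zero_iff]
  refine ⟨(z, w), ?_⟩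
  rw [colM_apply]
  exact Prod.ext (by ring) (by ring)

theorem exists_extension_M_Q (y : S O p × S O p →ₗ[S O p] Qmod O p)
    (hy : ∀ x, y (colN O p x) = 0) :
    ∃ z : S O p × S O p →ₗ[S O p] Qmod O p, ∀ x, z (colM O p x) = y x := by
  obtain ⟨w, hw⟩ := exists_extension_M (toIdealAB O p ∘ₗ y) fun x => by simp [hy]
  have h2 : b O p 1 * w (1, 0) + a₁' O p * w (0, 1) ∈ idealAB O p := by
    have h := hw (0, 1)
    rw [colM_apply, apply_pair] at h
    simp only [mul_zero, mul_one, zero_add, neg_zero, smul_eq_mul] at h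
    rw [h]
    exact toIdealAB_mem _
  -- The row `w` may be changed by multiples of `(a₁', -b₁)`, a row of `N` and so killed by `M`. A
  -- suitable multiple moves both entries into `(a₀, b₀)`, that is, into `Q`.
  obtain ⟨u, hu, hu'⟩ := exists_of_mem_idealAB h2
  obtain ⟨q₁, h3⟩ := exists_of_mem_idealAB' hu
  obtain ⟨q₂, h4⟩ := exists_of_mem_idealAB' hu'
  refine ⟨ofPair q₁ q₂, fun x => toIdealAB_injective ?_⟩
  rw [← LinearMap.comp_apply (toIdealAB O p) y, ← hw]
  obtain ⟨x, x'⟩ := x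
  rw [colM_apply, ofPair_apply, map_add, map_smul, map_smul, h3, h4,
    apply_pair w (b O p 0 * x + _)]
  simp only [smul_eq_mul]
  linear_combination (-u * x) * relation O p

/-- This is the step of the vanishing of `Ext(Q, Q)` which uses the grading: the entries of the row
may be taken homogeneous of degree `s₁ > 0`, which puts the second one into `(b₀, b₁)`. -/
theorem exists_extension_N_Q {s₁ s₂ : ℤ} (h12 : s₁ + 2 = s₂) (hs : 0 < s₁)
    (y : S O p × S O p →ₗ[S O p] Qmod O p)
    (h₁ : toIdealAB O p (y (1, 0)) ∈ deg O p s₁) (h₂ : toIdealAB O p (y (0, 1)) ∈ deg O p s₂)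
    (hy : ∀ x, y (colM O p x) = 0) :
    ∃ z : S O p × S O p →ₗ[S O p] Qmod O p, ∀ x, z (colN O p x) = y x := by
  obtain ⟨w, hw⟩ := exists_extension_N (toIdealAB O p ∘ₗ y) fun x => by simp [hy]
  have e1 : a₁' O p * prS O p s₁ (w (1, 0)) + a₀ O p * prS O p s₁ (w (0, 1)) =
      toIdealAB O p (y (1, 0)) := by
    have h := hw (1, 0)
    rw [colN_apply, apply_pair] at h
    simp only [mul_zero, mul_one, add_zero, neg_zero, smul_eq_mul] at h
    rw [← prS_mul (zero_add s₁) (a₁'_mem O p), ← prS_mul (zero_add s₁) (a₀_mem O p), ← map_add, h]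
    exact prS_of_mem h₁
  have e2 : -(b O p 1 * prS O p s₁ (w (1, 0))) + b O p 0 * prS O p s₁ (w (0, 1)) =
      toIdealAB O p (y (0, 1)) := by
    have h := hw (0, 1)
    rw [colN_apply, apply_pair] at h
    simp only [mul_zero, mul_one, zero_add, smul_eq_mul, neg_mul] at h
    rw [← prS_mul (by rw [add_comm, h12]) (b_mem O p 1), ← prS_mul (by rw [add_comm, h12])
      (b_mem O p 0), ← map_neg, ← map_add, h]
    exact prS_of_mem h₂
  obtain ⟨u, -, v, -, huv⟩ := exists_of_mem_deg_pos hs (prS_mem s₁ (w (0, 1)))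
  have m1 : prS O p s₁ (w (1, 0)) ∈ idealAB O p := by
    refine mem_idealAB_of_a₁'_mul ?_
    rw [eq_sub_of_add_eq e1]
    exact sub_mem (toIdealAB_mem _) (Ideal.mul_mem_right _ _ a₀_mem_idealAB)
  -- Subtracting `v (b₀, b₁)`, a multiple of the first row of `M` and hence killed by `N`, leaves `u
  -- b₀` as second entry and keeps the first in `(a₀, b₀)`.
  obtain ⟨q₁, h3⟩ := exists_of_mem_idealAB'
    (sub_mem m1 (Ideal.mul_mem_left _ v b₀_mem_idealAB))
  obtain ⟨q₂, h4⟩ := exists_of_mem_idealAB' (Ideal.mul_mem_left _ u (b₀_mem_idealAB (p := p)))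
  refine ⟨ofPair q₁ q₂, fun x => toIdealAB_injective ?_⟩
  obtain ⟨x, x'⟩ := x
  rw [colN_apply, ofPair_apply, apply_pair y, map_add, map_smul, map_smul, h3, h4, map_add, map_smul,
    map_smul, ← e1, ← e2, huv]
  simp only [smul_eq_mul]
  linear_combination (-v * x) * relation O p

open Abelian

theorem projective_L (n : ℤ) : Projective (L O p n) :=
  have : Module.Projective (S O p) (L O p n).obj.carrier :=
    inferInstanceAs (Module.Projective (S O p) (S O p))
  GrCoh.projective_of_projective (isInternal_deg O p)

theorem one_mem_deg (m : ℤ) : (1 : S O p) ∈ deg O p (m + -m) := by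
  rw [add_neg_cancel]; exact SetLike.GradedOne.one_mem

/-- The condition `m ≤ 0` gives the positive degrees `1 - m` and `1 - k`, the image of `Q` in `S`
being shifted by one through `L₁`. It persists because the twists only decrease along the
resolution. -/
theorem ext_coker_Q [IsNoetherianRing O] (i : ℕ) :
    ∀ (k m n : ℤ) (h : k + 2 = m) (h' : m + 2 = n), m ≤ 0 →
    Subsingleton (Ext.{u + 1} (GrCoh.coker (matMₙ O p m n h') (isFG_line_dsum n m))
      (Q O p) (i + 1)) ∧
    Subsingleton (Ext.{u + 1} (GrCoh.coker (matNₙ O p k m h) (isFG_line_dsum m m))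
      (Q O p) (i + 1)) := by
  induction i with
  | zero =>
    intro k m n h h' hm
    refine ⟨GrCoh.subsingleton_ext_one_coker (isFG_line_dsum m m) _ (exact_N_M k m n h h')
        (isInternal_deg O p) fun y hy => exists_extension_M_Q y.lin hy,
      GrCoh.subsingleton_ext_one_coker (isFG_line_dsum m k) _ (exact_M_N k m h)
        (isInternal_deg O p) fun y hy => exists_extension_N_Q (s₁ := 1 - m) (s₂ := 1 - k)
          (by omega) (by omega) y.lin ?_ ?_ hy⟩
    · exact (φ₂₃ O p 0).hom.map_mem (-m) _ (y.map_mem (-m) _ ⟨one_mem_deg m, zero_mem _⟩)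
    · exact (φ₂₃ O p 0).hom.map_mem (-k) _ (y.map_mem (-k) _ ⟨zero_mem _, one_mem_deg k⟩)
  | succ i ih =>
    intro k m n h h' hm
    exact ⟨GrCoh.subsingleton_ext_succ_coker (isFG_line_dsum m m) _ (exact_N_M k m n h h')
        (isInternal_deg O p) (ih k m n h h' hm).2,
      GrCoh.subsingleton_ext_succ_coker (isFG_line_dsum m k) _ (exact_M_N k m h)
        (isInternal_deg O p) (ih (k - 2) k m (sub_add_cancel _ _) h (by omega)).1⟩

variable [IsNoetherianRing O]

theorem ext_Q_Q (i : ℕ) (hi : 1 ≤ i) : Subsingleton (Ext.{u + 1} (Q O p) (Q O p) i) := by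
  obtain ⟨i, rfl⟩ := Nat.exists_eq_add_of_le' hi
  exact (ext_coker_Q i (-3) (-1) 1 rfl rfl (by norm_num)).1

attribute [local instance] Abelian.hasFiniteBiproducts

theorem ext_X_X (i : ℕ) (hi : 1 ≤ i) : Subsingleton (Ext.{u + 1} (X O p) (X O p) i) := by
  have key : ∀ j k : Fin 3, Subsingleton (Ext.{u + 1} (summand O p j) (summand O p k) i) := by
    intro j k
    obtain ⟨i, rfl⟩ := Nat.exists_eq_add_of_le' hi
    have h1 : ∀ (n : ℤ) (Y : Coh O p), Subsingleton (Ext.{u + 1} (L O p n) Y (i + 1)) := by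
      intro n Y
      have := projective_L (O := O) (p := p) n
      exact Ext.subsingleton_of_projective _ _ _
    fin_cases j
    · exact h1 _ _
    · exact h1 _ _
    · fin_cases k
      · exact ext_Q_L _ _ hi
      · exact ext_Q_L _ _ hi
      · exact ext_Q_Q _ hi
  have h2 : ∀ k, Subsingleton (Ext.{u + 1} (X O p) (summand O p k) i) := fun k =>
    (Ext.biproductAddEquiv (biproduct.isBilimit (summand O p)) (summand O p k) i).toEquiv.subsingleton
  exact (Ext.addEquivBiproduct (X O p) (biproduct.isBilimit (summand O p)) i).toEquiv.subsingleton

end NonGenericII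

/-! ### Homomorphisms between the summands -/

namespace NonGenericII

open GrMod

variable {O : Type u} [CommRing O] [IsDomain O] {p : ℕ}

theorem hom_ext_lin {M N : Coh O p} {f g : M ⟶ N} (h : ∀ x, f.hom.lin x = g.hom.lin x) : f = g :=
  ObjectProperty.hom_ext _ (GrMod.hom_ext (LinearMap.ext h))

/-- The value of a homomorphism out of `Lₙ` at `1`. -/
noncomputable def valL {n : ℤ} {Y : Coh O p} (f : L O p n ⟶ Y) : Y.obj.carrier :=
  f.hom.lin (1 : S O p)

/-- The value of a homomorphism out of `Q` at the class of `(0, 1)`. -/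
noncomputable def valQ {Y : Coh O p} (f : Q O p ⟶ Y) : Y.obj.carrier :=
  f.hom.lin (mkQmod O p (0, 1))

theorem hom_ext_L {n : ℤ} {Y : Coh O p} {f g : L O p n ⟶ Y} (h : valL f = valL g) : f = g := by
  refine hom_ext_lin fun (x : S O p) => ?_
  have e : x = x • (1 : S O p) := by simp
  rw [e]
  refine (f.hom.lin.map_smul x (1 : S O p)).trans ?_
  refine Eq.trans ?_ (g.hom.lin.map_smul x (1 : S O p)).symm
  exact congrArg (x • ·) h

theorem valL_mem {n : ℤ} {Y : Coh O p} (f : L O p n ⟶ Y) : valL f ∈ Y.obj.deg (-n) :=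
  f.hom.map_mem (-n) _ (one_mem_deg n)

theorem valQ_mem {Y : Coh O p} (f : Q O p ⟶ Y) : valQ f ∈ Y.obj.deg 1 :=
  f.hom.map_mem 1 _ ⟨((0 : S O p), (1 : S O p)), ⟨zero_mem _, one_mem_deg (-1)⟩, rfl⟩

theorem mkQmod_M₁ : b O p 0 • mkQmod O p (1, 0) = a₀ O p • mkQmod O p (0, 1) := by
  rw [← sub_eq_zero, ← map_smul, ← map_smul, ← map_sub, mkQmod_eq_zero_iff]
  exact ⟨(1, 0), by rw [colM_apply]; simp⟩

theorem apply_mkQmod {Y : Coh O p} (f : Q O p ⟶ Y) (x y : S O p) : f.hom.lin (mkQmod O p (x, y)) =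
    x • f.hom.lin (mkQmod O p (1, 0)) + y • valQ f := by
  have : mkQmod O p (x, y) = x • mkQmod O p (1, 0) + y • mkQmod O p (0, 1) := apply_pair _ _ _
  rw [this]
  refine (f.hom.lin.map_add _ _).trans ?_
  exact congrArg₂ (· + ·) (f.hom.lin.map_smul _ _) (f.hom.lin.map_smul _ _)

theorem b₀_smul_apply {Y : Coh O p} (f : Q O p ⟶ Y) :
    b O p 0 • f.hom.lin (mkQmod O p (1, 0)) = a₀ O p • valQ f :=
  (f.hom.lin.map_smul _ _).symm.trans ((congrArg f.hom.lin mkQmod_M₁).trans (f.hom.lin.map_smul _ _))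

/-- The first column of `M` says that `b₀` times the class of `(1, 0)` is `a₀` times the class of
`(0, 1)`, so cancelling `b₀` determines the other value. -/
theorem hom_ext_Q {Y : Coh O p} (hY : ∀ y : Y.obj.carrier, b O p 0 • y = 0 → y = 0)
    {f g : Q O p ⟶ Y} (h : valQ f = valQ g) : f = g := by
  have h1 : f.hom.lin (mkQmod O p (1, 0)) = g.hom.lin (mkQmod O p (1, 0)) := by
    refine sub_eq_zero.1 (hY _ ?_)
    rw [smul_sub, b₀_smul_apply, b₀_smul_apply, h, sub_self]
  refine hom_ext_lin fun x => ?_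
  obtain ⟨⟨x, y⟩, rfl⟩ := mkQmod_surjective x
  rw [apply_mkQmod f x y, apply_mkQmod g x y, h, h1]

theorem mkQmod_mem {k : ℤ} {q : Qmod O p} (hq : q ∈ (Q O p).obj.deg k) :
    ∃ x ∈ deg O p (1 + k), ∃ y ∈ deg O p (-1 + k), mkQmod O p (x, y) = q := by
  obtain ⟨⟨x, y⟩, ⟨hx, hy⟩, hq⟩ := hq
  exact ⟨x, hx, y, hy, hq⟩

theorem hom_ext_QL {n : ℤ} {f g : Q O p ⟶ L O p n} (h : valQ f = valQ g) : f = g :=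
  hom_ext_Q (fun y hy => eq_zero_of_b₀_mul y hy) h

theorem Qmod_eq_zero_of_b₀_smul (q : Qmod O p) (hq : b O p 0 • q = 0) : q = 0 := by
  refine toIdealAB_injective ?_
  rw [map_zero]
  refine eq_zero_of_b₀_mul _ ?_
  rw [← smul_eq_mul, ← map_smul, hq, map_zero]

theorem hom_ext_LQ {n : ℤ} {f g : L O p n ⟶ Q O p}
    (h : toIdealAB O p (valL f) = toIdealAB O p (valL g)) : f = g :=
  hom_ext_L (toIdealAB_injective h)

theorem hom_ext_QQ {f g : Q O p ⟶ Q O p}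
    (h : toIdealAB O p (valQ f) = toIdealAB O p (valQ g)) : f = g :=
  hom_ext_Q Qmod_eq_zero_of_b₀_smul (toIdealAB_injective h)

/-! ### The composition relations -/

variable (O p)

theorem φ₂₁_comp_φ₁₂ (i : Fin 2) : φ₂₁ O p i ≫ φ₁₂ O p = rbc O p i • 𝟙 (L O p (-1)) :=
  hom_ext_L (show c O p * (b O p i * 1) = b O p i * c O p * 1 by ring)

theorem φ₂₃_comp_φ₁₂ (i : Fin 2) : φ₂₃ O p i ≫ φ₁₂ O p = φ₁₃ O p i :=
  hom_ext_QL (show c O p * (α O p i * 0 + b O p i * 1) =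
    α O p i * c O p * 0 + b O p i * c O p * 1 by ring)

theorem φ₃₁_comp_φ₁₃ (i : Fin 2) : φ₃₁ O p ≫ φ₁₃ O p i = rbc O p i • 𝟙 (L O p (-1)) :=
  hom_ext_L (show α O p i * c O p * 0 + b O p i * c O p * 1 = b O p i * c O p * 1 by ring)

theorem φ₁₂_comp_φ₂₁ (i : Fin 2) : φ₁₂ O p ≫ φ₂₁ O p i = rbc O p i • 𝟙 (L O p 1) :=
  hom_ext_L (show b O p i * (c O p * 1) = b O p i * c O p * 1 by ring)

theorem φ₁₃_comp_φ₂₁ (i j : Fin 2) : φ₁₃ O p j ≫ φ₂₁ O p i = rbc O p i • φ₂₃ O p j :=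
  hom_ext_QL (show b O p i * (α O p j * c O p * 0 + b O p j * c O p * 1) =
    b O p i * c O p * (α O p j * 0 + b O p j * 1) by ring)

theorem φ₃₁_comp_φ₂₃ (i : Fin 2) : φ₃₁ O p ≫ φ₂₃ O p i = φ₂₁ O p i :=
  hom_ext_L (show α O p i * 0 + b O p i * 1 = b O p i * 1 by ring)

theorem φ₁₂_comp_φ₃₁ : φ₁₂ O p ≫ φ₃₁ O p = φ₃₂ O p := rfl

theorem φ₁₃_comp_φ₃₁ (i : Fin 2) : φ₁₃ O p i ≫ φ₃₁ O p = rbc O p i • 𝟙 (Q O p) :=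
  hom_ext_QQ (by
    refine Eq.trans ?_ ((toIdealAB O p).map_smul (b O p i * c O p) _).symm
    change a₀ O p * 0 + b O p 0 * (α O p i * c O p * 0 + b O p i * c O p * 1) =
      b O p i * c O p * (a₀ O p * 0 + b O p 0 * 1)
    ring)

theorem φ₃₂_comp_φ₁₃ (i : Fin 2) : φ₃₂ O p ≫ φ₁₃ O p i = rbc O p i • φ₁₂ O p :=
  hom_ext_L (show α O p i * c O p * 0 + b O p i * c O p * (c O p * 1) =
    b O p i * c O p * (c O p * 1) by ring)

theorem β_comp_φ₁₃_zero : β O p ≫ φ₁₃ O p 0 = ra₀ O p • φ₁₂ O p :=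
  hom_ext_L (show a₀ O p * c O p * 1 + b O p 0 * c O p * 0 = a₀ O p * (c O p * 1) by ring)

theorem β_comp_φ₁₃_one : β O p ≫ φ₁₃ O p 1 = (-ra₁' O p) • φ₁₂ O p :=
  hom_ext_L (show -a₁' O p * c O p * 1 + b O p 1 * c O p * 0 = -a₁' O p * (c O p * 1) by ring)

theorem φ₃₂_comp_φ₂₃ (i : Fin 2) : φ₃₂ O p ≫ φ₂₃ O p i = rbc O p i • 𝟙 (L O p 1) :=
  hom_ext_L (show α O p i * 0 + b O p i * (c O p * 1) = b O p i * c O p * 1 by ring)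

theorem β_comp_φ₂₃_zero : β O p ≫ φ₂₃ O p 0 = ra₀ O p • 𝟙 (L O p 1) :=
  hom_ext_L (show a₀ O p * 1 + b O p 0 * 0 = a₀ O p * 1 by ring)

theorem β_comp_φ₂₃_one : β O p ≫ φ₂₃ O p 1 = (-ra₁' O p) • 𝟙 (L O p 1) :=
  hom_ext_L (show -a₁' O p * 1 + b O p 1 * 0 = -a₁' O p * 1 by ring)

theorem φ₂₁_comp_φ₃₂ (i : Fin 2) : φ₂₁ O p i ≫ φ₃₂ O p = rbc O p i • φ₃₁ O p :=
  hom_ext_LQ (by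
    refine Eq.trans ?_ ((toIdealAB O p).map_smul (b O p i * c O p) _).symm
    change a₀ O p * 0 + b O p 0 * (c O p * (b O p i * 1)) =
      b O p i * c O p * (a₀ O p * 0 + b O p 0 * 1)
    ring)

theorem φ₂₁_comp_β_zero : φ₂₁ O p 0 ≫ β O p = ra₀ O p • φ₃₁ O p :=
  hom_ext_LQ (by
    refine Eq.trans ?_ ((toIdealAB O p).map_smul (a₀ O p) _).symm
    change a₀ O p * (b O p 0 * 1) + b O p 0 * 0 = a₀ O p * (a₀ O p * 0 + b O p 0 * 1)
    ring)

theorem φ₂₁_comp_β_one : φ₂₁ O p 1 ≫ β O p = (-ra₁' O p) • φ₃₁ O p :=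
  hom_ext_LQ (by
    refine Eq.trans ?_ ((toIdealAB O p).map_smul (-a₁' O p) _).symm
    change a₀ O p * (b O p 1 * 1) + b O p 0 * 0 = -a₁' O p * (a₀ O p * 0 + b O p 0 * 1)
    linear_combination relation O p)

theorem φ₂₃_comp_φ₃₂ (i : Fin 2) : φ₂₃ O p i ≫ φ₃₂ O p = rbc O p i • 𝟙 (Q O p) :=
  hom_ext_QQ (by
    refine Eq.trans ?_ ((toIdealAB O p).map_smul (b O p i * c O p) _).symm
    change a₀ O p * 0 + b O p 0 * (c O p * (α O p i * 0 + b O p i * 1)) =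
      b O p i * c O p * (a₀ O p * 0 + b O p 0 * 1)
    ring)

theorem φ₂₃_comp_β_zero : φ₂₃ O p 0 ≫ β O p = ra₀ O p • 𝟙 (Q O p) :=
  hom_ext_QQ (by
    refine Eq.trans ?_ ((toIdealAB O p).map_smul (a₀ O p) _).symm
    change a₀ O p * (a₀ O p * 0 + b O p 0 * 1) + b O p 0 * 0 =
      a₀ O p * (a₀ O p * 0 + b O p 0 * 1)
    ring)

theorem φ₂₃_comp_β_one : φ₂₃ O p 1 ≫ β O p = (-ra₁' O p) • 𝟙 (Q O p) :=
  hom_ext_QQ (by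
    refine Eq.trans ?_ ((toIdealAB O p).map_smul (-a₁' O p) _).symm
    change a₀ O p * (-a₁' O p * 0 + b O p 1 * 1) + b O p 0 * 0 =
      -a₁' O p * (a₀ O p * 0 + b O p 0 * 1)
    linear_combination relation O p)

end NonGenericII

/-! ### The modules of homomorphisms -/

namespace NonGenericII

open GrMod

variable {O : Type u} [CommRing O] [IsDomain O] {p : ℕ}

theorem valL_smul {n : ℤ} {Y : Coh O p} (r : R O p) (f : L O p n ⟶ Y) :
    valL (r • f) = (r : S O p) • valL f := rfl

theorem valL_add {n : ℤ} {Y : Coh O p} (f g : L O p n ⟶ Y) : valL (f + g) = valL f + valL g := rfl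

theorem valL_φ₁₂ : valL (φ₁₂ O p) = c O p := mul_one (c O p)
theorem valL_φ₂₁ (i : Fin 2) : valL (φ₂₁ O p i) = b O p i := mul_one (b O p i)
theorem valL_φ₃₁ : valL (φ₃₁ O p) = mkQmod O p (0, 1) := rfl
theorem valL_β : valL (β O p) = mkQmod O p (1, 0) := rfl
theorem valL_φ₃₂ : valL (φ₃₂ O p) = mkQmod O p (0, c O p) :=
  congrArg (fun x => mkQmod O p (0, x)) (mul_one (c O p))
theorem valQ_φ₂₃ (i : Fin 2) : valQ (φ₂₃ O p i) = b O p i :=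
  show α O p i * 0 + b O p i * 1 = b O p i by ring
theorem valQ_φ₁₃ (i : Fin 2) : valQ (φ₁₃ O p i) = b O p i * c O p :=
  show α O p i * c O p * 0 + b O p i * c O p * 1 = b O p i * c O p by ring

theorem end_L_bijective (n : ℤ) : Function.Bijective (fun r : R O p => r • 𝟙 (L O p n)) := by
  constructor
  · intro r s h
    have h1 : (r : S O p) * 1 = (s : S O p) * 1 := congrArg valL h
    exact Subtype.ext (by simpa using h1)
  · intro f
    have h : valL f ∈ deg O p (n + -n) := valL_mem f
    rw [add_neg_cancel] at h
    exact ⟨⟨valL f, h⟩, hom_ext_L (@mul_one (S O p) _ (valL f))⟩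

theorem hom_φ₁₂_bijective : Function.Bijective (fun r : R O p => r • φ₁₂ O p) := by
  constructor
  · intro r s h
    have h1 : (r : S O p) * (c O p * 1) = (s : S O p) * (c O p * 1) := congrArg valL h
    refine Subtype.ext (sub_eq_zero.1 (eq_zero_of_c_mul _ ?_))
    linear_combination h1
  · intro f
    have h : valL f ∈ deg O p (-2) := valL_mem f
    obtain ⟨y, hy, h1⟩ := exists_of_mem_deg_neg (by norm_num) h
    refine ⟨⟨y, hy⟩, hom_ext_L ?_⟩
    rw [valL_smul, valL_φ₁₂, h1]
    rfl

theorem hom_φ₃₁_bijective : Function.Bijective (fun r : R O p => r • φ₃₁ O p) := by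
  constructor
  · intro r s h
    have h1 : (r : S O p) • mkQmod O p (0, 1) = (s : S O p) • mkQmod O p (0, 1) := congrArg valL h
    have h2 := congrArg (toIdealAB O p) h1
    rw [map_smul, map_smul, toIdealAB_mkQmod, smul_eq_mul, smul_eq_mul] at h2
    refine Subtype.ext (sub_eq_zero.1 (eq_zero_of_b₀_mul _ ?_))
    linear_combination h2
  · intro f
    obtain ⟨x, hx, y, hy, hxy⟩ := mkQmod_mem (valL_mem f)
    obtain ⟨u, hu, v, hv, rfl⟩ := exists_of_mem_deg_pos (by norm_num) hx
    -- Subtracting `M (u, v)` from `(x, y)` clears the first entry `x = u b₀ + v b₁` and leaves this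
    -- scalar in the second.
    have h0 : y + a₀ O p * u - a₁' O p * v ∈ deg O p 0 := by
      refine sub_mem (add_mem hy ?_) ?_
      · simpa using SetLike.GradedMul.mul_mem (a₀_mem O p) hu
      · simpa using SetLike.GradedMul.mul_mem (a₁'_mem O p) hv
    refine ⟨⟨_, h0⟩, hom_ext_L ?_⟩
    rw [valL_smul, valL_φ₃₁, ← hxy]
    refine sub_eq_zero.1 (Eq.trans (congrArg (· - _) (map_smul (mkQmod O p) _ _).symm) ?_)
    refine ((mkQmod O p).map_sub _ _).symm.trans ((mkQmod_eq_zero_iff _).2 ⟨(-u, -v), ?_⟩)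
    rw [colM_apply]
    refine Prod.ext ?_ ?_
    · simp; ring
    · simp; ring

/-- Composition with `φ₃₁` embeds `End(Q)` into the free module on `φ₃₁` and carries the identity to
the generator. -/
theorem end_Q_bijective : Function.Bijective (fun r : R O p => r • 𝟙 (Q O p)) := by
  constructor
  · intro r s h
    refine hom_φ₃₁_bijective.1 ?_
    exact congrArg (φ₃₁ O p ≫ ·) h
  · intro f
    obtain ⟨r, hr⟩ := hom_φ₃₁_bijective.2 (φ₃₁ O p ≫ f)
    exact ⟨r, hom_ext_Q Qmod_eq_zero_of_b₀_smul (congrArg valL hr)⟩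

/-- The value at `1`, as a linear map. -/
noncomputable def valLₗ (m n : ℤ) : (L O p m ⟶ L O p n) →ₗ[R O p] S O p where
  toFun f := valL f
  map_add' _ _ := rfl
  map_smul' _ _ := rfl

/-- The value at the class of `(0, 1)`, as a linear map. -/
noncomputable def valQₗ (n : ℤ) : (Q O p ⟶ L O p n) →ₗ[R O p] S O p where
  toFun f := valQ f
  map_add' _ _ := rfl
  map_smul' _ _ := rfl

theorem mem_span_b {x : S O p} (hx : x ∈ deg O p 2) :
    x ∈ Submodule.span (R O p) (Set.range (b O p)) := by
  obtain ⟨y, hy, z, hz, rfl⟩ := exists_of_mem_deg_pos (by norm_num) hx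
  refine add_mem ?_ ?_
  · exact Submodule.smul_mem _ (⟨y, hy⟩ : R O p) (Submodule.subset_span ⟨0, rfl⟩)
  · exact Submodule.smul_mem _ (⟨z, hz⟩ : R O p) (Submodule.subset_span ⟨1, rfl⟩)

theorem range_valLₗ : LinearMap.range (valLₗ (O := O) (p := p) (-1) 1) =
    Submodule.span (R O p) (Set.range (b O p)) := by
  refine le_antisymm ?_ (Submodule.span_le.2 ?_)
  · rintro _ ⟨f, rfl⟩
    exact mem_span_b (valL_mem f)
  · rintro _ ⟨i, rfl⟩
    exact ⟨φ₂₁ O p i, valL_φ₂₁ i⟩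

theorem range_valQₗ : LinearMap.range (valQₗ (O := O) (p := p) 1) =
    Submodule.span (R O p) (Set.range (b O p)) := by
  refine le_antisymm ?_ (Submodule.span_le.2 ?_)
  · rintro _ ⟨f, rfl⟩
    exact mem_span_b (valQ_mem f)
  · rintro _ ⟨i, rfl⟩
    exact ⟨φ₂₃ O p i, valQ_φ₂₃ i⟩

theorem exists_hom_Lneg_L₁ : ∃ Ψ : (L O p (-1) ⟶ L O p 1) ≃ₗ[R O p]
    Submodule.span (R O p) (Set.range (b O p)),
    ∀ f, (Ψ f : S O p) = valL f :=
  ⟨(LinearEquiv.ofInjective (valLₗ (-1) 1) fun _ _ h => hom_ext_L h).trans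
    (LinearEquiv.ofEq _ _ range_valLₗ), fun _ => rfl⟩

theorem exists_hom_Q_L₁ : ∃ Ψ : (Q O p ⟶ L O p 1) ≃ₗ[R O p]
    Submodule.span (R O p) (Set.range (b O p)),
    ∀ f, (Ψ f : S O p) = valQ f :=
  ⟨(LinearEquiv.ofInjective (valQₗ 1) fun _ _ h => hom_ext_QL h).trans
    (LinearEquiv.ofEq _ _ range_valQₗ), fun _ => rfl⟩

/-- Homomorphisms `Q ⟶ L₋₁` as elements of `R`. -/
noncomputable def valR : (Q O p ⟶ L O p (-1)) →ₗ[R O p] R O p where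
  toFun f := ⟨valQ f, valQ_mem f⟩
  map_add' _ _ := rfl
  map_smul' _ _ := rfl

/-- The row of `f` is killed by `M`, hence is a combination of the rows of `N`. The coefficients may
be taken of degree `-2`, where every element is a multiple of `c`; this produces `b₀ c` and `b₁ c`
in the second entry. -/
theorem exists_valR_eq (f : Q O p ⟶ L O p (-1)) :
    ∃ u v : R O p, valR f = u * rbc O p 0 + v * rbc O p 1 := by
  let s₁ : S O p := f.hom.lin (mkQmod O p (1, 0))
  have hs₁ : s₁ ∈ deg O p (-2) :=
    f.hom.map_mem (-1) _ ⟨((1 : S O p), (0 : S O p)), ⟨one_mem_deg 1, zero_mem _⟩, rfl⟩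
  obtain ⟨s₂, hs⟩ : ∃ s₂ : S O p, s₂ = valQ f := ⟨_, rfl⟩
  have hs₂ : s₂ ∈ deg O p 0 := hs ▸ valQ_mem f
  have h1 : b O p 0 * s₁ = a₀ O p * s₂ := by rw [hs]; exact b₀_smul_apply f
  obtain ⟨z₁, z₂, -, e2⟩ := exists_row_N (s₁ := s₁) (s₂ := s₂) (by
    linear_combination h1)
  obtain ⟨y₁, hy₁, h3⟩ := exists_of_mem_deg_neg (by norm_num) (prS_mem (-2) z₁)
  obtain ⟨y₂, hy₂, h4⟩ := exists_of_mem_deg_neg (by norm_num) (prS_mem (-2) z₂)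
  refine ⟨⟨y₂, hy₂⟩, -⟨y₁, hy₁⟩, Subtype.ext ?_⟩
  have e3 : s₂ = -(b O p 1 * prS O p (-2) z₁) + b O p 0 * prS O p (-2) z₂ := by
    rw [← prS_mul (show (2 : ℤ) + -2 = 0 by norm_num) (b_mem O p 1),
      ← prS_mul (show (2 : ℤ) + -2 = 0 by norm_num) (b_mem O p 0), ← map_neg, ← map_add,
      show -(b O p 1 * z₁) + b O p 0 * z₂ = s₂ by linear_combination -e2]
    exact (prS_of_mem hs₂).symm
  have e4 : s₂ = y₂ * (b O p 0 * c O p) + -y₁ * (b O p 1 * c O p) := by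
    rw [e3, h3, h4]
    ring
  exact hs.symm.trans e4

theorem range_valR : LinearMap.range (valR (O := O) (p := p)) =
    Submodule.span (R O p) (Set.range (rbc O p)) := by
  refine le_antisymm ?_ (Submodule.span_le.2 ?_)
  · rintro _ ⟨f, rfl⟩
    obtain ⟨u, v, h⟩ := exists_valR_eq f
    rw [h]
    exact add_mem (Submodule.smul_mem _ u (Submodule.subset_span ⟨0, rfl⟩))
      (Submodule.smul_mem _ v (Submodule.subset_span ⟨1, rfl⟩))
  · rintro _ ⟨i, rfl⟩
    exact ⟨φ₁₃ O p i, Subtype.ext (valQ_φ₁₃ i)⟩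

theorem valR_injective : Function.Injective (valR (O := O) (p := p)) := fun _ _ h =>
  hom_ext_QL (congrArg Subtype.val h)

theorem exists_hom_Q_Lneg : ∃ Ψ : (Q O p ⟶ L O p (-1)) ≃ₗ[R O p]
    Submodule.span (R O p) (Set.range (rbc O p)),
    ∀ f, ((Ψ f : R O p) : S O p) = valQ f :=
  ⟨(LinearEquiv.ofInjective valR valR_injective).trans
    (LinearEquiv.ofEq _ _ range_valR), fun _ => rfl⟩

theorem exists_hom_L₁_Q_eq (f : L O p 1 ⟶ Q O p) :
    ∃ x y : R O p, f = x • β O p + y • φ₃₂ O p := by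
  obtain ⟨x, hx, y, hy, hxy⟩ := mkQmod_mem (valL_mem f)
  obtain ⟨y', hy', rfl⟩ := exists_of_mem_deg_neg (by norm_num) hy
  refine ⟨⟨x, hx⟩, ⟨y', hy'⟩, hom_ext_L ?_⟩
  rw [valL_add, valL_smul, valL_smul, valL_β, valL_φ₃₂, ← hxy]
  refine Eq.trans ?_ (congrArg₂ (· + ·) ((mkQmod O p).map_smul x (1, 0))
    ((mkQmod O p).map_smul y' (0, c O p)))
  refine Eq.trans ?_ ((mkQmod O p).map_add _ _)
  simp

/-- The morphism is the class of `(x, y c)`, which vanishes when it equals `M (s, t)`. In degree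
`-2` one has `s = u c` and `t = v c`, and cancelling `c` in the second entry gives the formula for
`y`. -/
theorem relation_hom_L₁_Q (x y : R O p) : x • β O p + y • φ₃₂ O p = 0 ↔
    ∃ u v : R O p, x = u * rbc O p 0 + v * rbc O p 1 ∧
      y = -(u * ra₀ O p) + v * ra₁' O p := by
  have key : x • β O p + y • φ₃₂ O p = 0 ↔
      mkQmod O p ((x : S O p), (y : S O p) * c O p) = 0 := by
    have h1 : valL (x • β O p + y • φ₃₂ O p) = mkQmod O p ((x : S O p), (y : S O p) * c O p) := by
      rw [valL_add, valL_smul, valL_smul, valL_β, valL_φ₃₂]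
      refine (congrArg₂ (· + ·) ((mkQmod O p).map_smul (x : S O p) (1, 0))
        ((mkQmod O p).map_smul (y : S O p) (0, c O p))).symm.trans ?_
      refine ((mkQmod O p).map_add _ _).symm.trans ?_
      simp
    rw [← h1]
    exact ⟨fun h => by rw [h]; rfl, fun h => hom_ext_L h⟩
  rw [key, mkQmod_eq_zero_iff]
  constructor
  · rintro ⟨⟨s, t⟩, hst⟩
    rw [colM_apply, Prod.mk.injEq] at hst
    obtain ⟨h1, h2⟩ := hst
    obtain ⟨u, hu, h3⟩ := exists_of_mem_deg_neg (by norm_num) (prS_mem (-2) s)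
    obtain ⟨v, hv, h4⟩ := exists_of_mem_deg_neg (by norm_num) (prS_mem (-2) t)
    refine ⟨⟨u, hu⟩, ⟨v, hv⟩, Subtype.ext ?_, Subtype.ext ?_⟩
    · change (x : S O p) = u * (b O p 0 * c O p) + v * (b O p 1 * c O p)
      have e : (x : S O p) = b O p 0 * prS O p (-2) s + b O p 1 * prS O p (-2) t := by
        rw [← prS_mul (show (2 : ℤ) + -2 = 0 by norm_num) (b_mem O p 1),
          ← prS_mul (show (2 : ℤ) + -2 = 0 by norm_num) (b_mem O p 0), ← map_add, h1]
        exact (prS_of_mem x.2).symm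
      rw [e, h3, h4]
      ring
    · change (y : S O p) = -(u * a₀ O p) + v * a₁' O p
      have hyc : (y : S O p) * c O p ∈ deg O p (-2) := by
        simpa using SetLike.GradedMul.mul_mem y.2 (c_mem O p)
      have e : (y : S O p) * c O p = -(a₀ O p * prS O p (-2) s) + a₁' O p * prS O p (-2) t := by
        rw [← prS_mul (zero_add (-2)) (a₀_mem O p), ← prS_mul (zero_add (-2)) (a₁'_mem O p),
          ← map_neg, ← map_add, h2]
        exact (prS_of_mem hyc).symm
      rw [h3, h4] at e
      refine sub_eq_zero.1 (eq_zero_of_c_mul _ ?_)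
      linear_combination e
  · rintro ⟨u, v, rfl, rfl⟩
    refine ⟨((u : S O p) * c O p, (v : S O p) * c O p), ?_⟩
    rw [colM_apply]
    refine Prod.ext ?_ ?_
    · change b O p 0 * (u * c O p) + b O p 1 * (v * c O p) =
        u * (b O p 0 * c O p) + v * (b O p 1 * c O p)
      ring
    · change -(a₀ O p * (u * c O p)) + a₁' O p * (v * c O p) =
        (-(u * a₀ O p) + v * a₁' O p) * c O p
      ring

/-- Homomorphisms `L₁ ⟶ Q` as elements of `R`. -/
noncomputable def valAB : (L O p 1 ⟶ Q O p) →ₗ[R O p] R O p where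
  toFun f := ⟨toIdealAB O p (valL f), (φ₂₃ O p 0).hom.map_mem (-1) _ (valL_mem f)⟩
  map_add' _ _ := Subtype.ext ((toIdealAB O p).map_add _ _)
  map_smul' r f := Subtype.ext ((toIdealAB O p).map_smul (r : S O p) (valL f))

theorem valAB_β : valAB (β O p) = ra₀ O p :=
  Subtype.ext (show a₀ O p * 1 + b O p 0 * 0 = a₀ O p by ring)

theorem valAB_φ₃₂ : valAB (φ₃₂ O p) = rbc O p 0 :=
  Subtype.ext (show a₀ O p * 0 + b O p 0 * (c O p * 1) = b O p 0 * c O p by ring)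

theorem range_valAB : LinearMap.range (valAB (O := O) (p := p)) =
    Submodule.span (R O p) {ra₀ O p, rbc O p 0} := by
  refine le_antisymm ?_ (Submodule.span_le.2 ?_)
  · rintro _ ⟨f, rfl⟩
    obtain ⟨x, y, rfl⟩ := exists_hom_L₁_Q_eq f
    rw [map_add, map_smul, map_smul, valAB_β, valAB_φ₃₂]
    exact add_mem (Submodule.smul_mem _ _ (Submodule.subset_span (by simp)))
      (Submodule.smul_mem _ _ (Submodule.subset_span (by simp)))
  · rintro _ (rfl | rfl)
    · exact ⟨β O p, valAB_β⟩
    · exact ⟨φ₃₂ O p, valAB_φ₃₂⟩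

theorem exists_hom_L₁_Q : ∃ Ψ : (L O p 1 ⟶ Q O p) ≃ₗ[R O p]
    Submodule.span (R O p) {ra₀ O p, rbc O p 0},
    (Ψ (β O p) : R O p) = ra₀ O p ∧ (Ψ (φ₃₂ O p) : R O p) = rbc O p 0 :=
  ⟨(LinearEquiv.ofInjective valAB fun _ _ h => hom_ext_LQ (congrArg Subtype.val h)).trans
    (LinearEquiv.ofEq _ _ range_valAB), valAB_β, valAB_φ₃₂⟩

end NonGenericII

/-! ### The presentation of the endomorphism algebra -/

theorem smul_add_smul_eq_zero_of_smul_eq {A M : Type*} [CommRing A] [AddCommGroup M] [Module A M]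
    {F₀ F₁ : M} {a a' y₀ y₁ : A} (w z : A) (h₁ : a • F₁ = -a' • F₀) (h₂ : y₀ • F₁ = y₁ • F₀) :
    (a' * w + y₁ * z) • F₀ + (a * w - y₀ * z) • F₁ = 0 := by
  have : (a' * w + y₁ * z) • F₀ + (a * w - y₀ * z) • F₁ =
      w • (a • F₁ - -a' • F₀) - z • (y₀ • F₁ - y₁ • F₀) := by module
  rw [this, h₁, h₂, sub_self, sub_self, smul_zero, smul_zero, sub_zero]

theorem smul_add_neg_smul_eq_zero_of_smul_eq {A M : Type*} [CommRing A] [AddCommGroup M]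
    [Module A M] {B F : M} {a a' y₀ y₁ : A} (w z : A) (h₀ : y₀ • B = a • F)
    (h₁ : y₁ • B = -a' • F) :
    (w * y₀ + z * y₁) • B + (-(w * a) + z * a') • F = 0 := by
  have : (w * y₀ + z * y₁) • B + (-(w * a) + z * a') • F =
      w • (y₀ • B - a • F) + z • (y₁ • B - -a' • F) := by module
  rw [this, h₀, h₁, sub_self, sub_self, smul_zero, smul_zero, add_zero]

namespace NonGenericII

open GrMod

attribute [local instance] Abelian.hasFiniteBiproducts

variable {O : Type u} [CommRing O] {p : ℕ}

namespace GMA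

variable (O p)

theorem mk_rel {x y : FreeAlgebra (R O p) Gen} (h : Rel O p x y) :
    RingQuot.mkAlgHom (R O p) (Rel O p) x = RingQuot.mkAlgHom (R O p) (Rel O p) y :=
  RingQuot.mkAlgHom_rel _ h

theorem sum_e : gen O p (.e 0) + gen O p (.e 1) + gen O p (.e 2) = 1 := by
  simpa [gen] using mk_rel O p Rel.sum_e

theorem e_mul_e {i j : Fin 3} (h : i ≠ j) : gen O p (.e i) * gen O p (.e j) = 0 := by
  simpa [gen] using mk_rel O p (Rel.e_mul_e h)

theorem e_mul (g : Gen) : gen O p (.e g.row) * gen O p g = gen O p g := by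
  simpa [gen] using mk_rel O p (Rel.e_mul g)

theorem mul_e (g : Gen) : gen O p g * gen O p (.e g.col) = gen O p g := by
  simpa [gen] using mk_rel O p (Rel.mul_e g)

theorem e_mul_of {i : Fin 3} {g : Gen} (h : g.row = i) : gen O p (.e i) * gen O p g = gen O p g :=
  h ▸ e_mul O p g

theorem mul_e_of {j : Fin 3} {g : Gen} (h : g.col = j) : gen O p g * gen O p (.e j) = gen O p g :=
  h ▸ mul_e O p g

theorem φ₁₂_mul_φ₂₁ (i : Fin 2) :
    gen O p .φ₁₂ * gen O p (.φ₂₁ i) = rbc O p i • gen O p (.e 0) := by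
  simpa [gen] using mk_rel O p (Rel.r1 i)

theorem φ₁₂_mul_φ₂₃ (i : Fin 2) : gen O p .φ₁₂ * gen O p (.φ₂₃ i) = gen O p (.φ₁₃ i) := by
  simpa [gen] using mk_rel O p (Rel.r2 i)

theorem φ₁₃_mul_φ₃₁ (i : Fin 2) :
    gen O p (.φ₁₃ i) * gen O p .φ₃₁ = rbc O p i • gen O p (.e 0) := by
  simpa [gen] using mk_rel O p (Rel.r3 i)

theorem φ₂₁_mul_φ₁₂ (i : Fin 2) :
    gen O p (.φ₂₁ i) * gen O p .φ₁₂ = rbc O p i • gen O p (.e 1) := by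
  simpa [gen] using mk_rel O p (Rel.r4 i)

theorem φ₂₁_mul_φ₁₃ (i j : Fin 2) :
    gen O p (.φ₂₁ i) * gen O p (.φ₁₃ j) = rbc O p i • gen O p (.φ₂₃ j) := by
  simpa [gen] using mk_rel O p (Rel.r5 i j)

theorem φ₂₃_mul_φ₃₁ (i : Fin 2) : gen O p (.φ₂₃ i) * gen O p .φ₃₁ = gen O p (.φ₂₁ i) := by
  simpa [gen] using mk_rel O p (Rel.r6 i)

theorem φ₃₁_mul_φ₁₂ : gen O p .φ₃₁ * gen O p .φ₁₂ = gen O p .φ₃₂ := by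
  simpa [gen] using mk_rel O p Rel.r7

theorem φ₃₁_mul_φ₁₃ (i : Fin 2) :
    gen O p .φ₃₁ * gen O p (.φ₁₃ i) = rbc O p i • gen O p (.e 2) := by
  simpa [gen] using mk_rel O p (Rel.r8 i)

theorem φ₁₃_mul_φ₃₂ (i : Fin 2) :
    gen O p (.φ₁₃ i) * gen O p .φ₃₂ = rbc O p i • gen O p .φ₁₂ := by
  simpa [gen] using mk_rel O p (Rel.r9 i)

/-- The elements `a₀` and `-a₁'` of `R`. -/
noncomputable def rα : Fin 2 → R O p := ![ra₀ O p, -ra₁' O p]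

theorem φ₁₃_mul_β (i : Fin 2) : gen O p (.φ₁₃ i) * gen O p .β = rα O p i • gen O p .φ₁₂ := by
  have h₀ : gen O p (.φ₁₃ 0) * gen O p .β = ra₀ O p • gen O p .φ₁₂ := by
    simpa [gen] using mk_rel O p Rel.r9₀
  have h₁ : gen O p (.φ₁₃ 1) * gen O p .β = -ra₁' O p • gen O p .φ₁₂ := by
    simpa [gen] using mk_rel O p Rel.r9₁
  fin_cases i
  · exact h₀
  · exact h₁

theorem φ₂₃_mul_φ₃₂ (i : Fin 2) :
    gen O p (.φ₂₃ i) * gen O p .φ₃₂ = rbc O p i • gen O p (.e 1) := by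
  simpa [gen] using mk_rel O p (Rel.r10 i)

theorem φ₂₃_mul_β (i : Fin 2) : gen O p (.φ₂₃ i) * gen O p .β = rα O p i • gen O p (.e 1) := by
  have h₀ : gen O p (.φ₂₃ 0) * gen O p .β = ra₀ O p • gen O p (.e 1) := by
    simpa [gen] using mk_rel O p Rel.r10₀
  have h₁ : gen O p (.φ₂₃ 1) * gen O p .β = -ra₁' O p • gen O p (.e 1) := by
    simpa [gen] using mk_rel O p Rel.r10₁
  fin_cases i
  · exact h₀
  · exact h₁

theorem φ₃₂_mul_φ₂₁ (i : Fin 2) :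
    gen O p .φ₃₂ * gen O p (.φ₂₁ i) = rbc O p i • gen O p .φ₃₁ := by
  simpa [gen] using mk_rel O p (Rel.r11 i)

theorem β_mul_φ₂₁ (i : Fin 2) : gen O p .β * gen O p (.φ₂₁ i) = rα O p i • gen O p .φ₃₁ := by
  have h₀ : gen O p .β * gen O p (.φ₂₁ 0) = ra₀ O p • gen O p .φ₃₁ := by
    simpa [gen] using mk_rel O p Rel.r11₀
  have h₁ : gen O p .β * gen O p (.φ₂₁ 1) = -ra₁' O p • gen O p .φ₃₁ := by
    simpa [gen] using mk_rel O p Rel.r11₁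
  fin_cases i
  · exact h₀
  · exact h₁

theorem φ₃₂_mul_φ₂₃ (i : Fin 2) :
    gen O p .φ₃₂ * gen O p (.φ₂₃ i) = rbc O p i • gen O p (.e 2) := by
  simpa [gen] using mk_rel O p (Rel.r12 i)

theorem β_mul_φ₂₃ (i : Fin 2) : gen O p .β * gen O p (.φ₂₃ i) = rα O p i • gen O p (.e 2) := by
  have h₀ : gen O p .β * gen O p (.φ₂₃ 0) = ra₀ O p • gen O p (.e 2) := by
    simpa [gen] using mk_rel O p Rel.r12₀
  have h₁ : gen O p .β * gen O p (.φ₂₃ 1) = -ra₁' O p • gen O p (.e 2) := by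
    simpa [gen] using mk_rel O p Rel.r12₁
  fin_cases i
  · exact h₀
  · exact h₁

theorem gen_mul_gen_eq_zero {g h : Gen} (hgh : g.col ≠ h.row) : gen O p g * gen O p h = 0 := by
  rw [← mul_e, ← e_mul O p h, mul_assoc, ← mul_assoc (gen O p (.e g.col)), e_mul_e O p hgh,
    zero_mul, mul_zero]

/-- The span of the generators in a matrix entry. -/
noncomputable def entry (i j : Fin 3) : Submodule (R O p) (GMA O p) :=
  Submodule.span _ {x | ∃ g : Gen, g.row = i ∧ g.col = j ∧ gen O p g = x}

variable {O p}

theorem gen_mem_entry (g : Gen) : gen O p g ∈ entry O p g.row g.col :=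
  Submodule.subset_span ⟨g, rfl, rfl, rfl⟩

/-- Here the list of relations is seen to be complete: each product of composable generators is
rewritten as a multiple of a generator of the same matrix entry. -/
theorem gen_mul_gen_mem {g h : Gen} (hgh : g.col = h.row) :
    gen O p g * gen O p h ∈ entry O p g.row h.col := by
  have hs : ∀ (r : R O p) (k : Gen), k.row = g.row → k.col = h.col →
      r • gen O p k ∈ entry O p g.row h.col := fun r k h1 h2 =>
    Submodule.smul_mem _ r (h1 ▸ h2 ▸ gen_mem_entry k)
  have hs' : ∀ (k : Gen), k.row = g.row → k.col = h.col →
      gen O p k ∈ entry O p g.row h.col := fun k h1 h2 => h1 ▸ h2 ▸ gen_mem_entry k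
  cases g with
  | e i =>
    obtain rfl : i = h.row := hgh
    rw [e_mul]; exact hs' _ rfl rfl
  | φ₁₂ =>
    cases h with
    | e j => rw [mul_e_of O p (j := j) hgh]; obtain rfl : 1 = j := hgh; exact hs' _ rfl rfl
    | φ₂₁ i => rw [φ₁₂_mul_φ₂₁]; exact hs _ _ rfl rfl
    | φ₂₃ i => rw [φ₁₂_mul_φ₂₃]; exact hs' _ rfl rfl
    | _ => exact absurd hgh (by simp [Gen.row, Gen.col])
  | φ₁₃ i =>
    cases h with
    | e j => rw [mul_e_of O p (j := j) hgh]; obtain rfl : 2 = j := hgh; exact hs' _ rfl rfl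
    | φ₃₁ => rw [φ₁₃_mul_φ₃₁]; exact hs _ _ rfl rfl
    | φ₃₂ => rw [φ₁₃_mul_φ₃₂]; exact hs _ _ rfl rfl
    | β => rw [φ₁₃_mul_β]; exact hs _ _ rfl rfl
    | _ => exact absurd hgh (by simp [Gen.row, Gen.col])
  | φ₂₁ i =>
    cases h with
    | e j => rw [mul_e_of O p (j := j) hgh]; obtain rfl : 0 = j := hgh; exact hs' _ rfl rfl
    | φ₁₂ => rw [φ₂₁_mul_φ₁₂]; exact hs _ _ rfl rfl
    | φ₁₃ j => rw [φ₂₁_mul_φ₁₃]; exact hs _ _ rfl rfl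
    | _ => exact absurd hgh (by simp [Gen.row, Gen.col])
  | φ₂₃ i =>
    cases h with
    | e j => rw [mul_e_of O p (j := j) hgh]; obtain rfl : 2 = j := hgh; exact hs' _ rfl rfl
    | φ₃₁ => rw [φ₂₃_mul_φ₃₁]; exact hs' _ rfl rfl
    | φ₃₂ => rw [φ₂₃_mul_φ₃₂]; exact hs _ _ rfl rfl
    | β => rw [φ₂₃_mul_β]; exact hs _ _ rfl rfl
    | _ => exact absurd hgh (by simp [Gen.row, Gen.col])
  | φ₃₁ =>
    cases h with
    | e j => rw [mul_e_of O p (j := j) hgh]; obtain rfl : 0 = j := hgh; exact hs' _ rfl rfl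
    | φ₁₂ => rw [φ₃₁_mul_φ₁₂]; exact hs' _ rfl rfl
    | φ₁₃ i => rw [φ₃₁_mul_φ₁₃]; exact hs _ _ rfl rfl
    | _ => exact absurd hgh (by simp [Gen.row, Gen.col])
  | φ₃₂ =>
    cases h with
    | e j => rw [mul_e_of O p (j := j) hgh]; obtain rfl : 1 = j := hgh; exact hs' _ rfl rfl
    | φ₂₁ i => rw [φ₃₂_mul_φ₂₁]; exact hs _ _ rfl rfl
    | φ₂₃ i => rw [φ₃₂_mul_φ₂₃]; exact hs _ _ rfl rfl
    | _ => exact absurd hgh (by simp [Gen.row, Gen.col])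
  | β =>
    cases h with
    | e j => rw [mul_e_of O p (j := j) hgh]; obtain rfl : 1 = j := hgh; exact hs' _ rfl rfl
    | φ₂₁ i => rw [β_mul_φ₂₁]; exact hs _ _ rfl rfl
    | φ₂₃ i => rw [β_mul_φ₂₃]; exact hs _ _ rfl rfl
    | _ => exact absurd hgh (by simp [Gen.row, Gen.col])

/-- The span contains `1 = e₀ + e₁ + e₂` and is closed under products, so it is a subalgebra
containing all generators. Hence no longer words are needed. -/
theorem mem_span_gen (x : GMA O p) : x ∈ Submodule.span (R O p) (Set.range (gen O p)) := by
  set W := Submodule.span (R O p) (Set.range (gen O p)) with hW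
  have hent : ∀ i j, entry O p i j ≤ W := fun i j => Submodule.span_mono (by
    rintro _ ⟨g, -, -, rfl⟩
    exact ⟨g, rfl⟩)
  have hmul : ∀ x ∈ W, ∀ y ∈ W, x * y ∈ W := by
    intro x hx y hy
    induction hx using Submodule.span_induction with
    | mem x hx =>
      obtain ⟨g, rfl⟩ := hx
      induction hy using Submodule.span_induction with
      | mem y hy =>
        obtain ⟨h, rfl⟩ := hy
        by_cases hgh : g.col = h.row
        · exact hent _ _ (gen_mul_gen_mem hgh)
        · rw [gen_mul_gen_eq_zero O p hgh]
          exact zero_mem _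
      | zero => rw [mul_zero]; exact zero_mem _
      | add y z _ _ hy hz => rw [mul_add]; exact add_mem hy hz
      | smul r y _ hy => rw [mul_smul_comm]; exact Submodule.smul_mem _ _ hy
    | zero => rw [zero_mul]; exact zero_mem _
    | add x z _ _ hx hz => rw [add_mul]; exact add_mem hx hz
    | smul r x _ hx => rw [smul_mul_assoc]; exact Submodule.smul_mem _ _ hx
  have h1 : (1 : GMA O p) ∈ W := by
    rw [← sum_e]
    exact add_mem (add_mem (Submodule.subset_span ⟨_, rfl⟩) (Submodule.subset_span ⟨_, rfl⟩))
      (Submodule.subset_span ⟨_, rfl⟩)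
  obtain ⟨x, rfl⟩ := RingQuot.mkAlgHom_surjective (R O p) (Rel O p) x
  induction x using FreeAlgebra.induction with
  | grade0 r =>
    rw [AlgHom.commutes, Algebra.algebraMap_eq_smul_one]
    exact Submodule.smul_mem _ _ h1
  | grade1 g => exact Submodule.subset_span ⟨g, rfl⟩
  | mul x y hx hy => rw [map_mul]; exact hmul _ hx _ hy
  | add x y hx hy => rw [map_add]; exact add_mem hx hy

theorem e_mul_mul_e_mem (i j : Fin 3) (x : GMA O p) :
    gen O p (.e i) * x * gen O p (.e j) ∈ entry O p i j := by
  induction mem_span_gen x using Submodule.span_induction with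
  | mem x hx =>
    obtain ⟨g, rfl⟩ := hx
    by_cases hi : i = g.row
    · subst hi
      rw [e_mul]
      by_cases hj : g.col = j
      · subst hj
        rw [mul_e]
        exact gen_mem_entry g
      · rw [gen_mul_gen_eq_zero O p (h := .e j) hj]
        exact zero_mem _
    · rw [gen_mul_gen_eq_zero O p (g := .e i) hi, zero_mul]
      exact zero_mem _
  | zero => rw [mul_zero, zero_mul]; exact zero_mem _
  | add x y _ _ hx hy => rw [mul_add, add_mul]; exact add_mem hx hy
  | smul r x _ hx =>
    rw [mul_smul_comm, smul_mul_assoc]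
    exact Submodule.smul_mem _ _ hx

theorem eq_sum_e_mul_mul_e (x : GMA O p) :
    x = ∑ i : Fin 3, ∑ j : Fin 3, gen O p (.e i) * x * gen O p (.e j) := by
  have h := sum_e O p
  simp only [← Finset.mul_sum, ← Finset.sum_mul, Fin.sum_univ_three, h, one_mul, mul_one]

/-! Consequences of the defining relations -/

/-- The two bracketings of `β φ₂₁ⁱ φ₁₂`. -/
theorem rbc_smul_β (i : Fin 2) : rbc O p i • gen O p .β = rα O p i • gen O p .φ₃₂ := by
  have h : gen O p .β * (gen O p (.φ₂₁ i) * gen O p .φ₁₂) =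
      gen O p .β * gen O p (.φ₂₁ i) * gen O p .φ₁₂ := (mul_assoc _ _ _).symm
  rwa [φ₂₁_mul_φ₁₂, β_mul_φ₂₁, mul_smul_comm, mul_e_of O p (g := .β) (j := 1) rfl, smul_mul_assoc, φ₃₁_mul_φ₁₂] at h

/-- The two bracketings of `φ₂₃ⁱ β φ₂₃ʲ`; replacing `β` by `φ₃₂` gives the companion identity with
coefficients `bᵢ c`. Together they realize the two generating syzygies of `(b₀, b₁)` over `R`. -/
theorem rα_smul_φ₂₃ (i j : Fin 2) :
    rα O p i • gen O p (.φ₂₃ j) = rα O p j • gen O p (.φ₂₃ i) := by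
  have h : gen O p (.φ₂₃ i) * gen O p .β * gen O p (.φ₂₃ j) =
      gen O p (.φ₂₃ i) * (gen O p .β * gen O p (.φ₂₃ j)) := mul_assoc _ _ _
  rwa [φ₂₃_mul_β, β_mul_φ₂₃, mul_smul_comm, mul_e_of O p (g := .φ₂₃ i) (j := 2) rfl, smul_mul_assoc,
    e_mul_of O p (g := .φ₂₃ j) (i := 1) rfl] at h

theorem rbc_smul_φ₂₃ (i j : Fin 2) :
    rbc O p i • gen O p (.φ₂₃ j) = rbc O p j • gen O p (.φ₂₃ i) := by
  have h : gen O p (.φ₂₃ i) * gen O p .φ₃₂ * gen O p (.φ₂₃ j) =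
      gen O p (.φ₂₃ i) * (gen O p .φ₃₂ * gen O p (.φ₂₃ j)) := mul_assoc _ _ _
  rwa [φ₂₃_mul_φ₃₂, φ₃₂_mul_φ₂₃, mul_smul_comm, mul_e_of O p (g := .φ₂₃ i) (j := 2) rfl, smul_mul_assoc,
    e_mul_of O p (g := .φ₂₃ j) (i := 1) rfl] at h

/-- Syzygies of the pair `b₀, b₁` over `R` give relations. -/
theorem smul_add_smul_φ₂₃ (w z : R O p) :
    (ra₁' O p * w + rbc O p 1 * z) • gen O p (.φ₂₃ 0) +
      (ra₀ O p * w - rbc O p 0 * z) • gen O p (.φ₂₃ 1) = 0 := by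
  have h1 : ra₀ O p • gen O p (.φ₂₃ 1) = -ra₁' O p • gen O p (.φ₂₃ 0) := rα_smul_φ₂₃ 0 1
  have h2 := rbc_smul_φ₂₃ (O := O) (p := p) 0 1
  exact smul_add_smul_eq_zero_of_smul_eq (A := R O p) (M := GMA O p) w z h1 h2

/-- Right multiplication by `φ₃₁` carries the relation from `φ₂₃` to `φ₂₁`; left multiplication by
`φ₁₂` carries it to `φ₁₃` in the same way. -/
theorem smul_add_smul_φ₂₁ (w z : R O p) :
    (ra₁' O p * w + rbc O p 1 * z) • gen O p (.φ₂₁ 0) +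
      (ra₀ O p * w - rbc O p 0 * z) • gen O p (.φ₂₁ 1) = 0 := by
  have h := congrArg (· * gen O p .φ₃₁) (smul_add_smul_φ₂₃ (O := O) (p := p) w z)
  simpa only [add_mul, smul_mul_assoc, φ₂₃_mul_φ₃₁, zero_mul] using h

theorem smul_add_smul_φ₁₃ (w z : R O p) :
    (ra₁' O p * w + rbc O p 1 * z) • gen O p (.φ₁₃ 0) +
      (ra₀ O p * w - rbc O p 0 * z) • gen O p (.φ₁₃ 1) = 0 := by
  have h := congrArg (gen O p .φ₁₂ * ·) (smul_add_smul_φ₂₃ (O := O) (p := p) w z)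
  simpa only [mul_add, mul_smul_comm, φ₁₂_mul_φ₂₃, mul_zero] using h

theorem smul_β_add_smul_φ₃₂ (w z : R O p) :
    (w * rbc O p 0 + z * rbc O p 1) • gen O p .β +
      (-(w * ra₀ O p) + z * ra₁' O p) • gen O p .φ₃₂ = 0 := by
  have h0 : rbc O p 0 • gen O p .β = ra₀ O p • gen O p .φ₃₂ := rbc_smul_β 0
  have h1 : rbc O p 1 • gen O p .β = -ra₁' O p • gen O p .φ₃₂ := rbc_smul_β 1
  exact smul_add_neg_smul_eq_zero_of_smul_eq (A := R O p) (M := GMA O p) w z h0 h1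

end GMA

variable [IsDomain O]

/-- The syzygies of `b₀, b₁` over `R`. -/
theorem exists_of_smul_b {x y : R O p} (h : (x : S O p) * b O p 0 + (y : S O p) * b O p 1 = 0) :
    ∃ w z, x = ra₁' O p * w + rbc O p 1 * z ∧ y = ra₀ O p * w - rbc O p 0 * z := by
  obtain ⟨w, z, h1, h2⟩ := exists_of_b_mul h
  -- In the syzygies over `S`, only the degree `0` part of `w` and the degree `-2` part of `z`
  -- matter, and the latter is `c` times an element of `R`.
  obtain ⟨z', hz', h3⟩ := exists_of_mem_deg_neg (by norm_num) (prS_mem (-2) z)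
  refine ⟨⟨prS O p 0 w, prS_mem 0 w⟩, ⟨z', hz'⟩, Subtype.ext ?_, Subtype.ext ?_⟩
  · change (x : S O p) = a₁' O p * prS O p 0 w + b O p 1 * c O p * z'
    have : b O p 1 * c O p * z' = prS O p 0 (b O p 1 * z) := by
      rw [prS_mul (show (2 : ℤ) + -2 = 0 by norm_num) (b_mem O p 1), h3]
      ring
    rw [this, ← prS_mul (zero_add 0) (a₁'_mem O p), ← map_add, ← h1]
    exact (prS_of_mem x.2).symm
  · change (y : S O p) = a₀ O p * prS O p 0 w - b O p 0 * c O p * z'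
    have : b O p 0 * c O p * z' = prS O p 0 (b O p 0 * z) := by
      rw [prS_mul (show (2 : ℤ) + -2 = 0 by norm_num) (b_mem O p 0), h3]
      ring
    rw [this, ← prS_mul (zero_add 0) (a₀_mem O p), ← map_sub, ← h2]
    exact (prS_of_mem y.2).symm

end NonGenericII

/-! ### The endomorphism algebra satisfies the presentation -/

namespace NonGenericII

open GrMod

attribute [local instance] Abelian.hasFiniteBiproducts

variable {O : Type u} [CommRing O] [IsDomain O] [IsNoetherianRing O] {p : ℕ}

variable (O p) in
/-- The endomorphism of `X` with a single nonzero matrix entry. -/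
noncomputable def single (i j : Fin 3) :
    (summand O p j ⟶ summand O p i) →ₗ[R O p] End (X O p) where
  toFun f := biproduct.π (summand O p) j ≫ f ≫ biproduct.ι (summand O p) i
  map_add' f g := by rw [Preadditive.add_comp, Preadditive.comp_add]
  map_smul' r f := by rw [Linear.smul_comp, Linear.comp_smul]; rfl

theorem single_apply {i j : Fin 3} (f : summand O p j ⟶ summand O p i) : single O p i j f =
    biproduct.π (summand O p) j ≫ f ≫ biproduct.ι (summand O p) i := rfl

theorem toEnd_eq (g : Gen) : g.toEnd O p = single O p g.row g.col (g.hom O p) := rfl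

theorem single_mul_single {i j k : Fin 3} (f : summand O p j ⟶ summand O p i)
    (g : summand O p k ⟶ summand O p j) :
    single O p i j f * single O p j k g = single O p i k (g ≫ f) := by
  rw [End.mul_def]
  simp only [single_apply, Category.assoc, biproduct.ι_π_self_assoc]

theorem single_mul_single_of_ne {i j j' k : Fin 3} (h : j ≠ j')
    (f : summand O p j ⟶ summand O p i) (g : summand O p k ⟶ summand O p j') :
    single O p i j f * single O p j' k g = 0 := by
  rw [End.mul_def]
  simp only [single_apply, Category.assoc, biproduct.ι_π_ne_assoc _ h.symm, zero_comp, comp_zero]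

theorem ι_single_π {i j : Fin 3} (f : summand O p j ⟶ summand O p i) :
    biproduct.ι (summand O p) j ≫ single O p i j f ≫ biproduct.π (summand O p) i = f := by
  simp only [single_apply, Category.assoc, biproduct.ι_π_self, biproduct.ι_π_self_assoc,
    Category.comp_id]

theorem single_injective (i j : Fin 3) : Function.Injective (single O p i j) := fun f g h => by
  rw [← ι_single_π f, h, ι_single_π]

theorem sum_single_id : ∑ i : Fin 3, single O p i i (𝟙 _) = 1 := by
  refine Eq.trans ?_ (biproduct.total (f := summand O p))
  simp only [single_apply, Category.id_comp]

theorem eq_sum_single (f : End (X O p)) : f = ∑ i : Fin 3, ∑ j : Fin 3,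
    single O p i j (biproduct.ι (summand O p) j ≫ f ≫ biproduct.π (summand O p) i) := by
  have h : ∀ i j : Fin 3, single O p i i (𝟙 _) * f * single O p j j (𝟙 _) =
      single O p i j (biproduct.ι (summand O p) j ≫ f ≫ biproduct.π (summand O p) i) := by
    intro i j
    rw [End.mul_def, End.mul_def]
    simp only [single_apply, Category.assoc, Category.id_comp]
  simp only [← h, ← Finset.mul_sum, ← Finset.sum_mul, sum_single_id, one_mul, mul_one]

theorem lift_toEnd_rel ⦃x y : FreeAlgebra (R O p) Gen⦄ (h : Rel O p x y) :
    FreeAlgebra.lift (R O p) (Gen.toEnd O p) x = FreeAlgebra.lift (R O p) (Gen.toEnd O p) y := by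
  have hs : ∀ {i j k : Fin 3} (f : summand O p j ⟶ summand O p i)
      (g : summand O p k ⟶ summand O p j) (r : R O p) (u : summand O p k ⟶ summand O p i),
      g ≫ f = r • u → single O p i j f * single O p j k g = r • single O p i k u :=
    fun f g r u h => by rw [single_mul_single, h, map_smul]
  have hs' : ∀ {i j k : Fin 3} (f : summand O p j ⟶ summand O p i)
      (g : summand O p k ⟶ summand O p j) (u : summand O p k ⟶ summand O p i),
      g ≫ f = u → single O p i j f * single O p j k g = single O p i k u :=
    fun f g u h => by rw [single_mul_single, h]
  cases h with
  | sum_e =>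
    simp only [map_add, map_one, FreeAlgebra.lift_ι_apply]
    have h := sum_single_id (O := O) (p := p)
    rw [Fin.sum_univ_three] at h
    exact h
  | e_mul_e h =>
    simp only [map_mul, map_zero, FreeAlgebra.lift_ι_apply]
    exact single_mul_single_of_ne h _ _
  | e_mul g =>
    simp only [map_mul, FreeAlgebra.lift_ι_apply]
    exact hs' (𝟙 _) (g.hom O p) _ (Category.comp_id _)
  | mul_e g =>
    simp only [map_mul, FreeAlgebra.lift_ι_apply]
    exact hs' (g.hom O p) (𝟙 _) _ (Category.id_comp _)
  | r1 i =>
    simp only [map_mul, map_smul, FreeAlgebra.lift_ι_apply]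
    exact hs _ _ _ _ (φ₂₁_comp_φ₁₂ O p i)
  | r2 i =>
    simp only [map_mul, FreeAlgebra.lift_ι_apply]
    exact hs' _ _ _ (φ₂₃_comp_φ₁₂ O p i)
  | r3 i =>
    simp only [map_mul, map_smul, FreeAlgebra.lift_ι_apply]
    exact hs _ _ _ _ (φ₃₁_comp_φ₁₃ O p i)
  | r4 i =>
    simp only [map_mul, map_smul, FreeAlgebra.lift_ι_apply]
    exact hs _ _ _ _ (φ₁₂_comp_φ₂₁ O p i)
  | r5 i j =>
    simp only [map_mul, map_smul, FreeAlgebra.lift_ι_apply]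
    exact hs _ _ _ _ (φ₁₃_comp_φ₂₁ O p i j)
  | r6 i =>
    simp only [map_mul, FreeAlgebra.lift_ι_apply]
    exact hs' _ _ _ (φ₃₁_comp_φ₂₃ O p i)
  | r7 =>
    simp only [map_mul, FreeAlgebra.lift_ι_apply]
    exact hs' _ _ _ (φ₁₂_comp_φ₃₁ O p)
  | r8 i =>
    simp only [map_mul, map_smul, FreeAlgebra.lift_ι_apply]
    exact hs _ _ _ _ (φ₁₃_comp_φ₃₁ O p i)
  | r9 i =>
    simp only [map_mul, map_smul, FreeAlgebra.lift_ι_apply]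
    exact hs _ _ _ _ (φ₃₂_comp_φ₁₃ O p i)
  | r9₀ =>
    simp only [map_mul, map_smul, FreeAlgebra.lift_ι_apply]
    exact hs _ _ _ _ (β_comp_φ₁₃_zero O p)
  | r9₁ =>
    simp only [map_mul, map_smul, FreeAlgebra.lift_ι_apply]
    exact hs _ _ _ _ (β_comp_φ₁₃_one O p)
  | r10 i =>
    simp only [map_mul, map_smul, FreeAlgebra.lift_ι_apply]
    exact hs _ _ _ _ (φ₃₂_comp_φ₂₃ O p i)
  | r10₀ =>
    simp only [map_mul, map_smul, FreeAlgebra.lift_ι_apply]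
    exact hs _ _ _ _ (β_comp_φ₂₃_zero O p)
  | r10₁ =>
    simp only [map_mul, map_smul, FreeAlgebra.lift_ι_apply]
    exact hs _ _ _ _ (β_comp_φ₂₃_one O p)
  | r11 i =>
    simp only [map_mul, map_smul, FreeAlgebra.lift_ι_apply]
    exact hs _ _ _ _ (φ₂₁_comp_φ₃₂ O p i)
  | r11₀ =>
    simp only [map_mul, map_smul, FreeAlgebra.lift_ι_apply]
    exact hs _ _ _ _ (φ₂₁_comp_β_zero O p)
  | r11₁ =>
    simp only [map_mul, map_smul, FreeAlgebra.lift_ι_apply]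
    exact hs _ _ _ _ (φ₂₁_comp_β_one O p)
  | r12 i =>
    simp only [map_mul, map_smul, FreeAlgebra.lift_ι_apply]
    exact hs _ _ _ _ (φ₂₃_comp_φ₃₂ O p i)
  | r12₀ =>
    simp only [map_mul, map_smul, FreeAlgebra.lift_ι_apply]
    exact hs _ _ _ _ (φ₂₃_comp_β_zero O p)
  | r12₁ =>
    simp only [map_mul, map_smul, FreeAlgebra.lift_ι_apply]
    exact hs _ _ _ _ (φ₂₃_comp_β_one O p)

variable (O p) in
/-- The algebra map from the presented algebra to the endomorphism algebra. -/
noncomputable def gmaHom : GMA O p →ₐ[R O p] End (X O p) :=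
  RingQuot.liftAlgHom _ ⟨FreeAlgebra.lift _ (Gen.toEnd O p), lift_toEnd_rel⟩

theorem gmaHom_gen (g : Gen) : gmaHom O p (GMA.gen O p g) = g.toEnd O p := by
  rw [gmaHom, GMA.gen, RingQuot.liftAlgHom_mkAlgHom_apply, FreeAlgebra.lift_ι_apply]

theorem gmaHom_smul_gen (r : R O p) (g : Gen) :
    gmaHom O p (r • GMA.gen O p g) = single O p g.row g.col (r • g.hom O p) := by
  rw [map_smul, gmaHom_gen, toEnd_eq, map_smul]

theorem single_mem_range : ∀ (i j : Fin 3) (f : summand O p j ⟶ summand O p i),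
    single O p i j f ∈ LinearMap.range (gmaHom O p).toLinearMap := by
  have h1 : ∀ (g : Gen) (r : R O p),
      single O p g.row g.col (r • g.hom O p) ∈ LinearMap.range (gmaHom O p).toLinearMap :=
    fun g r => ⟨r • GMA.gen O p g, gmaHom_smul_gen r g⟩
  intro i j f
  match i, j, f with
  | 0, 0, f =>
    obtain ⟨r, rfl⟩ := (end_L_bijective (-1)).2 f
    exact h1 (.e 0) r
  | 0, 1, f =>
    obtain ⟨r, rfl⟩ := hom_φ₁₂_bijective.2 f
    exact h1 .φ₁₂ r
  | 0, 2, f =>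
    obtain ⟨u, v, h⟩ := exists_valR_eq f
    obtain rfl : f = u • φ₁₃ O p 0 + v • φ₁₃ O p 1 := by
      refine hom_ext_QL ((congrArg Subtype.val h).trans ?_)
      change (u : S O p) * (b O p 0 * c O p) + (v : S O p) * (b O p 1 * c O p) = _
      rw [← valQ_φ₁₃, ← valQ_φ₁₃]
      rfl
    rw [map_add]
    exact add_mem (h1 (.φ₁₃ 0) u) (h1 (.φ₁₃ 1) v)
  | 1, 0, f =>
    obtain ⟨u, hu, v, hv, h⟩ := exists_of_mem_deg_pos (by norm_num) (valL_mem f)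
    obtain rfl : f = (⟨u, hu⟩ : R O p) • φ₂₁ O p 0 + (⟨v, hv⟩ : R O p) • φ₂₁ O p 1 := by
      refine hom_ext_L ?_
      rw [valL_add, valL_smul, valL_smul, valL_φ₂₁, valL_φ₂₁]
      exact h
    rw [map_add]
    exact add_mem (h1 (.φ₂₁ 0) _) (h1 (.φ₂₁ 1) _)
  | 1, 1, f =>
    obtain ⟨r, rfl⟩ := (end_L_bijective 1).2 f
    exact h1 (.e 1) r
  | 1, 2, f =>
    obtain ⟨u, hu, v, hv, h⟩ := exists_of_mem_deg_pos (by norm_num) (valQ_mem f)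
    obtain rfl : f = (⟨u, hu⟩ : R O p) • φ₂₃ O p 0 + (⟨v, hv⟩ : R O p) • φ₂₃ O p 1 := by
      refine hom_ext_QL ?_
      refine h.trans ?_
      rw [← valQ_φ₂₃, ← valQ_φ₂₃]
      rfl
    rw [map_add]
    exact add_mem (h1 (.φ₂₃ 0) _) (h1 (.φ₂₃ 1) _)
  | 2, 0, f =>
    obtain ⟨r, rfl⟩ := hom_φ₃₁_bijective.2 f
    exact h1 .φ₃₁ r
  | 2, 1, f =>
    obtain ⟨x, y, rfl⟩ := exists_hom_L₁_Q_eq f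
    rw [map_add]
    exact add_mem (h1 .β x) (h1 .φ₃₂ y)
  | 2, 2, f =>
    obtain ⟨r, rfl⟩ := end_Q_bijective.2 f
    exact h1 (.e 2) r

theorem gmaHom_surjective : Function.Surjective (gmaHom O p) := fun f => by
  have : f ∈ LinearMap.range (gmaHom O p).toLinearMap := by
    rw [eq_sum_single f]
    exact sum_mem fun i _ => sum_mem fun j _ => single_mem_range i j _
  exact this

theorem GMA.exists_smul_of_mem_entry {i j : Fin 3} {x : GMA O p} (hx : x ∈ GMA.entry O p i j)
    (g : Gen) (hg : ∀ h : Gen, h.row = i → h.col = j → h = g) :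
    ∃ r : R O p, r • GMA.gen O p g = x := by
  refine Submodule.mem_span_singleton.1 (Submodule.span_mono ?_ hx)
  rintro _ ⟨h, hi, hj, rfl⟩
  rw [hg h hi hj]
  rfl

theorem GMA.exists_smul_add_smul_of_mem_entry {i j : Fin 3} {x : GMA O p}
    (hx : x ∈ GMA.entry O p i j) (g g' : Gen)
    (hg : ∀ h : Gen, h.row = i → h.col = j → h = g ∨ h = g') :
    ∃ r s : R O p, r • GMA.gen O p g + s • GMA.gen O p g' = x := by
  refine Submodule.mem_span_pair.1 (Submodule.span_mono ?_ hx)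
  rintro _ ⟨h, hi, hj, rfl⟩
  rcases hg h hi hj with rfl | rfl
  · exact Or.inl rfl
  · exact Or.inr rfl

/-- In an entry with a single generator the corresponding Hom module is free on it. In the others, a
vanishing combination of the two morphisms has the known syzygies as coefficients, and the matching
combination of generators was already shown to vanish in the presented algebra. -/
theorem GMA.eq_zero_of_mem_entry : ∀ (i j : Fin 3) (x : GMA O p), x ∈ GMA.entry O p i j →
    gmaHom O p x = 0 → x = 0 := by
  have h1 : ∀ (g : Gen) (r : R O p), Function.Injective (fun r : R O p => r • g.hom O p) →
      gmaHom O p (r • GMA.gen O p g) = 0 → r • GMA.gen O p g = 0 := by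
    intro g r hinj h
    rw [gmaHom_smul_gen] at h
    have h' := single_injective _ _ (h.trans (map_zero _).symm)
    obtain rfl : r = 0 := hinj (h'.trans (zero_smul _ _).symm)
    exact zero_smul _ _
  intro i j x hx h
  match i, j, hx with
  | 0, 0, hx =>
    obtain ⟨r, rfl⟩ := GMA.exists_smul_of_mem_entry hx (.e 0) (by
      rintro (i | _ | i | i | i | _ | _ | _) <;> simp [Gen.row, Gen.col])
    exact h1 _ _ (end_L_bijective (-1)).1 h
  | 0, 1, hx =>
    obtain ⟨r, rfl⟩ := GMA.exists_smul_of_mem_entry hx .φ₁₂ (by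
      rintro (i | _ | i | i | i | _ | _ | _) <;> simp +contextual [Gen.row, Gen.col])
    exact h1 _ _ hom_φ₁₂_bijective.1 h
  | 1, 1, hx =>
    obtain ⟨r, rfl⟩ := GMA.exists_smul_of_mem_entry hx (.e 1) (by
      rintro (i | _ | i | i | i | _ | _ | _) <;> simp +contextual [Gen.row, Gen.col])
    exact h1 _ _ (end_L_bijective 1).1 h
  | 2, 0, hx =>
    obtain ⟨r, rfl⟩ := GMA.exists_smul_of_mem_entry hx .φ₃₁ (by
      rintro (i | _ | i | i | i | _ | _ | _) <;> simp +contextual [Gen.row, Gen.col])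
    exact h1 _ _ hom_φ₃₁_bijective.1 h
  | 2, 2, hx =>
    obtain ⟨r, rfl⟩ := GMA.exists_smul_of_mem_entry hx (.e 2) (by
      rintro (i | _ | i | i | i | _ | _ | _) <;> simp +contextual [Gen.row, Gen.col])
    exact h1 _ _ end_Q_bijective.1 h
  | 0, 2, hx =>
    obtain ⟨r, s, rfl⟩ := GMA.exists_smul_add_smul_of_mem_entry hx (.φ₁₃ 0) (.φ₁₃ 1) (by
      rintro (i | _ | i | i | i | _ | _ | _) <;> simp +contextual [Gen.row, Gen.col] <;> omega)
    rw [map_add, gmaHom_smul_gen, gmaHom_smul_gen] at h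
    have h' : r • φ₁₃ O p 0 + s • φ₁₃ O p 1 = 0 :=
      single_injective 0 2 ((map_add _ _ _).trans (h.trans (map_zero _).symm))
    have h2 : (r : S O p) * (b O p 0 * c O p) + (s : S O p) * (b O p 1 * c O p) = 0 := by
      rw [← valQ_φ₁₃, ← valQ_φ₁₃]
      exact congrArg valQ h'
    -- Regularity of `c` reduces the syzygies of `(b₀ c, b₁ c)` to those of `(b₀, b₁)`.
    obtain ⟨w, z, rfl, rfl⟩ := exists_of_smul_b (x := r) (y := s)
      (eq_zero_of_c_mul _ (by linear_combination h2))
    exact GMA.smul_add_smul_φ₁₃ w z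
  | 1, 0, hx =>
    obtain ⟨r, s, rfl⟩ := GMA.exists_smul_add_smul_of_mem_entry hx (.φ₂₁ 0) (.φ₂₁ 1) (by
      rintro (i | _ | i | i | i | _ | _ | _) <;> simp +contextual [Gen.row, Gen.col] <;> omega)
    rw [map_add, gmaHom_smul_gen, gmaHom_smul_gen] at h
    have h' : r • φ₂₁ O p 0 + s • φ₂₁ O p 1 = 0 :=
      single_injective 1 0 ((map_add _ _ _).trans (h.trans (map_zero _).symm))
    have h2 : (r : S O p) * b O p 0 + (s : S O p) * b O p 1 = 0 := by
      rw [← valL_φ₂₁, ← valL_φ₂₁]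
      exact congrArg valL h'
    obtain ⟨w, z, rfl, rfl⟩ := exists_of_smul_b h2
    exact GMA.smul_add_smul_φ₂₁ w z
  | 1, 2, hx =>
    obtain ⟨r, s, rfl⟩ := GMA.exists_smul_add_smul_of_mem_entry hx (.φ₂₃ 0) (.φ₂₃ 1) (by
      rintro (i | _ | i | i | i | _ | _ | _) <;> simp +contextual [Gen.row, Gen.col] <;> omega)
    rw [map_add, gmaHom_smul_gen, gmaHom_smul_gen] at h
    have h' : r • φ₂₃ O p 0 + s • φ₂₃ O p 1 = 0 :=
      single_injective 1 2 ((map_add _ _ _).trans (h.trans (map_zero _).symm))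
    have h2 : (r : S O p) * b O p 0 + (s : S O p) * b O p 1 = 0 := by
      rw [← valQ_φ₂₃, ← valQ_φ₂₃]
      exact congrArg valQ h'
    obtain ⟨w, z, rfl, rfl⟩ := exists_of_smul_b h2
    exact GMA.smul_add_smul_φ₂₃ w z
  | 2, 1, hx =>
    obtain ⟨r, s, rfl⟩ := GMA.exists_smul_add_smul_of_mem_entry hx .β .φ₃₂ (by
      rintro (i | _ | i | i | i | _ | _ | _) <;> simp +contextual [Gen.row, Gen.col])
    rw [map_add, gmaHom_smul_gen, gmaHom_smul_gen] at h
    have h' : r • β O p + s • φ₃₂ O p = 0 :=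
      single_injective 2 1 ((map_add _ _ _).trans (h.trans (map_zero _).symm))
    obtain ⟨u, v, rfl, rfl⟩ := (relation_hom_L₁_Q r s).1 h'
    exact GMA.smul_β_add_smul_φ₃₂ u v

/-- A kernel element has all its components `eᵢ x eⱼ` in the kernel, so injectivity can be checked
one matrix entry at a time. -/
theorem gmaHom_injective : Function.Injective (gmaHom O p) := by
  rw [injective_iff_map_eq_zero]
  intro x hx
  rw [GMA.eq_sum_e_mul_mul_e x]
  refine Finset.sum_eq_zero fun i _ => Finset.sum_eq_zero fun j _ => ?_
  refine GMA.eq_zero_of_mem_entry i j _ (GMA.e_mul_mul_e_mem i j x) ?_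
  rw [map_mul, map_mul, hx, mul_zero, zero_mul]

/-- The endomorphism algebra of `X` has the given presentation. -/
theorem exists_gma_equiv : ∃ Φ : GMA O p ≃ₐ[R O p] End (X O p),
    ∀ g : Gen, Φ (GMA.gen O p g) = g.toEnd O p :=
  ⟨AlgEquiv.ofBijective (gmaHom O p) ⟨gmaHom_injective, gmaHom_surjective⟩, gmaHom_gen⟩

end NonGenericII

/-! ### Depth of localizations -/

namespace LocalDepth

open IsLocalRing RingTheory.Sequence

theorem HasDepth.congr {B : Type*} [CommRing B] [IsLocalRing B] {N N' : Type*} [AddCommGroup N]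
    [Module B N] [AddCommGroup N'] [Module B N'] (e : N ≃ₗ[B] N') {n : ℕ} (h : HasDepth B N n) :
    HasDepth B N' n := by
  obtain ⟨rs, hl, hm, hr⟩ := h
  exact ⟨rs, hl, hm, (e.isWeaklyRegular_congr rs).1 hr⟩

/-- There is a weakly regular sequence of length `n` on `N_𝔭` in the maximal ideal. -/
def HasDepthAt {A : Type*} [CommRing A] (𝔭 : Ideal A) [𝔭.IsPrime] (N : Type*) [AddCommGroup N]
    [Module A N] (n : ℕ) : Prop :=
  HasDepth (Localization.AtPrime 𝔭) (LocalizedModule 𝔭.primeCompl N) n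

section

variable {A : Type u} [CommRing A] {𝔭 : Ideal A} [𝔭.IsPrime]
variable {N N₁ N₃ : Type u} [AddCommGroup N] [Module A N] [AddCommGroup N₁] [Module A N₁]
  [AddCommGroup N₃] [Module A N₃]

theorem HasDepthAt.congr (e : N ≃ₗ[A] N₁) {n : ℕ} (h : HasDepthAt 𝔭 N n) : HasDepthAt 𝔭 N₁ n :=
  HasDepth.congr (IsLocalizedModule.mapEquiv 𝔭.primeCompl (LocalizedModule.mkLinearMap _ N)
    (LocalizedModule.mkLinearMap _ N₁) (Localization.AtPrime 𝔭) e) h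

theorem hasDepthAt_self {n : ℕ} (h : HasDepth (Localization.AtPrime 𝔭) (Localization.AtPrime 𝔭) n) :
    HasDepthAt 𝔭 A n :=
  h.congr (LinearEquiv.extendScalarsOfIsLocalization 𝔭.primeCompl (Localization.AtPrime 𝔭)
    (IsLocalizedModule.iso 𝔭.primeCompl (Algebra.linearMap A (Localization.AtPrime 𝔭))).symm)

variable [IsNoetherianRing A] [Module.Finite A N] [Module.Finite A N₁] [Module.Finite A N₃]

theorem HasDepthAt.of_le {m n : ℕ} (h : HasDepthAt 𝔭 N n) (hm : m ≤ n) : HasDepthAt 𝔭 N m :=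
  HasDepth.of_le h hm

theorem HasDepthAt.of_exact₃ {n : ℕ} (f : N₁ →ₗ[A] N) (g : N →ₗ[A] N₃)
    (hf : Function.Injective f) (hg : Function.Surjective g) (hfg : Function.Exact f g)
    (h₁ : HasDepthAt 𝔭 N₁ (n + 1)) (h : HasDepthAt 𝔭 N n) : HasDepthAt 𝔭 N₃ n :=
  HasDepth.of_exact₃ (LocalizedModule.map 𝔭.primeCompl f) (LocalizedModule.map 𝔭.primeCompl g)
    (LocalizedModule.map_injective _ f hf) (LocalizedModule.map_surjective _ g hg)
    (LocalizedModule.map_exact _ f g hfg) h₁ h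

theorem HasDepthAt.of_exact₂ {n : ℕ} (f : N₁ →ₗ[A] N) (g : N →ₗ[A] N₃)
    (hf : Function.Injective f) (hg : Function.Surjective g) (hfg : Function.Exact f g)
    (h₁ : HasDepthAt 𝔭 N₁ n) (h₃ : HasDepthAt 𝔭 N₃ n) : HasDepthAt 𝔭 N n :=
  HasDepth.of_exact₂ (LocalizedModule.map 𝔭.primeCompl f) (LocalizedModule.map 𝔭.primeCompl g)
    (LocalizedModule.map_injective _ f hf) (LocalizedModule.map_surjective _ g hg)
    (LocalizedModule.map_exact _ f g hfg) h₁ h₃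

theorem HasDepthAt.prod {n : ℕ} (h₁ : HasDepthAt 𝔭 N₁ n) (h₃ : HasDepthAt 𝔭 N₃ n) :
    HasDepthAt 𝔭 (N₁ × N₃) n :=
  h₁.of_exact₂ (LinearMap.inl A N₁ N₃) (LinearMap.snd A N₁ N₃) LinearMap.inl_injective
    LinearMap.snd_surjective Function.Exact.inl_snd h₃

/-- Multiplication by `r` on `A / I` is injective with cokernel `A / J`, so the depth lemma loses
one unit. -/
theorem HasDepthAt.quotient {n : ℕ} {I J : Ideal A} {r : A} (hr : ∀ x, r * x ∈ I → x ∈ I)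
    (hJ : J = I ⊔ Ideal.span {r}) (h : HasDepthAt 𝔭 (A ⧸ I) (n + 1)) :
    HasDepthAt 𝔭 (A ⧸ J) n := by
  have hIJ : I ≤ J := hJ ▸ le_sup_left
  refine h.of_exact₃ (LinearMap.lsmul A (A ⧸ I) r) (Submodule.factor hIJ) ?_
    (Submodule.factor_surjective hIJ) ?_ (h.of_le n.le_succ)
  · rw [← LinearMap.ker_eq_bot, LinearMap.ker_eq_bot']
    intro x hx
    obtain ⟨x, rfl⟩ := Ideal.Quotient.mk_surjective x
    exact Ideal.Quotient.eq_zero_iff_mem.2 (hr x (Ideal.Quotient.eq_zero_iff_mem.1 hx))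
  · intro x
    obtain ⟨x, rfl⟩ := Ideal.Quotient.mk_surjective x
    constructor
    · intro hx
      have hx' : x ∈ J := Ideal.Quotient.eq_zero_iff_mem.1 hx
      rw [hJ] at hx'
      obtain ⟨y, hy, z, hz, rfl⟩ := Submodule.mem_sup.1 hx'
      obtain ⟨z, rfl⟩ := Ideal.mem_span_singleton'.1 hz
      refine ⟨Ideal.Quotient.mk I z, Ideal.Quotient.eq.2 ?_⟩
      change r * z - (y + z * r) ∈ I
      rw [show r * z - (y + z * r) = -y by ring]
      exact neg_mem hy
    · rintro ⟨y, hy⟩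
      obtain ⟨y, rfl⟩ := Ideal.Quotient.mk_surjective y
      rw [← hy]
      refine Ideal.Quotient.eq_zero_iff_mem.2 ?_
      rw [hJ]
      exact Ideal.mem_sup_right (Ideal.mul_mem_right _ _ (Ideal.mem_span_singleton_self r))

end

/-- Depth may be computed over a ring surjecting to the given one. -/
theorem HasDepthAt.of_isLocalizedModule_comap {A A' : Type*} [CommRing A] [CommRing A']
    [Algebra A A'] {N W : Type*} [AddCommGroup N] [Module A N] [Module A' N] [IsScalarTower A A' N]
    (hs : Function.Surjective (algebraMap A A')) (𝔭 : Ideal A') [𝔭.IsPrime] [AddCommGroup W]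
    [Module A' W] [Module (Localization.AtPrime 𝔭) W] [IsScalarTower A' (Localization.AtPrime 𝔭) W]
    (f : N →ₗ[A'] W) [IsLocalizedModule 𝔭.primeCompl f] {n : ℕ}
    (h : HasDepthAt (𝔭.comap (algebraMap A A')) N n) : HasDepth (Localization.AtPrime 𝔭) W n := by
  let 𝔮 := 𝔭.comap (algebraMap A A')
  let φ : Localization.AtPrime 𝔮 →+* Localization.AtPrime 𝔭 :=
    Localization.localRingHom 𝔮 𝔭 (algebraMap A A') rfl
  have hφ : IsLocalHom φ := Localization.isLocalHom_localRingHom _ _ _ _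
  let : Module A W := Module.compHom W (algebraMap A A')
  let : Module (Localization.AtPrime 𝔮) W := Module.compHom W φ
  have hA : ∀ (a : A) (w : W), a • w = algebraMap A A' a • w := fun _ _ => rfl
  have hB : ∀ (b : Localization.AtPrime 𝔮) (w : W), b • w = φ b • w := fun _ _ => rfl
  have : IsScalarTower A (Localization.AtPrime 𝔮) W := ⟨fun a b w => by
    rw [hB, hB, hA, Algebra.smul_def, map_mul, Localization.localRingHom_to_map, mul_smul,
      algebraMap_smul]⟩
  let g : N →ₗ[A] W :=
    { toFun := f
      map_add' := map_add f
      map_smul' := fun a x => by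
        rw [← algebraMap_smul A' a x, map_smul]
        rfl }
  -- Every denominator outside `𝔭` lifts along the surjection to one outside `𝔮`, so the
  -- localization over `A'` is also the localization over `A`.
  have hg : IsLocalizedModule 𝔮.primeCompl g :=
    { map_units := fun s => by
        have h1 := IsLocalizedModule.map_units f (⟨algebraMap A A' s, s.2⟩ : 𝔭.primeCompl)
        rw [Module.End.isUnit_iff] at h1 ⊢
        exact h1
      surj := fun y => by
        obtain ⟨⟨x, s, hs'⟩, hx⟩ := IsLocalizedModule.surj 𝔭.primeCompl f y
        obtain ⟨s, rfl⟩ := hs s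
        exact ⟨⟨x, s, hs'⟩, hx⟩
      exists_of_eq := fun {x y} hxy => by
        obtain ⟨⟨s, hs'⟩, hx⟩ := IsLocalizedModule.exists_of_eq (S := 𝔭.primeCompl) (f := f) hxy
        obtain ⟨s, rfl⟩ := hs s
        refine ⟨⟨s, hs'⟩, ?_⟩
        change algebraMap A A' s • x = algebraMap A A' s • y at hx
        rwa [algebraMap_smul, algebraMap_smul] at hx }
  let e := LinearEquiv.extendScalarsOfIsLocalization 𝔮.primeCompl (Localization.AtPrime 𝔮)
    (IsLocalizedModule.iso 𝔮.primeCompl g)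
  obtain ⟨rs, hl, hm, hr⟩ := h
  refine ⟨rs.map φ, by simpa using hl, fun r hr => ?_, ?_⟩
  · obtain ⟨s, hs, rfl⟩ := List.mem_map.1 hr
    exact (map_mem_nonunits_iff φ s).2 (hm s hs)
  · refine (AddEquiv.isWeaklyRegular_congr (e := e.toAddEquiv) ?_).1 hr
    rw [List.forall₂_map_right_iff, List.forall₂_same]
    exact fun s _ x => e.map_smul s x

theorem HasDepthAt.of_comap {A A' : Type*} [CommRing A] [CommRing A'] [Algebra A A'] {N : Type*}
    [AddCommGroup N] [Module A N] [Module A' N] [IsScalarTower A A' N]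
    (hs : Function.Surjective (algebraMap A A')) (𝔭 : Ideal A') [𝔭.IsPrime] {n : ℕ}
    (h : HasDepthAt (𝔭.comap (algebraMap A A')) N n) : HasDepthAt 𝔭 N n :=
  h.of_isLocalizedModule_comap hs 𝔭 (LocalizedModule.mkLinearMap 𝔭.primeCompl N)

/-- Killing a weakly regular sequence lowers the dimension of a local ring by its length. -/
theorem ringKrullDim_add_length_le {A A' : Type*} [CommRing A] [IsNoetherianRing A] [CommRing A']
    [Algebra A A'] (hs : Function.Surjective (algebraMap A A')) (𝔭 : Ideal A') [𝔭.IsPrime]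
    (rs : List A) (hr : IsWeaklyRegular A rs) (h0 : ∀ r ∈ rs, algebraMap A A' r = 0) :
    ringKrullDim (Localization.AtPrime 𝔭) + rs.length ≤
      ringKrullDim (Localization.AtPrime (𝔭.comap (algebraMap A A'))) := by
  let 𝔮 := 𝔭.comap (algebraMap A A')
  let φ : Localization.AtPrime 𝔮 →+* Localization.AtPrime 𝔭 :=
    Localization.localRingHom 𝔮 𝔭 (algebraMap A A') rfl
  have hreg := hr.isRegular_of_isLocalization_of_mem (Localization.AtPrime 𝔮) 𝔮 fun r hr => by
    change algebraMap A A' r ∈ 𝔭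
    rw [h0 r hr]
    exact zero_mem _
  have hdim := ringKrullDim_add_length_eq_ringKrullDim_of_isRegular _ hreg
  rw [List.length_map] at hdim
  refine le_trans ?_ hdim.le
  gcongr
  -- The local ring at `𝔭` is a quotient of the local ring at `𝔮` modulo the sequence, whose
  -- dimension has dropped by exactly the length.
  refine ringKrullDim_le_of_surjective (Ideal.Quotient.lift _ φ ?_) ?_
  · suffices Ideal.ofList (rs.map (algebraMap A (Localization.AtPrime 𝔮))) ≤ RingHom.ker φ from
      fun a ha => this ha
    refine Ideal.span_le.2 fun x hx => ?_
    obtain ⟨r, hr, rfl⟩ := List.mem_map.1 hx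
    change φ _ = 0
    rw [Localization.localRingHom_to_map, h0 r hr, map_zero]
  · refine Ideal.Quotient.lift_surjective_of_surjective _ _ fun y => ?_
    obtain ⟨y, ⟨s, hs'⟩, rfl⟩ := IsLocalization.exists_mk'_eq 𝔭.primeCompl y
    obtain ⟨y, rfl⟩ := hs y
    obtain ⟨s, rfl⟩ := hs s
    exact ⟨IsLocalization.mk' _ y (⟨s, hs'⟩ : 𝔮.primeCompl), Localization.localRingHom_mk' ..⟩

theorem exists_eq_add_of_add_le {a : WithBot ℕ∞} (h0 : 0 ≤ a) {k m : ℕ}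
    (h : a + k ≤ (m : WithBot ℕ∞)) : ∃ n : ℕ, m = n + k ∧ a ≤ n := by
  induction a with
  | bot => exact absurd h0 (by simp)
  | coe a =>
    have h' : a + k ≤ (m : ℕ∞) := by exact_mod_cast h
    have ha : a ≠ ⊤ := by
      rintro rfl
      simp at h'
    lift a to ℕ using ha
    have h2 : a + k ≤ m := by exact_mod_cast h'
    obtain ⟨n, rfl⟩ : ∃ n, m = n + k := ⟨m - k, by omega⟩
    have h3 : a ≤ n := by omega
    exact ⟨n, rfl, by exact_mod_cast h3⟩

/-- A weakly regular sequence as long as the dimension makes a nonzero module maximal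
Cohen-Macaulay. -/
theorem HasDepth.exists_isRegular {B W : Type*} [CommRing B] [IsLocalRing B] [IsNoetherianRing B]
    [AddCommGroup W] [Module B W] [Module.Finite B W] [Nontrivial W] {n : ℕ} (h : HasDepth B W n)
    (hn : ringKrullDim B ≤ n) : ∃ rs : List B, (∀ r ∈ rs, r ∈ maximalIdeal B) ∧ IsRegular W rs ∧
      (rs.length : WithBot ℕ∞) = ringKrullDim B := by
  obtain ⟨rs, rfl, hm, hr⟩ := h
  have hreg := (isRegular_iff_isWeaklyRegular_of_subset_maximalIdeal (M := W) hm).2 hr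
  refine ⟨rs, hm, hreg, le_antisymm ?_ hn⟩
  have := hreg.quot_ofList_smul_nontrivial (⊤ : Submodule B W)
  have h1 := Module.supportDim_add_length_eq_supportDim_of_isRegular rs hreg
  refine le_trans ?_ (h1.le.trans (Module.supportDim_le_ringKrullDim B W))
  refine le_add_of_nonneg_left ?_
  have h2 := Module.supportDim_ne_bot_of_nontrivial B (W ⧸ Ideal.ofList rs • (⊤ : Submodule B W))
  obtain ⟨k, hk⟩ := WithBot.ne_bot_iff_exists.1 h2
  rw [← hk]
  exact_mod_cast zero_le

end LocalDepth

/-! ### `Q` is maximal Cohen-Macaulay -/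

namespace NonGenericII

open LocalDepth RingTheory.Sequence MvPolynomial

variable (O : Type u) [CommRing O] [IsDomain O] (p : ℕ)

/-- The relator `Y₀ - b₀ c`. -/
noncomputable def relator₁ : Poly O := C (MvPowerSeries.X 2) - MvPolynomial.X 0 * MvPolynomial.X 2

/-- The relator `Y₁ - b₁ c`. -/
noncomputable def relator₂ : Poly O := C (MvPowerSeries.X 3) - MvPolynomial.X 1 * MvPolynomial.X 2

theorem relIdeal₂_eq : relIdeal₂ O = Ideal.span {relator₁ O} ⊔ Ideal.span {relator₂ O} := by
  rw [relIdeal₂, Ideal.span_insert]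
  rfl

theorem mem_span_relator₁_of_mul (x : Poly O) (hx : relator₂ O * x ∈ Ideal.span {relator₁ O}) :
    x ∈ Ideal.span {relator₁ O} :=
  have : IsDomain (Coeff O) := NoZeroDivisors.to_isDomain _
  ExtendedRees.mem_span_of_mul_mem_span (X_ne_zero 2) (X_ne_zero 3) x hx

theorem relator₁_ne_zero : relator₁ O ≠ 0 := fun h => by
  have h1 := congrArg constantCoeff h
  simp only [relator₁, map_sub, map_mul, constantCoeff_C, constantCoeff_X, map_zero, mul_zero,
    sub_zero] at h1
  exact X_ne_zero 2 h1

theorem isWeaklyRegular_relators :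
    IsWeaklyRegular (Poly O) [relator₁ O, relator₂ O, relator₃ O p] := by
  have h1 : IsWeaklyRegular (Poly O) [relator₁ O] := by
    rw [isWeaklyRegular_singleton_iff]
    exact (IsRegular.of_ne_zero (relator₁_ne_zero O)).left
  have h2 : IsWeaklyRegular (Poly O) ([relator₁ O] ++ [relator₂ O]) := by
    refine isWeaklyRegular_append_singleton _ _ h1 fun x hx => ?_
    rw [Ideal.ofList_singleton] at hx ⊢
    exact mem_span_relator₁_of_mul O x hx
  refine isWeaklyRegular_append_singleton ([relator₁ O] ++ [relator₂ O]) _ h2 fun x hx => ?_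
  rw [Ideal.ofList_append, Ideal.ofList_singleton, Ideal.ofList_singleton, ← relIdeal₂_eq]
    at hx ⊢
  exact mem_relIdeal₂_of_relator₃_mul hx

theorem mk_relators {r : Poly O} (hr : r ∈ [relator₁ O, relator₂ O, relator₃ O p]) :
    mk O p r = 0 := by
  rw [mk_eq_zero, relIdeal_eq, relIdeal₂_eq]
  simp only [List.mem_cons, List.not_mem_nil, or_false] at hr
  rcases hr with rfl | rfl | rfl
  · exact Ideal.mem_sup_left (Ideal.mem_sup_left (Ideal.mem_span_singleton_self _))
  · exact Ideal.mem_sup_left (Ideal.mem_sup_right (Ideal.mem_span_singleton_self _))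
  · exact Ideal.mem_sup_right (Ideal.mem_span_singleton_self _)

/-- The ring `O⟦a₀, a₁, Y₀, Y₁⟧[b₀, b₁, c] / (Y₀ - b₀ c, Y₁ - b₁ c)`. -/
abbrev PreS : Type u := Poly O ⧸ relIdeal₂ O

/-- The matrix `M` over `PreS`. -/
noncomputable def preM : PreS O × PreS O →ₗ[Poly O] PreS O × PreS O :=
  LinearMap.prod ((MvPolynomial.X 0 : Poly O) • LinearMap.fst _ _ _ +
      (MvPolynomial.X 1 : Poly O) • LinearMap.snd _ _ _)
    (-((C (MvPowerSeries.X 0) : Poly O) • LinearMap.fst _ _ _) +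
      (C (ca₁' O p) : Poly O) • LinearMap.snd _ _ _)

theorem preM_mk (x y : Poly O) :
    preM O p (Ideal.Quotient.mk _ x, Ideal.Quotient.mk _ y) =
      (Ideal.Quotient.mk _ (MvPolynomial.X 0 * x + MvPolynomial.X 1 * y),
        Ideal.Quotient.mk _ (-(C (MvPowerSeries.X 0) * x) + C (ca₁' O p) * y)) := rfl

/-- Applying the adjugate turns `M v = 0` into vanishing of the third relator times `v`, and that
relator is regular over `PreS`. -/
theorem preM_injective : Function.Injective (preM O p) := by
  rw [← LinearMap.ker_eq_bot, LinearMap.ker_eq_bot']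
  rintro ⟨x, y⟩ hxy
  obtain ⟨x, rfl⟩ := Ideal.Quotient.mk_surjective x
  obtain ⟨y, rfl⟩ := Ideal.Quotient.mk_surjective y
  rw [preM_mk] at hxy
  have h1 := Ideal.Quotient.eq_zero_iff_mem.1 (congrArg Prod.fst hxy)
  have h2 := Ideal.Quotient.eq_zero_iff_mem.1 (congrArg Prod.snd hxy)
  refine Prod.ext (Ideal.Quotient.eq_zero_iff_mem.2 (mem_relIdeal₂_of_relator₃_mul (p := p) ?_))
    (Ideal.Quotient.eq_zero_iff_mem.2 (mem_relIdeal₂_of_relator₃_mul (p := p) ?_))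
  · have := sub_mem (Ideal.mul_mem_left _ (C (ca₁' O p)) h1) (Ideal.mul_mem_left _ (MvPolynomial.X 1) h2)
    convert this using 1
    rw [relator₃]; ring
  · have := add_mem (Ideal.mul_mem_left _ (C (MvPowerSeries.X 0)) h1)
      (Ideal.mul_mem_left _ (MvPolynomial.X 0) h2)
    convert this using 1
    rw [relator₃]; ring

/-- `S` as an algebra over the polynomial ring. -/
noncomputable instance : Algebra (Poly O) (S O p) := (mk O p).toAlgebra

/-- `Q` as a module over the polynomial ring. -/
noncomputable instance : Module (Poly O) (Qmod O p) := Module.compHom _ (mk O p)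

instance : IsScalarTower (Poly O) (S O p) (Qmod O p) := ⟨fun a s q => by
  rw [Algebra.smul_def, mul_smul]; rfl⟩

/-- The projection to `S`. -/
noncomputable def preSToS : PreS O →+* S O p := Ideal.Quotient.lift _ (mk O p) fun _ =>
  relIdeal₂_le _ p

theorem preSToS_mk (x : Poly O) : preSToS O p (Ideal.Quotient.mk _ x) = mk O p x := rfl

/-- The projection `PreS² → Q`. -/
noncomputable def preQ : PreS O × PreS O →ₗ[Poly O] Qmod O p where
  toFun x := mkQmod O p (preSToS O p x.1, preSToS O p x.2)
  map_add' x y := by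
    rw [← map_add, Prod.fst_add, Prod.snd_add, map_add, map_add]
    rfl
  map_smul' a x := by
    obtain ⟨x, y⟩ := x
    obtain ⟨x, rfl⟩ := Ideal.Quotient.mk_surjective x
    obtain ⟨y, rfl⟩ := Ideal.Quotient.mk_surjective y
    change mkQmod O p (mk O p (a * x), mk O p (a * y)) = mk O p a • mkQmod O p (mk O p x, mk O p y)
    rw [← map_smul, map_mul, map_mul]
    rfl

theorem preQ_mk (x y : Poly O) : preQ O p (Ideal.Quotient.mk _ x, Ideal.Quotient.mk _ y) =
    mkQmod O p (mk O p x, mk O p y) := rfl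

theorem preQ_surjective : Function.Surjective (preQ O p) := fun q => by
  obtain ⟨⟨x, y⟩, rfl⟩ := mkQmod_surjective q
  obtain ⟨x, rfl⟩ := mk_surjective O p x
  obtain ⟨y, rfl⟩ := mk_surjective O p y
  exact ⟨_, preQ_mk O p x y⟩

theorem colM_mk (x y : Poly O) : colM O p (mk O p x, mk O p y) = (mk O p (MvPolynomial.X 0 * x + MvPolynomial.X 1 * y),
    mk O p (-(C (MvPowerSeries.X 0) * x) + C (ca₁' O p) * y)) := by
  simp only [colM_apply, map_add, map_neg, map_mul]
  rfl

/-- Since `M N` is the third relator times the identity, the image of `M` over `PreS` already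
contains all multiples of that relator. So the cokernel over `PreS` is the cokernel over `S`. -/
theorem exact_preM_preQ : Function.Exact (preM O p) (preQ O p) := by
  rintro ⟨x, y⟩
  obtain ⟨x, rfl⟩ := Ideal.Quotient.mk_surjective x
  obtain ⟨y, rfl⟩ := Ideal.Quotient.mk_surjective y
  rw [preQ_mk, mkQmod_eq_zero_iff]
  constructor
  · rintro ⟨⟨u, v⟩, huv⟩
    obtain ⟨u, rfl⟩ := mk_surjective O p u
    obtain ⟨v, rfl⟩ := mk_surjective O p v
    rw [colM_mk] at huv
    obtain ⟨g, hg⟩ := (mk_eq_zero_iff p (x - (MvPolynomial.X 0 * u + MvPolynomial.X 1 * v))).1 (by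
      rw [map_sub, sub_eq_zero]; exact (congrArg Prod.fst huv).symm)
    obtain ⟨g', hg'⟩ := (mk_eq_zero_iff p
      (y - (-(C (MvPowerSeries.X 0) * u) + C (ca₁' O p) * v))).1 (by
        rw [map_sub, sub_eq_zero]; exact (congrArg Prod.snd huv).symm)
    -- The preimage is `(u, v) + N (g, g')`, where `g, g'` record the multiples of the relator by
    -- which `M (u, v)` misses `(x, y)`.
    refine ⟨(Ideal.Quotient.mk _ (u + C (ca₁' O p) * g - MvPolynomial.X 1 * g'),
      Ideal.Quotient.mk _ (v + C (MvPowerSeries.X 0) * g + MvPolynomial.X 0 * g')), ?_⟩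
    rw [preM_mk]
    refine Prod.ext (Ideal.Quotient.eq.2 ?_) (Ideal.Quotient.eq.2 ?_)
    · rw [← neg_mem_iff]
      convert hg using 1
      rw [relator₃]; ring
    · rw [← neg_mem_iff]
      convert hg' using 1
      rw [relator₃]; ring
  · rintro ⟨⟨u, v⟩, huv⟩
    obtain ⟨u, rfl⟩ := Ideal.Quotient.mk_surjective u
    obtain ⟨v, rfl⟩ := Ideal.Quotient.mk_surjective v
    rw [preM_mk] at huv
    refine ⟨(mk O p u, mk O p v), ?_⟩
    rw [colM_mk, ← preSToS_mk, ← preSToS_mk, ← preSToS_mk, ← preSToS_mk]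
    exact Prod.ext (congrArg (preSToS O p) (congrArg Prod.fst huv))
      (congrArg (preSToS O p) (congrArg Prod.snd huv))

/-- If `s` kills `Q`, then `s` times the identity factors as `M B`, and taking determinants gives `s
^ 2 = det M * det B = 0`. So the annihilator is nil and `Q` has full support, which makes its
localizations nonzero. -/
theorem sq_eq_zero_of_smul_Q {s : S O p} (hs : ∀ q : Qmod O p, s • q = 0) : s ^ 2 = 0 := by
  obtain ⟨⟨x, y⟩, h1⟩ := (mkQmod_eq_zero_iff (s • ((1, 0) : S O p × S O p))).1 (by
    rw [map_smul]; exact hs _)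
  obtain ⟨⟨z, w⟩, h2⟩ := (mkQmod_eq_zero_iff (s • ((0, 1) : S O p × S O p))).1 (by
    rw [map_smul]; exact hs _)
  rw [colM_apply] at h1 h2
  have h11 : b O p 0 * x + b O p 1 * y = s * 1 := congrArg Prod.fst h1
  have h12 : -(a₀ O p * x) + a₁' O p * y = s * 0 := congrArg Prod.snd h1
  have h21 : b O p 0 * z + b O p 1 * w = s * 0 := congrArg Prod.fst h2
  have h22 : -(a₀ O p * z) + a₁' O p * w = s * 1 := congrArg Prod.snd h2
  linear_combination (-s) * h11 - (b O p 0 * x + b O p 1 * y) * h22 +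
    (b O p 0 * z + b O p 1 * w) * h12 + (x * w - y * z) * relation O p

theorem nontrivial_localizedModule_Q [IsNoetherianRing O] (𝔪 : Ideal (S O p)) [h𝔪 : 𝔪.IsPrime] :
    Nontrivial (LocalizedModule 𝔪.primeCompl (Qmod O p)) := by
  have : Module.Finite (S O p) (Qmod O p) := (Q O p).property
  have h : (⟨𝔪, h𝔪⟩ : PrimeSpectrum (S O p)) ∈ Module.support (S O p) (Qmod O p) := by
    rw [Module.support_eq_zeroLocus]
    intro s hs
    exact h𝔪.mem_of_pow_mem 2 (by
      rw [sq_eq_zero_of_smul_Q O p (Module.mem_annihilator.1 hs)]; exact zero_mem _)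
  exact h

/-- At the preimage of `𝔪` the polynomial ring has depth `n + 3`, where `n` is at least the
dimension of `S` at `𝔪`. Two relators leave depth `n + 1` on `PreS`, and the resolution of length
one by `M` leaves depth `n` on `Q`. -/
theorem isMaximalCohenMacaulay_Q [IsLocalRing O] [IsNoetherianRing O] (x : O)
    (hx : x ∈ IsLocalRing.maximalIdeal O) (hx0 : x ≠ 0) (hd : ringKrullDim O ≤ 1) :
    IsMaximalCohenMacaulay (S O p) (Qmod O p) := by
  have hfin : Module.Finite (S O p) (Qmod O p) := (Q O p).property
  refine ⟨hfin, fun 𝔪 _ => ?_⟩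
  have hs : Function.Surjective (algebraMap (Poly O) (S O p)) := mk_surjective O p
  have : Module.Finite (Poly O) (Qmod O p) := Module.Finite.of_surjective _ (preQ_surjective O p)
  obtain ⟨rs, hm, hr, hl⟩ := isCMRing_poly O x hx hx0 hd (𝔪.comap (algebraMap (Poly O) (S O p)))
  have h3 := (ringKrullDim_add_length_le hs 𝔪 _ (isWeaklyRegular_relators O p)
    fun r hr => mk_relators O p hr).trans hl
  obtain ⟨n, hn, hn'⟩ : ∃ n, rs.length = n + 3 ∧
      ringKrullDim (Localization.AtPrime 𝔪) ≤ (n : WithBot ℕ∞) := by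
    exact exists_eq_add_of_add_le ringKrullDim_nonneg_of_nontrivial h3
  have hd0 : HasDepthAt (𝔪.comap (algebraMap (Poly O) (S O p))) (Poly O ⧸ (⊥ : Ideal (Poly O)))
      (n + 3) :=
    (hasDepthAt_self ⟨rs, hn, hm, hr⟩).congr (Submodule.quotEquivOfEqBot ⊥ rfl).symm
  have hd1 := hd0.quotient (r := relator₁ O) (J := Ideal.span {relator₁ O}) (fun z hz =>
    (mul_eq_zero.1 hz).resolve_left (relator₁_ne_zero O)) (by rw [bot_sup_eq])
  have hd2 := hd1.quotient (mem_span_relator₁_of_mul O) (relIdeal₂_eq O)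
  have hd3 : HasDepthAt (𝔪.comap (algebraMap (Poly O) (S O p))) (Qmod O p) n :=
    HasDepthAt.of_exact₃ (preM O p) (preQ O p) (preM_injective O p) (preQ_surjective O p)
      (exact_preM_preQ O p) (hd2.prod hd2) ((hd2.prod hd2).of_le n.le_succ)
  have := nontrivial_localizedModule_Q O p 𝔪
  exact HasDepth.exists_isRegular (hd3.of_comap hs 𝔪) hn'

end NonGenericII

/-! ### `Q` is not projective -/

namespace NonGenericII

open MvPolynomial

variable (O : Type u) [CommRing O] (p : ℕ)

/-- The specialization of `S` to `k[b₀]` in which the other variables and `p` vanish. -/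
theorem exists_specialization {k : Type*} [CommRing k] (φ : O →+* k) (hφ : φ p = 0) :
    ∃ ψ : S O p →+* Polynomial k, ψ (b O p 0) = Polynomial.X ∧ ψ (b O p 1) = 0 ∧
      ψ (a₀ O p) = 0 := by
  let ψ₀ : Poly O →+* Polynomial k := eval₂Hom
    ((Polynomial.C.comp φ).comp (MvPowerSeries.constantCoeff (σ := Fin 4) (R := O)))
    ![Polynomial.X, 0, 0]
  have hC : ∀ x : Coeff O, ψ₀ (C x) = Polynomial.C (φ (MvPowerSeries.constantCoeff x)) :=
    fun x => eval₂Hom_C _ _ x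
  have hX : ∀ i, ψ₀ (MvPolynomial.X i) = (![Polynomial.X, 0, 0] : Fin 3 → Polynomial k) i :=
    fun i => eval₂Hom_X' _ _ i
  have h0 : ∀ x ∈ relIdeal O p, ψ₀ x = 0 := by
    suffices relIdeal O p ≤ RingHom.ker ψ₀ from fun x hx => this hx
    rw [relIdeal, Ideal.span_le]
    rintro _ ⟨i, rfl⟩
    change ψ₀ _ = 0
    have hφ' : (p : Polynomial k) = 0 := by
      rw [← map_natCast Polynomial.C, ← map_natCast φ, hφ, map_zero]
    fin_cases i <;> simp [relators, hC, hX, hφ']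
  refine ⟨Ideal.Quotient.lift _ ψ₀ h0, hX 0, hX 1, ?_⟩
  exact (hC _).trans (by simp)

/-- A section `σ` satisfies `b₀ σ(e₁) = a₀ σ(e₂)`, and it differs from the identity by the image of
`M`. Specializing to `k[b₀]` with `a₀ = b₁ = 0` gives `b₀ (1 - b₀ t) = 0`, whose linear coefficient
reads `1 = 0`. -/
theorem not_projective_Q {k : Type*} [CommRing k] [Nontrivial k] (φ : O →+* k) (hφ : φ p = 0) :
    ¬ Module.Projective (S O p) (Qmod O p) := by
  intro h
  obtain ⟨σ, hσ⟩ := Module.projective_lifting_property (mkQmod O p) LinearMap.id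
    mkQmod_surjective
  have hσ' : ∀ q, mkQmod O p (σ q) = q := fun q => LinearMap.congr_fun hσ q
  have key : ∀ x : S O p × S O p, ∃ t, colM O p t = x - σ (mkQmod O p x) := fun x =>
    (mkQmod_eq_zero_iff _).1 (by rw [map_sub, hσ', sub_self])
  obtain ⟨⟨t₀, t₁⟩, ht⟩ := key (1, 0)
  obtain ⟨⟨u₀, u₁⟩, hu⟩ := key (0, 1)
  have h1 : b O p 0 • σ (mkQmod O p (1, 0)) - a₀ O p • σ (mkQmod O p (0, 1)) = 0 := by
    rw [← map_smul, ← map_smul, ← map_smul, ← map_smul, ← map_sub, ← map_sub,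
      (mkQmod_eq_zero_iff _).2 ⟨(1, 0), ?_⟩, map_zero]
    rw [colM_apply]
    exact Prod.ext (by simp) (by simp)
  have h2 : b O p 0 * (1 - (b O p 0 * t₀ + b O p 1 * t₁)) -
      a₀ O p * (0 - (b O p 0 * u₀ + b O p 1 * u₁)) = 0 := by
    have ht' : b O p 0 * t₀ + b O p 1 * t₁ = 1 - (σ (mkQmod O p (1, 0))).1 := congrArg Prod.fst ht
    have hu' : b O p 0 * u₀ + b O p 1 * u₁ = 0 - (σ (mkQmod O p (0, 1))).1 := congrArg Prod.fst hu
    rw [ht', hu', sub_sub_cancel, sub_sub_cancel]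
    exact congrArg Prod.fst h1
  obtain ⟨ψ, hb₀, hb₁, ha₀⟩ := exists_specialization O p φ hφ
  have h3 := congrArg ψ h2
  simp only [map_sub, map_mul, map_add, map_one, map_zero, hb₀, hb₁, ha₀, zero_mul, add_zero,
    sub_zero] at h3
  have h4 := congrArg (Polynomial.coeff · (0 + 1)) h3
  simp only [Polynomial.coeff_X_mul, Polynomial.coeff_sub, Polynomial.coeff_one_zero,
    Polynomial.mul_coeff_zero, Polynomial.coeff_X_zero, zero_mul, sub_zero,
    Polynomial.coeff_zero] at h4
  exact one_ne_zero h4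

end NonGenericII
-- Assembly over the ring of integers
theorem mainTheorem6 (p : ℕ) [Fact p.Prime] (hp : 5 ≤ p) (K : Type u) [Field K]
    [Algebra ℚ_[p] K] [Algebra ℤ_[p] K] [IsScalarTower ℤ_[p] ℚ_[p] K] [FiniteDimensional ℚ_[p] K] :
    -- `Q` is maximal Cohen-Macaulay and not locally free
    ((∀ i : ℕ, 1 ≤ i → Subsingleton (Abelian.Ext.{u}
        (ModuleCat.of (S (𝒪 p K) p) (Qmod (𝒪 p K) p))
        (ModuleCat.of (S (𝒪 p K) p) (S (𝒪 p K) p)) i)) ∧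
      IsMaximalCohenMacaulay (S (𝒪 p K) p) (Qmod (𝒪 p K) p) ∧
      ¬ Module.Projective (S (𝒪 p K) p) (Qmod (𝒪 p K) p)) ∧
    -- vanishing of `Ext` groups in `Coh(𝔛)`
    ((∀ (n : ℤ) (i : ℕ), 1 ≤ i →
        Subsingleton (Abelian.Ext.{u + 1} (Q (𝒪 p K) p) (L (𝒪 p K) p n) i)) ∧
      (∀ i : ℕ, 1 ≤ i → Subsingleton (Abelian.Ext.{u + 1} (Q (𝒪 p K) p) (Q (𝒪 p K) p) i)) ∧
      (∀ i : ℕ, 1 ≤ i → Subsingleton (Abelian.Ext.{u + 1} (X (𝒪 p K) p) (X (𝒪 p K) p) i))) ∧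
    -- the entries of the matrix algebra as `R`-modules
    (Function.Bijective (fun r : R (𝒪 p K) p => r • 𝟙 (L (𝒪 p K) p (-1))) ∧
      Function.Bijective (fun r : R (𝒪 p K) p => r • 𝟙 (L (𝒪 p K) p 1)) ∧
      Function.Bijective (fun r : R (𝒪 p K) p => r • 𝟙 (Q (𝒪 p K) p)) ∧
      Function.Bijective (fun r : R (𝒪 p K) p => r • φ₁₂ (𝒪 p K) p) ∧
      (∃ Ψ : (Q (𝒪 p K) p ⟶ L (𝒪 p K) p (-1)) ≃ₗ[R (𝒪 p K) p]
          Submodule.span (R (𝒪 p K) p) (Set.range (rbc (𝒪 p K) p)),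
        ∀ i : Fin 2, (Ψ (φ₁₃ (𝒪 p K) p i) : R (𝒪 p K) p) = rbc (𝒪 p K) p i) ∧
      (∃ Ψ : (L (𝒪 p K) p (-1) ⟶ L (𝒪 p K) p 1) ≃ₗ[R (𝒪 p K) p]
          Submodule.span (R (𝒪 p K) p) (Set.range (b (𝒪 p K) p)),
        ∀ i : Fin 2, (Ψ (φ₂₁ (𝒪 p K) p i) : S (𝒪 p K) p) = b (𝒪 p K) p i) ∧
      (∃ Ψ : (Q (𝒪 p K) p ⟶ L (𝒪 p K) p 1) ≃ₗ[R (𝒪 p K) p]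
          Submodule.span (R (𝒪 p K) p) (Set.range (b (𝒪 p K) p)),
        ∀ i : Fin 2, (Ψ (φ₂₃ (𝒪 p K) p i) : S (𝒪 p K) p) = b (𝒪 p K) p i) ∧
      Function.Bijective (fun r : R (𝒪 p K) p => r • φ₃₁ (𝒪 p K) p) ∧
      (∀ f : L (𝒪 p K) p 1 ⟶ Q (𝒪 p K) p, ∃ x y : R (𝒪 p K) p,
        f = x • β (𝒪 p K) p + y • φ₃₂ (𝒪 p K) p) ∧
      (∀ x y : R (𝒪 p K) p, x • β (𝒪 p K) p + y • φ₃₂ (𝒪 p K) p = 0 ↔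
        ∃ u v : R (𝒪 p K) p, x = u * rbc (𝒪 p K) p 0 + v * rbc (𝒪 p K) p 1 ∧
          y = -(u * ra₀ (𝒪 p K) p) + v * ra₁' (𝒪 p K) p) ∧
      (∃ Ψ : (L (𝒪 p K) p 1 ⟶ Q (𝒪 p K) p) ≃ₗ[R (𝒪 p K) p]
          Submodule.span (R (𝒪 p K) p) {ra₀ (𝒪 p K) p, rbc (𝒪 p K) p 0},
        (Ψ (β (𝒪 p K) p) : R (𝒪 p K) p) = ra₀ (𝒪 p K) p ∧
        (Ψ (φ₃₂ (𝒪 p K) p) : R (𝒪 p K) p) = rbc (𝒪 p K) p 0)) ∧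
    -- the twelve composition relations; the composite `f ∘ g` is written `g ≫ f`
    (∀ i j : Fin 2,
      φ₂₁ (𝒪 p K) p i ≫ φ₁₂ (𝒪 p K) p = rbc (𝒪 p K) p i • 𝟙 (L (𝒪 p K) p (-1)) ∧
      φ₂₃ (𝒪 p K) p i ≫ φ₁₂ (𝒪 p K) p = φ₁₃ (𝒪 p K) p i ∧
      φ₃₁ (𝒪 p K) p ≫ φ₁₃ (𝒪 p K) p i = rbc (𝒪 p K) p i • 𝟙 (L (𝒪 p K) p (-1)) ∧
      φ₁₂ (𝒪 p K) p ≫ φ₂₁ (𝒪 p K) p i = rbc (𝒪 p K) p i • 𝟙 (L (𝒪 p K) p 1) ∧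
      φ₁₃ (𝒪 p K) p j ≫ φ₂₁ (𝒪 p K) p i = rbc (𝒪 p K) p i • φ₂₃ (𝒪 p K) p j ∧
      φ₃₁ (𝒪 p K) p ≫ φ₂₃ (𝒪 p K) p i = φ₂₁ (𝒪 p K) p i ∧
      φ₁₂ (𝒪 p K) p ≫ φ₃₁ (𝒪 p K) p = φ₃₂ (𝒪 p K) p ∧
      φ₁₃ (𝒪 p K) p i ≫ φ₃₁ (𝒪 p K) p = rbc (𝒪 p K) p i • 𝟙 (Q (𝒪 p K) p) ∧
      (φ₃₂ (𝒪 p K) p ≫ φ₁₃ (𝒪 p K) p i = rbc (𝒪 p K) p i • φ₁₂ (𝒪 p K) p ∧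
        β (𝒪 p K) p ≫ φ₁₃ (𝒪 p K) p 0 = ra₀ (𝒪 p K) p • φ₁₂ (𝒪 p K) p ∧
        β (𝒪 p K) p ≫ φ₁₃ (𝒪 p K) p 1 = (-ra₁' (𝒪 p K) p) • φ₁₂ (𝒪 p K) p) ∧
      (φ₃₂ (𝒪 p K) p ≫ φ₂₃ (𝒪 p K) p i = rbc (𝒪 p K) p i • 𝟙 (L (𝒪 p K) p 1) ∧
        β (𝒪 p K) p ≫ φ₂₃ (𝒪 p K) p 0 = ra₀ (𝒪 p K) p • 𝟙 (L (𝒪 p K) p 1) ∧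
        β (𝒪 p K) p ≫ φ₂₃ (𝒪 p K) p 1 = (-ra₁' (𝒪 p K) p) • 𝟙 (L (𝒪 p K) p 1)) ∧
      (φ₂₁ (𝒪 p K) p i ≫ φ₃₂ (𝒪 p K) p = rbc (𝒪 p K) p i • φ₃₁ (𝒪 p K) p ∧
        φ₂₁ (𝒪 p K) p 0 ≫ β (𝒪 p K) p = ra₀ (𝒪 p K) p • φ₃₁ (𝒪 p K) p ∧
        φ₂₁ (𝒪 p K) p 1 ≫ β (𝒪 p K) p = (-ra₁' (𝒪 p K) p) • φ₃₁ (𝒪 p K) p) ∧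
      (φ₂₃ (𝒪 p K) p i ≫ φ₃₂ (𝒪 p K) p = rbc (𝒪 p K) p i • 𝟙 (Q (𝒪 p K) p) ∧
        φ₂₃ (𝒪 p K) p 0 ≫ β (𝒪 p K) p = ra₀ (𝒪 p K) p • 𝟙 (Q (𝒪 p K) p) ∧
        φ₂₃ (𝒪 p K) p 1 ≫ β (𝒪 p K) p = (-ra₁' (𝒪 p K) p) • 𝟙 (Q (𝒪 p K) p))) ∧
    -- `End(X)` is the `R`-algebra presented by these generators and relations
    (∃ Φ : GMA (𝒪 p K) p ≃ₐ[R (𝒪 p K) p] End (X (𝒪 p K) p),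
      ∀ g : Gen, Φ (GMA.gen (𝒪 p K) p g) = g.toEnd (𝒪 p K) p) := by
  -- The residue field provides the specialization in which `p` vanishes, used to refute
  -- projectivity.
  have hφ : IsLocalRing.residue (𝒪 p K) p = 0 :=
    (IsLocalRing.residue_eq_zero_iff _).2 (PadicIntegers.natCast_mem_maximalIdeal p K)
  refine ⟨⟨fun i hi => ext_Q_S i hi, ?_, not_projective_Q _ p _ hφ⟩,
    ⟨fun n i hi => ext_Q_L n i hi, fun i hi => ext_Q_Q i hi, fun i hi => ext_X_X i hi⟩,
    ⟨end_L_bijective _, end_L_bijective _, end_Q_bijective, hom_φ₁₂_bijective, ?_, ?_, ?_,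
      hom_φ₃₁_bijective, exists_hom_L₁_Q_eq, relation_hom_L₁_Q, exists_hom_L₁_Q⟩,
    fun i j => ⟨φ₂₁_comp_φ₁₂ _ p i, φ₂₃_comp_φ₁₂ _ p i, φ₃₁_comp_φ₁₃ _ p i, φ₁₂_comp_φ₂₁ _ p i,
      φ₁₃_comp_φ₂₁ _ p i j, φ₃₁_comp_φ₂₃ _ p i, φ₁₂_comp_φ₃₁ _ p, φ₁₃_comp_φ₃₁ _ p i,
      ⟨φ₃₂_comp_φ₁₃ _ p i, β_comp_φ₁₃_zero _ p, β_comp_φ₁₃_one _ p⟩,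
      ⟨φ₃₂_comp_φ₂₃ _ p i, β_comp_φ₂₃_zero _ p, β_comp_φ₂₃_one _ p⟩,
      ⟨φ₂₁_comp_φ₃₂ _ p i, φ₂₁_comp_β_zero _ p, φ₂₁_comp_β_one _ p⟩,
      ⟨φ₂₃_comp_φ₃₂ _ p i, φ₂₃_comp_β_zero _ p, φ₂₃_comp_β_one _ p⟩⟩,
    exists_gma_equiv⟩
  · exact isMaximalCohenMacaulay_Q _ p _ (PadicIntegers.natCast_mem_maximalIdeal p K)
      (PadicIntegers.natCast_ne_zero p K) (PadicIntegers.ringKrullDim_le_one p K)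
  · obtain ⟨Ψ, hΨ⟩ := exists_hom_Q_Lneg (O := 𝒪 p K) (p := p)
    exact ⟨Ψ, fun i => Subtype.ext ((hΨ _).trans (valQ_φ₁₃ i))⟩
  · obtain ⟨Ψ, hΨ⟩ := exists_hom_Lneg_L₁ (O := 𝒪 p K) (p := p)
    exact ⟨Ψ, fun i => (hΨ _).trans (valL_φ₂₁ i)⟩
  · obtain ⟨Ψ, hΨ⟩ := exists_hom_Q_L₁ (O := 𝒪 p K) (p := p)
    exact ⟨Ψ, fun i => (hΨ _).trans (valQ_φ₂₃ i)⟩
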